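/- Let $k$ be a field and let $\mathcal A$ be a small DG category over $k$ (morphism spaces are complexes of $k$-vector spaces with differential of degree $1$). Let $G$ be a finite group whose order is invertible in $k$, acting strongly on $\mathcal A$, i.e. we are given a homomorphism from $G$ to the group of DG automorphisms of $\mathcal A$ (with equality, not just isomorphism, of functors). **Semidirect product.** $\mathcal A\rtimes G$ is the DG category with the same objects as $\mathcal A$ and $$\operatorname{Hom}_{\mathcal A\rtimes G}(b,a)=\bigoplus_{g\in G}\operatorname{Hom}_{\mathcal A}(g b,a),\qquad (\alpha_1,g_1)\circ(\alpha_2,g_2)=(\alpha_1\circ g_1(\alpha_2),\,g_1g_2),$$ where $(\alpha,g)$ denotes the element $\alpha$ of the summand indexed by $g$; the grading and the differential are those of $\mathcal A$. **Twisted Hochschild complexes.** For a DG endofunctor $F$ of $\mathcal A$, let $C_\bullet(\mathcal A;F)$ be the complex $$\bigoplus_{n\ge 0}\ \bigoplus_{x_1,\dots,x_{n+1}}\operatorname{Hom}(x_1,Fx_{n+1})\otimes\operatorname{Hom}(x_2,x_1)\otimes\dots\otimes\operatorname{Hom}(x_{n+1},x_n),$$ in which $\alpha_0\otimes\dots\otimes\alpha_n$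 has cohomological degree $\sum_i|\alpha_i|-n$. Its differential sends a chain of homogeneous morphisms to $$(-1)^n\sum_{i=0}^n(-1)^{|\alpha_0|+\dots+|\alpha_{i-1}|}\alpha_0\otimes\dots\otimes d\alpha_i\otimes\dots\otimes\alpha_n+\sum_{i=0}^{n-1}(-1)^i\alpha_0\otimes\dots\otimes\alpha_i\alpha_{i+1}\otimes\dots\otimes\alpha_n$$ $$+\,(-1)^{n+|\alpha_n|(|\alpha_0|+\dots+|\alpha_{n-1}|)}F(\alpha_n)\alpha_0\otimes\alpha_1\otimes\dots\otimes\alpha_{n-1}$$ (for $n=0$ only the first sum is present). Its cohomology is $HH_\bullet(\mathcal A;F)$. For $F=\mathrm{id}$ write $C_\bullet(\mathcal A)$ and $HH_\bullet(\mathcal A)$; for $F$ the action of $g\in G$ write $C_\bullet(\mathcal A;g)$ and $HH_\bullet(\mathcal A;g)$. The group $G$ acts on $\bigoplus_{g}C_\bullet(\mathcal A;g)$ through the maps $C_\bullet(\mathcal A;g)\to C_\bullet(\mathcal A;hgh^{-1})$, $h.(\alpha_0\otimes\dots\otimes\alpha_n)=h(\alpha_0)\otimes\dots\otimes h(\alpha_n)$,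 hence also on $\bigoplus_g HH_\bullet(\mathcal A;g)$; a subscript $G$ denotes coinvariants. **The maps.** Let $$\nu\colon C_\bullet(\mathcal A\rtimes G)\to\Bigl(\bigoplus_{g\in G}C_\bullet(\mathcal A;g)\Bigr)_G$$ send $(\alpha_0,\sigma_0)\otimes\dots\otimes(\alpha_m,\sigma_m)$ to the class of $$(\sigma_0\cdots\sigma_m)^{-1}(\alpha_0)\otimes(\sigma_1\cdots\sigma_m)^{-1}(\alpha_1)\otimes\dots\otimes\sigma_m^{-1}(\alpha_m)\in C_\bullet(\mathcal A;(\sigma_0\cdots\sigma_m)^{-1}).$$ For $g\in G$ let $\xi_g\colon C_\bullet(\mathcal A;g)\to C_\bullet(\mathcal A\rtimes G)$ be $$\xi_g(\alpha_0\otimes\dots\otimes\alpha_m)=\bigl((\mathrm{id},g^{-1})\circ(\alpha_0,1)\bigr)\otimes(\alpha_1,1)\otimes\dots\otimes(\alpha_m,1),$$ and let $\xi\colon\bigl(\bigoplus_{g}C_\bullet(\mathcal A;g)\bigr)_G\to C_\bullet(\mathcal A\rtimes G)$ be the composite of the symmetrisation $[\alpha]\mapsto\frac1{|G|}\sum_{h\in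 G}h.\alpha$ and $\sum_g\xi_g$. **Proposition.** These formulas define (unique) morphisms of complexes $\nu$ and $\xi$. They are mutually inverse homotopy equivalences: $\nu\xi=\mathrm{id}$ and $\xi\nu$ is chain homotopic to $\mathrm{id}$. Moreover, the canonical map $\bigl(\bigoplus_{g}HH_\bullet(\mathcal A;g)\bigr)_G\to H\bigl(\bigl(\bigoplus_gC_\bullet(\mathcal A;g)\bigr)_G\bigr)$ is an isomorphism, and through it $\nu$ and $\xi$ induce mutually inverse isomorphisms $$HH_\bullet(\mathcal A\rtimes G)\;\cong\;\Bigl(\bigoplus_{g\in G}HH_\bullet(\mathcal A;g)\Bigr)_G .$$ -/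

import Mathlib

open CategoryTheory

set_option linter.unusedSectionVars false

universe w₀ u v u' v'

namespace DGHochschild

open scoped Classical

/-- A DG category over a field `k`: a `k`-linear category whose morphism spaces are complexes of
`k`-vector spaces, i.e. carry an internal `ℤ`-grading `gr` and a differential `d` of degree `1`,
such that identities have degree `0` and composition is a morphism of complexes.  Mathlib's
`f ≫ g` is the composite `g ∘ f`. -/
class DGCategory (k : Type w₀) [Field k] (C : Type u) [Category.{v} C] [Preadditive C]
    [Linear k C] where
  gr (X Y : C) : ℤ → Submodule k (X ⟶ Y)
  isInternal (X Y : C) : DirectSum.IsInternal (gr X Y)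
  d (X Y : C) : (X ⟶ Y) →ₗ[k] (X ⟶ Y)
  d_mem {X Y : C} {n : ℤ} {f : X ⟶ Y} (hf : f ∈ gr X Y n) : d X Y f ∈ gr X Y (n + 1)
  d_d {X Y : C} (f : X ⟶ Y) : d X Y (d X Y f) = 0
  id_mem (X : C) : 𝟙 X ∈ gr X X 0
  comp_mem {X Y Z : C} {m n : ℤ} {f : X ⟶ Y} {g : Y ⟶ Z} (hf : f ∈ gr X Y m)
    (hg : g ∈ gr Y Z n) : f ≫ g ∈ gr X Z (n + m)
  d_comp {X Y Z : C} {n : ℤ} (f : X ⟶ Y) {g : Y ⟶ Z} (hg : g ∈ gr Y Z n) :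
    d X Z (f ≫ g) = f ≫ d Y Z g + ((-1 : k) ^ n) • (d X Y f ≫ g)

/-- A DG functor: a functor that is `k`-linear on morphisms, preserves degrees and commutes with
the differentials. -/
class IsDGFunctor (k : Type w₀) [Field k] {C : Type u} [Category.{v} C] [Preadditive C]
    [Linear k C] [DGCategory k C] {D : Type u'} [Category.{v'} D] [Preadditive D]
    [Linear k D] [DGCategory k D] (F : C ⥤ D) : Prop where
  map_add' {X Y : C} (f g : X ⟶ Y) : F.map (f + g) = F.map f + F.map g
  map_smul' {X Y : C} (c : k) (f : X ⟶ Y) : F.map (c • f) = c • F.map f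
  map_mem {X Y : C} {n : ℤ} {f : X ⟶ Y} (hf : f ∈ DGCategory.gr (k := k) X Y n) :
    F.map f ∈ DGCategory.gr (k := k) (F.obj X) (F.obj Y) n
  map_d {X Y : C} (f : X ⟶ Y) : F.map (DGCategory.d (k := k) X Y f) =
    DGCategory.d (k := k) (F.obj X) (F.obj Y) (F.map f)

variable (k : Type w₀) [Field k]

section Basic

variable {C : Type u} [Category.{v} C] [Preadditive C] [Linear k C] [DGCategory k C]
variable {D : Type u'} [Category.{v'} D] [Preadditive D] [Linear k D] [DGCategory k D]

instance isDGFunctor_id : IsDGFunctor k (𝟭 C) where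
  map_add' _ _ := rfl
  map_smul' _ _ := rfl
  map_mem h := h
  map_d _ := rfl

theorem eqToHom_mem {X Y : C} (h : X = Y) : eqToHom h ∈ DGCategory.gr (k := k) X Y 0 := by
  subst h; simpa using DGCategory.id_mem X

theorem d_id (X : C) : DGCategory.d (k := k) X X (𝟙 X) = 0 := by
  have h := DGCategory.d_comp (k := k) (𝟙 X) (DGCategory.id_mem (k := k) X)
  simpa using h

theorem d_eqToHom {X Y : C} (h : X = Y) : DGCategory.d (k := k) X Y (eqToHom h) = 0 := by
  subst h; simpa using d_id k X

theorem eqToHom_comp_mem {X Y Z : C} (h : X = Y) {n : ℤ} {f : Y ⟶ Z}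
    (hf : f ∈ DGCategory.gr (k := k) Y Z n) :
    eqToHom h ≫ f ∈ DGCategory.gr (k := k) X Z n := by
  subst h; simpa using hf

theorem d_eqToHom_comp {X Y Z : C} (h : X = Y) (f : Y ⟶ Z) :
    DGCategory.d (k := k) X Z (eqToHom h ≫ f) = eqToHom h ≫ DGCategory.d (k := k) Y Z f := by
  subst h; simp

/-- The action of a DG functor on morphism spaces, as a linear map. -/
def mapHom (F : C ⥤ D) [IsDGFunctor k F] (X Y : C) : (X ⟶ Y) →ₗ[k] (F.obj X ⟶ F.obj Y) where
  toFun f := F.map f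
  map_add' := IsDGFunctor.map_add' k
  map_smul' := IsDGFunctor.map_smul'

end Basic

section SemidirectProduct

/-- A strong action of a group `G` on a DG category: a homomorphism from `G` to the group of
DG automorphisms of `C`, with equalities (not just isomorphisms) of functors. -/
structure StrongAction (G : Type v) [Group G] (C : Type u) [Category.{v} C] [Preadditive C]
    [Linear k C] [DGCategory k C] where
  F : G → (C ⥤ C)
  isDG (g : G) : IsDGFunctor k (F g)
  map_one : F 1 = 𝟭 C
  map_mul (g h : G) : F (g * h) = F h ⋙ F g

attribute [instance] StrongAction.isDG

variable {k}
variable {G : Type v} [Group G] {C : Type u} [Category.{v} C] [Preadditive C] [Linear k C]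
  [DGCategory k C] (ρ : StrongAction k G C)

namespace StrongAction

theorem obj_one (X : C) : (ρ.F 1).obj X = X := by rw [ρ.map_one]; rfl

theorem obj_mul (g h : G) (X : C) : (ρ.F (g * h)).obj X = (ρ.F g).obj ((ρ.F h).obj X) := by
  rw [ρ.map_mul]; rfl

theorem map_one_hom {X Y : C} (f : X ⟶ Y) :
    (ρ.F 1).map f = eqToHom (ρ.obj_one X) ≫ f ≫ eqToHom (ρ.obj_one Y).symm := by
  simpa using Functor.congr_hom ρ.map_one f

theorem map_mul_hom (g h : G) {X Y : C} (f : X ⟶ Y) :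
    (ρ.F (g * h)).map f = eqToHom (ρ.obj_mul g h X) ≫ (ρ.F g).map ((ρ.F h).map f) ≫
      eqToHom (ρ.obj_mul g h Y).symm := by
  simpa using Functor.congr_hom (ρ.map_mul g h) f

end StrongAction

/-- The semidirect product `C ⋊ G` has the same objects as `C`. -/
structure Semidirect {G : Type v} [Group G] {C : Type u} [Category.{v} C] [Preadditive C]
    [Linear k C] [DGCategory k C] (ρ : StrongAction k G C) where
  obj : C

namespace Semidirect

variable {ρ}

/-- Morphisms `X ⟶ Y` in `C ⋊ G`: the direct sum over `g` of the spaces of morphisms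
`g X ⟶ Y` in `C`. -/
abbrev Hom (X Y : Semidirect ρ) : Type v :=
  DirectSum G fun g => ((ρ.F g).obj X.obj ⟶ Y.obj)

/-- The morphism `(α, g)` of `C ⋊ G` for `α : g X ⟶ Y`. -/
noncomputable def homMk (X Y : Semidirect ρ) (g : G) : ((ρ.F g).obj X.obj ⟶ Y.obj) →ₗ[k] Hom X Y :=
  DirectSum.lof k G (fun g => ((ρ.F g).obj X.obj ⟶ Y.obj)) g

theorem homMk_congr {X Y : Semidirect ρ} {g h : G} (e : g = h)
    (α : (ρ.F h).obj X.obj ⟶ Y.obj) :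
    homMk X Y g (eqToHom (by rw [e]) ≫ α) = homMk X Y h α := by
  subst e; simp

/-- The composition `(α₁, g₁) ∘ (α₂, g₂) = (α₁ ∘ g₁.α₂, g₁ g₂)`, extended bilinearly. The
`eqToHom` only identifies the equal objects `(g₁ g₂) X` and `g₁ (g₂ X)`. -/
noncomputable def compMk (X Y Z : Semidirect ρ) (g₁ g₂ : G) :
    ((ρ.F g₁).obj Y.obj ⟶ Z.obj) →ₗ[k] ((ρ.F g₂).obj X.obj ⟶ Y.obj) →ₗ[k] Hom X Z :=
  LinearMap.mk₂ k (fun α₁ α₂ => homMk X Z (g₁ * g₂)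
      (eqToHom (ρ.obj_mul g₁ g₂ X.obj) ≫ (ρ.F g₁).map α₂ ≫ α₁))
    (fun _ _ _ => by simp)
    (fun _ _ _ => by simp)
    (fun _ _ _ => by simp [IsDGFunctor.map_add' k])
    (fun _ _ _ => by simp [IsDGFunctor.map_smul'])

noncomputable def compHom (X Y Z : Semidirect ρ) : Hom Y Z →ₗ[k] Hom X Y →ₗ[k] Hom X Z :=
  DirectSum.toModule k G _ fun g₁ =>
    (DirectSum.toModule k G _ fun g₂ => (compMk X Y Z g₁ g₂).flip).flip

theorem compHom_mk {X Y Z : Semidirect ρ} (g₁ g₂ : G) (α₁ : (ρ.F g₁).obj Y.obj ⟶ Z.obj)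
    (α₂ : (ρ.F g₂).obj X.obj ⟶ Y.obj) :
    compHom X Y Z (homMk Y Z g₁ α₁) (homMk X Y g₂ α₂) = homMk X Z (g₁ * g₂)
      (eqToHom (ρ.obj_mul g₁ g₂ X.obj) ≫ (ρ.F g₁).map α₂ ≫ α₁) := by
  simp [compHom, homMk, compMk, DirectSum.toModule_lof]

theorem hom_induction {X Y : Semidirect ρ} {p : Hom X Y → Prop} (f : Hom X Y) (h0 : p 0)
    (hmk : ∀ g α, p (homMk X Y g α)) (hadd : ∀ f f', p f → p f' → p (f + f')) : p f :=
  DirectSum.induction_on f h0 hmk hadd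

/-- The identity of `X` in `C ⋊ G` is `(id, 1)`. -/
noncomputable def idHom (X : Semidirect ρ) : Hom X X :=
  homMk X X 1 (eqToHom (ρ.obj_one X.obj))

theorem compHom_id {X Y : Semidirect ρ} (f : Hom X Y) : compHom X X Y f (idHom X) = f := by
  induction f using hom_induction with
  | h0 => simp
  | hmk g α =>
    rw [idHom, compHom_mk]
    convert homMk_congr (mul_one g) α using 2
    simp [eqToHom_map]
  | hadd f f' hf hf' => simp [hf, hf']

theorem id_compHom {X Y : Semidirect ρ} (f : Hom X Y) : compHom X Y Y (idHom Y) f = f := by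
  induction f using hom_induction with
  | h0 => simp
  | hmk g α =>
    rw [idHom, compHom_mk]
    convert homMk_congr (one_mul g) α using 2
    simp [StrongAction.map_one_hom]
  | hadd f f' hf hf' => simp [hf, hf']

theorem compHom_assoc {W X Y Z : Semidirect ρ} (f : Hom W X) (g : Hom X Y) (h : Hom Y Z) :
    compHom W X Z (compHom X Y Z h g) f = compHom W Y Z h (compHom W X Y g f) := by
  induction f using hom_induction with
  | h0 => simp
  | hadd f f' hf hf' => simp [hf, hf']
  | hmk a α =>
    induction g using hom_induction with
    | h0 => simp
    | hadd f f' hf hf' => simp [hf, hf']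
    | hmk b β =>
      induction h using hom_induction with
      | h0 => simp
      | hadd f f' hf hf' => simp [hf, hf']
      | hmk c γ =>
        simp only [compHom_mk]
        rw [← homMk_congr (mul_assoc c b a)]
        congr 1
        simp [StrongAction.map_mul_hom, eqToHom_map]

noncomputable instance : Category.{v} (Semidirect ρ) where
  Hom X Y := Hom X Y
  id X := idHom X
  comp {X Y Z} f g := compHom X Y Z g f
  id_comp := compHom_id
  comp_id := id_compHom
  assoc f g h := (compHom_assoc f g h).symm

theorem comp_def {X Y Z : Semidirect ρ} (f : X ⟶ Y) (g : Y ⟶ Z) :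
    f ≫ g = compHom X Y Z g f := rfl

noncomputable instance : Preadditive (Semidirect ρ) where
  homGroup X Y := inferInstanceAs (AddCommGroup (Hom X Y))
  add_comp X Y Z f f' g := (compHom X Y Z g).map_add f f'
  comp_add X Y Z f g g' := 
    LinearMap.congr_fun ((compHom X Y Z).map_add g g') f

noncomputable instance : Linear k (Semidirect ρ) where
  homModule X Y := inferInstanceAs (Module k (Hom X Y))
  smul_comp X Y Z r f g := (compHom X Y Z g).map_smul r f
  comp_smul X Y Z f r g := 
    LinearMap.congr_fun ((compHom X Y Z).map_smul r g) f

end Semidirect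

/-- The elements of degree `n` of a direct sum of graded vector spaces. -/
def sumGr {ι : Type*} {M : ι → Type*} [∀ i, AddCommGroup (M i)] [∀ i, Module k (M i)]
    (gr : ∀ i, ℤ → Submodule k (M i)) (n : ℤ) : Submodule k (DirectSum ι M) where
  carrier := {f | ∀ i, f i ∈ gr i n}
  add_mem' hf hg i := by simpa using add_mem (hf i) (hg i)
  zero_mem' i := by simp
  smul_mem' c f hf i := by
    rw [DirectSum.smul_apply]; exact (gr i n).smul_mem c (hf i)

theorem lof_mem_sumGr {ι : Type*} {M : ι → Type*} [∀ i, AddCommGroup (M i)]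
    [∀ i, Module k (M i)] (gr : ∀ i, ℤ → Submodule k (M i)) (n : ℤ) (i : ι) {x : M i}
    (hx : x ∈ gr i n) : DirectSum.lof k ι M i x ∈ sumGr gr n := by
  intro j
  by_cases h : i = j
  · subst h; simpa [DirectSum.lof_apply] using hx
  · rw [DirectSum.lof_eq_of, DirectSum.of_eq_of_ne _ _ _ (Ne.symm h)]; simp

theorem sumGr_isInternal {ι : Type*} {M : ι → Type*} [∀ i, AddCommGroup (M i)]
    [∀ i, Module k (M i)] (gr : ∀ i, ℤ → Submodule k (M i))
    (h : ∀ i, DirectSum.IsInternal (gr i)) : DirectSum.IsInternal (sumGr gr) := by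
  constructor
  · rw [injective_iff_map_eq_zero]
    intro x hx
    ext p i
    let Φ : DirectSum ℤ (fun p => sumGr gr p) →ₗ[k] DirectSum ℤ (fun p => gr i p) :=
      DirectSum.lmap fun p => ((DirectSum.component k ι M i).comp (sumGr gr p).subtype).codRestrict
        (gr i p) (fun f => f.2 i)
    have key : (DirectSum.coeLinearMap (gr i)) ∘ₗ Φ =
        (DirectSum.component k ι M i) ∘ₗ DirectSum.coeLinearMap (sumGr gr) := by
      ext p y
      simp [Φ, DirectSum.lmap_lof, DirectSum.component]
    have h0 : Φ x = 0 := by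
      apply (h i).1
      have := LinearMap.congr_fun key x
      rw [LinearMap.comp_apply, LinearMap.comp_apply] at this
      rw [map_zero]
      refine this.trans ?_
      have hx' : DirectSum.coeLinearMap (sumGr gr) x = 0 := hx
      rw [hx', map_zero]
    have h1 : ((Φ x) p : M i) = (x p : DirectSum ι M) i := by
      simp only [Φ, DirectSum.lmap_apply]; rfl
    rw [h0] at h1
    simpa using h1.symm
  · intro f
    induction f using DirectSum.induction_on with
    | zero => exact ⟨0, map_zero _⟩
    | add f g hf hg =>
      obtain ⟨a, rfl⟩ := hf
      obtain ⟨b, rfl⟩ := hg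
      exact ⟨a + b, map_add _ _ _⟩
    | of i x =>
      obtain ⟨y, rfl⟩ := (h i).2 x
      induction y using DirectSum.induction_on with
      | zero => exact ⟨0, by simp⟩
      | add y z hy hz =>
        obtain ⟨a, ha⟩ := hy
        obtain ⟨b, hb⟩ := hz
        exact ⟨a + b, by rw [map_add, ha, hb, map_add, map_add]⟩
      | of p y =>
        exact ⟨DirectSum.of (fun p => sumGr gr p) p
          ⟨DirectSum.lof k ι M i y, lof_mem_sumGr gr p i y.2⟩, by simp [DirectSum.lof_eq_of]⟩

namespace Semidirect

variable {ρ}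

/-- `deg (α, g) = deg α`. -/
def homGr (X Y : Semidirect ρ) (n : ℤ) : Submodule k (Hom X Y) :=
  sumGr (fun g => DGCategory.gr (k := k) ((ρ.F g).obj X.obj) Y.obj) n

/-- `d (α, g) = (d α, g)`. -/
noncomputable def homD (X Y : Semidirect ρ) : Hom X Y →ₗ[k] Hom X Y :=
  DirectSum.lmap fun g => DGCategory.d (k := k) ((ρ.F g).obj X.obj) Y.obj

theorem homD_mk {X Y : Semidirect ρ} (g : G) (α : (ρ.F g).obj X.obj ⟶ Y.obj) :
    homD X Y (homMk X Y g α) = homMk X Y g (DGCategory.d (k := k) _ _ α) := by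
  simp [homD, homMk, DirectSum.lmap_lof]

theorem homMk_mem {X Y : Semidirect ρ} (g : G) {n : ℤ} {α : (ρ.F g).obj X.obj ⟶ Y.obj}
    (h : α ∈ DGCategory.gr (k := k) _ _ n) : homMk X Y g α ∈ homGr X Y n :=
  lof_mem_sumGr _ n g h

theorem homGr_induction {X Y : Semidirect ρ} {n : ℤ} {p : Hom X Y → Prop} (f : Hom X Y)
    (hf : f ∈ homGr X Y n) (h0 : p 0)
    (hmk : ∀ g α, α ∈ DGCategory.gr (k := k) _ _ n → p (homMk X Y g α))
    (hadd : ∀ f f', p f → p f' → p (f + f')) : p f := by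
  rw [← DirectSum.sum_support_of f]
  refine Finset.sum_induction _ p hadd h0 fun g _ => hmk g _ (hf g)

noncomputable instance : DGCategory k (Semidirect ρ) where
  gr X Y n := homGr X Y n
  isInternal X Y := sumGr_isInternal _ fun g => DGCategory.isInternal _ _
  d X Y := homD X Y
  d_mem {X Y n f} hf g := by
    rw [homD, DirectSum.lmap_apply]
    exact DGCategory.d_mem (hf g)
  d_d {X Y} f := by
    induction f using hom_induction with
    | h0 => simp
    | hadd f f' hf hf' => simp [hf, hf']
    | hmk a α => 
      rw [homD_mk, homD_mk, DGCategory.d_d, map_zero]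
  id_mem X := homMk_mem 1 (eqToHom_mem k _)
  comp_mem {X Y Z m n f g} hf hg := by
    refine homGr_induction (p := fun f => compHom X Y Z g f ∈ homGr X Z (n + m)) f hf
      (by rw [map_zero]; exact zero_mem _) ?_ (fun f f' h h' => by
      rw [map_add]; exact add_mem h h')
    intro a α hα
    refine homGr_induction (p := fun g => compHom X Y Z g (homMk X Y a α) ∈ homGr X Z (n + m)) g hg
      (by rw [map_zero]; exact zero_mem _) ?_ (fun f f' h h' => by
      rw [map_add]; exact add_mem h h')
    intro b β hβ
    rw [compHom_mk]
    exact homMk_mem _ (eqToHom_comp_mem k _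
      (DGCategory.comp_mem (IsDGFunctor.map_mem hα) hβ))
  d_comp {X Y Z n} f g hg := by
    refine homGr_induction (p := fun g => homD X Z (compHom X Y Z g f) =
      compHom X Y Z (homD Y Z g) f + ((-1 : k) ^ n) • compHom X Y Z g (homD X Y f)) g hg (by simp)
      ?_ (fun g g' h h' => by
      simp only [map_add, LinearMap.add_apply, smul_add, h, h']; abel)
    intro b β hβ
    induction f using hom_induction with
    | h0 => simp
    | hadd f f' h h' => simp only [map_add, smul_add, h, h']; abel
    | hmk a α =>
      rw [compHom_mk, homD_mk, homD_mk, homD_mk, compHom_mk, compHom_mk, d_eqToHom_comp,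
        DGCategory.d_comp _ hβ, IsDGFunctor.map_d, Preadditive.comp_add, Linear.comp_smul, map_add,
        map_smul]

end Semidirect
end SemidirectProduct

section Total

variable (C : Type u) [Category.{v} C] [Preadditive C]

/-- The total morphism space of a category: the direct sum of all the spaces `X ⟶ Y`. -/
def Tot : Type (max u v) := DirectSum (C × C) fun P => (P.1 ⟶ P.2)

noncomputable instance : AddCommGroup (Tot C) :=
  inferInstanceAs (AddCommGroup (DirectSum (C × C) fun P => (P.1 ⟶ P.2)))

noncomputable instance [Linear k C] : Module k (Tot C) :=
  inferInstanceAs (Module k (DirectSum (C × C) fun P => (P.1 ⟶ P.2)))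

variable {C}
variable [Linear k C] [DGCategory k C]
variable {D : Type u'} [Category.{v'} D] [Preadditive D] [Linear k D] [DGCategory k D]

/-- A morphism, as an element of the total morphism space. -/
noncomputable def inc {X Y : C} : (X ⟶ Y) →ₗ[k] Tot C :=
  DirectSum.lof k (C × C) (fun P => (P.1 ⟶ P.2)) (X, Y)

/-- The linear map on the total morphism space with given values on morphisms. -/
noncomputable def lift {M : Type*} [AddCommGroup M] [Module k M]
    (φ : ∀ X Y : C, (X ⟶ Y) →ₗ[k] M) : Tot C →ₗ[k] M :=
  DirectSum.toModule k (C × C) M fun P => φ P.1 P.2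

theorem lift_inc {M : Type*} [AddCommGroup M] [Module k M]
    (φ : ∀ X Y : C, (X ⟶ Y) →ₗ[k] M) {X Y : C} (f : X ⟶ Y) : lift k φ (inc k f) = φ X Y f :=
  DirectSum.toModule_lof (φ := fun P : C × C => φ P.1 P.2) k (X, Y) f

/-- The composite `f ∘ g` of `f : X ⟶ Y` and `g : Z ⟶ W` in the total morphism space; it is `0`
if `f` and `g` are not composable, i.e. if `W ≠ X`. -/
noncomputable def mulInc (X Y Z W : C) : (X ⟶ Y) →ₗ[k] (Z ⟶ W) →ₗ[k] Tot C :=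
  if h : W = X then
    LinearMap.mk₂ k (fun f g => inc k (g ≫ eqToHom h ≫ f)) (fun _ _ _ => by simp)
      (fun _ _ _ => by simp) (fun _ _ _ => by simp) (fun _ _ _ => by simp)
  else 0

/-- The bilinear extension of composition to the total morphism space. -/
noncomputable def mul : Tot C →ₗ[k] Tot C →ₗ[k] Tot C :=
  lift k fun X Y => (lift k fun Z W => (mulInc k X Y Z W).flip).flip

theorem mul_inc_inc {X Y Z W : C} (f : X ⟶ Y) (g : Z ⟶ W) :
    mul k (inc k f) (inc k g) =
      if h : W = X then inc k (g ≫ eqToHom h ≫ f) else (0 : Tot C) := by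
  simp only [mul, lift_inc, LinearMap.flip_apply, mulInc]
  split_ifs with h <;> simp

theorem mul_inc {X Y Z : C} (f : Y ⟶ Z) (g : X ⟶ Y) :
    mul k (inc k f) (inc k g) = inc k (g ≫ f) := by
  simp [mul_inc_inc]

theorem coe_bijective (X Y : C) :
    Function.Bijective (DirectSum.coeLinearMap (DGCategory.gr (k := k) X Y)) :=
  DGCategory.isInternal X Y

/-- The operator that multiplies the elements of degree `p` by `c p`. -/
noncomputable def scaleHom (c : ℤ → k) (X Y : C) : (X ⟶ Y) →ₗ[k] (X ⟶ Y) :=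
  DirectSum.coeLinearMap (DGCategory.gr X Y) ∘ₗ
    DirectSum.lmap (fun p => c p • LinearMap.id) ∘ₗ
      (LinearEquiv.ofBijective (DirectSum.coeLinearMap (DGCategory.gr (k := k) X Y))
        (coe_bijective k X Y)).symm.toLinearMap

theorem scaleHom_of_mem (c : ℤ → k) {X Y : C} {p : ℤ} {f : X ⟶ Y}
    (hf : f ∈ DGCategory.gr (k := k) X Y p) : scaleHom k c X Y f = c p • f := by
  have : (LinearEquiv.ofBijective (DirectSum.coeLinearMap (DGCategory.gr (k := k) X Y))
        (coe_bijective k X Y)).symm f =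
      DirectSum.lof k ℤ (fun p => DGCategory.gr (k := k) X Y p) p ⟨f, hf⟩ := by
    rw [LinearEquiv.symm_apply_eq]
    simp
  simp [scaleHom, this, DirectSum.lmap_lof]

/-- The operator `scaleHom` on the total morphism space. -/
noncomputable def scale (c : ℤ → k) : Tot C →ₗ[k] Tot C :=
  lift k fun X Y => inc k ∘ₗ scaleHom k c X Y

/-- The Koszul sign operator `f ↦ (-1)^|f| f`. -/
noncomputable abbrev eps : Tot C →ₗ[k] Tot C := scale k fun p => (-1) ^ p

/-- The projections to the parts of even and odd degree. -/
noncomputable abbrev evenPart : Tot C →ₗ[k] Tot C := scale k fun p => if Even p then 1 else 0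

noncomputable abbrev oddPart : Tot C →ₗ[k] Tot C := scale k fun p => if Even p then 0 else 1

/-- The differential on the total morphism space. -/
noncomputable def dTot : Tot C →ₗ[k] Tot C :=
  lift k fun X Y => inc k ∘ₗ DGCategory.d X Y

/-- The action of a DG functor on the total morphism spaces. -/
noncomputable def mapTot (F : C ⥤ D) [IsDGFunctor k F] : Tot C →ₗ[k] Tot D :=
  lift k fun X Y => inc k ∘ₗ mapHom k F X Y

theorem scale_inc (c : ℤ → k) {X Y : C} {p : ℤ} {f : X ⟶ Y}
    (hf : f ∈ DGCategory.gr (k := k) X Y p) : scale k c (inc k f) = c p • inc k f := by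
  simp [scale, lift_inc, scaleHom_of_mem k c hf]

theorem dTot_inc {X Y : C} (f : X ⟶ Y) :
    dTot k (inc k f) = inc k (DGCategory.d (k := k) X Y f) := by
  simp [dTot, lift_inc]

theorem mapTot_inc (F : C ⥤ D) [IsDGFunctor k F] {X Y : C} (f : X ⟶ Y) :
    mapTot k F (inc k f) = inc k (F.map f) := by
  simp [mapTot, lift_inc, mapHom]

/-- `a` is a morphism `X ⟶ Y` of degree `p`. -/
def IsArrow (X Y : C) (p : ℤ) (a : Tot C) : Prop :=
  ∃ f : X ⟶ Y, f ∈ DGCategory.gr (k := k) X Y p ∧ a = inc k f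

/-- The total morphism space is spanned by the homogeneous morphisms. -/
theorem tot_induction {P : Tot C → Prop} (x : Tot C) (h0 : P 0)
    (hmk : ∀ X Y p a, IsArrow k X Y p a → P a) (hadd : ∀ x y, P x → P y → P (x + y)) : P x := by
  induction x using DirectSum.induction_on with
  | zero => exact h0
  | add x y hx hy => exact hadd x y hx hy
  | of P' f =>
    obtain ⟨X, Y⟩ := P'
    change P (inc k f)
    obtain ⟨y, rfl⟩ := (coe_bijective k X Y).2 f
    induction y using DirectSum.induction_on with
    | zero => simpa using h0
    | add x y hx hy => rw [map_add, map_add]; exact hadd _ _ hx hy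
    | of p y => exact hmk X Y p _ ⟨y, y.2, by simp⟩

variable {k}

theorem IsArrow.mul {X Y Z : C} {p q : ℤ} {a b : Tot C} (ha : IsArrow k Y Z p a)
    (hb : IsArrow k X Y q b) : IsArrow k X Z (p + q) (mul k a b) := by
  obtain ⟨f, hf, rfl⟩ := ha
  obtain ⟨g, hg, rfl⟩ := hb
  exact ⟨_, DGCategory.comp_mem hg hf, mul_inc k f g⟩

theorem IsArrow.d {X Y : C} {p : ℤ} {a : Tot C} (ha : IsArrow k X Y p a) :
    IsArrow k X Y (p + 1) (dTot k a) := by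
  obtain ⟨f, hf, rfl⟩ := ha
  exact ⟨_, DGCategory.d_mem hf, dTot_inc k f⟩

theorem IsArrow.map (F : C ⥤ D) [IsDGFunctor k F] {X Y : C} {p : ℤ} {a : Tot C}
    (ha : IsArrow k X Y p a) : IsArrow k (F.obj X) (F.obj Y) p (mapTot k F a) := by
  obtain ⟨f, hf, rfl⟩ := ha
  exact ⟨_, IsDGFunctor.map_mem hf, mapTot_inc k F f⟩

theorem IsArrow.scale (c : ℤ → k) {X Y : C} {p : ℤ} {a : Tot C} (ha : IsArrow k X Y p a) :
    scale k c a = c p • a := by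
  obtain ⟨f, hf, rfl⟩ := ha
  exact scale_inc k c hf

theorem IsArrow.map_mul (F : C ⥤ D) [IsDGFunctor k F] {X Y Z : C} {p q : ℤ} {a b : Tot C}
    (ha : IsArrow k Y Z p a) (hb : IsArrow k X Y q b) :
    mapTot k F (DGHochschild.mul k a b) = DGHochschild.mul k (mapTot k F a) (mapTot k F b) := by
  obtain ⟨f, hf, rfl⟩ := ha
  obtain ⟨g, hg, rfl⟩ := hb
  simp [mul_inc, mapTot_inc]

variable (k)

theorem mul_eq_zero {X Y Z W : C} {p q : ℤ} {a b : Tot C} (ha : IsArrow k X Y p a)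
    (hb : IsArrow k Z W q b) (h : W ≠ X) : mul k a b = 0 := by
  obtain ⟨f, hf, rfl⟩ := ha
  obtain ⟨g, hg, rfl⟩ := hb
  simp [mul_inc_inc, h]

theorem mul_assoc_tot (x y z : Tot C) : mul k (mul k x y) z = mul k x (mul k y z) := by
  induction x using tot_induction k (C := C) with
  | h0 => simp
  | hadd _ _ h h' => simp [h, h']
  | hmk X Y p a ha0 =>
    obtain ⟨f, -, rfl⟩ := ha0
    induction y using tot_induction k (C := C) with
    | h0 => simp
    | hadd _ _ h h' => simp [h, h']
    | hmk X' Y' p' a ha1 =>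
      obtain ⟨g, -, rfl⟩ := ha1
      induction z using tot_induction k (C := C) with
      | h0 => simp
      | hadd _ _ h h' => simp [h, h']
      | hmk X'' Y'' p'' a ha2 =>
        obtain ⟨h, -, rfl⟩ := ha2
        by_cases h₁ : Y' = X
        · subst h₁
          by_cases h₂ : Y'' = X'
          · subst h₂
            simp [mul_inc]
          · simp [mul_inc, mul_inc_inc, h₂]
        · by_cases h₂ : Y'' = X'
          · subst h₂
            simp [mul_inc, mul_inc_inc, h₁]
          · simp [mul_inc_inc, h₁, h₂]

theorem dTot_dTot (x : Tot C) : dTot k (dTot k x) = 0 := by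
  induction x using tot_induction k (C := C) with
  | h0 => simp
  | hadd _ _ h h' => simp [h, h']
  | hmk X Y p a ha0 =>
    obtain ⟨f, -, rfl⟩ := ha0
    simp [dTot_inc, DGCategory.d_d]

theorem dTot_scale (c c' : ℤ → k) (h : ∀ p, c p = c' (p + 1)) (x : Tot C) :
    dTot k (scale k c x) = scale k c' (dTot k x) := by
  induction x using tot_induction k (C := C) with
  | h0 => simp
  | hadd _ _ h h' => simp [h, h']
  | hmk X Y p a ha =>
    rw [ha.scale, ha.d.scale, map_smul, h]

theorem scale_scale (c c' : ℤ → k) (x : Tot C) :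
    scale k c (scale k c' x) = scale k (fun p => c p * c' p) x := by
  induction x using tot_induction k (C := C) with
  | h0 => simp
  | hadd _ _ h h' => simp [h, h']
  | hmk X Y p a ha =>
    rw [ha.scale, ha.scale, map_smul, ha.scale, smul_smul, mul_comm]

theorem mapTot_scale (F : C ⥤ D) [IsDGFunctor k F] (c : ℤ → k) (x : Tot C) :
    mapTot k F (scale k c x) = scale k c (mapTot k F x) := by
  induction x using tot_induction k (C := C) with
  | h0 => simp
  | hadd _ _ h h' => simp [h, h']
  | hmk X Y p a ha =>
    rw [ha.scale, (ha.map F).scale, map_smul]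

theorem mapTot_dTot (F : C ⥤ D) [IsDGFunctor k F] (x : Tot C) :
    mapTot k F (dTot k x) = dTot k (mapTot k F x) := by
  induction x using tot_induction k (C := C) with
  | h0 => simp
  | hadd _ _ h h' => simp [h, h']
  | hmk X Y p a ha0 =>
    obtain ⟨f, -, rfl⟩ := ha0
    simp [dTot_inc, mapTot_inc, IsDGFunctor.map_d]

theorem eps_mul (x y : Tot C) : eps k (mul k x y) = mul k (eps k x) (eps k y) := by
  induction x using tot_induction k (C := C) with
  | h0 => simp
  | hadd _ _ h h' => simp [h, h']
  | hmk X Y p a ha =>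
    induction y using tot_induction k (C := C) with
    | h0 => simp
    | hadd _ _ h h' => simp [h, h']
    | hmk Z W q b hb =>
      rw [ha.scale, hb.scale]
      by_cases h : W = X
      · subst h
        rw [(ha.mul hb).scale, zpow_add₀ (by simp), map_smul, map_smul, LinearMap.smul_apply,
          smul_smul, mul_comm]
      · simp [mul_eq_zero k ha hb h]

theorem dTot_mul (x y : Tot C) :
    dTot k (mul k x y) = mul k (dTot k x) y + mul k (eps k x) (dTot k y) := by
  induction x using tot_induction k (C := C) with
  | h0 => simp
  | hadd _ _ h h' => simp [h, h']; abel
  | hmk X Y p a ha =>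
    induction y using tot_induction k (C := C) with
    | h0 => simp
    | hadd _ _ h h' => simp [h, h']; abel
    | hmk Z W q b hb =>
      rw [ha.scale]
      by_cases h : W = X
      · subst h
        obtain ⟨f, hf, rfl⟩ := ha
        obtain ⟨g, hg, rfl⟩ := hb
        simp [mul_inc, dTot_inc, DGCategory.d_comp _ hf]
      · simp [mul_eq_zero k ha hb h, mul_eq_zero k ha.d hb h, mul_eq_zero k ha hb.d h]

end Total

section Tensors

open PiTensorProduct
open scoped TensorProduct

/-- Merging the entries `i` and `i + 1` of a string by means of `op`. -/
def merge {α : Type*} {n : ℕ} (op : α → α → α) (i : Fin (n + 1)) (v : Fin (n + 2) → α) :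
    Fin (n + 1) → α :=
  Fin.contractNth i.castSucc op v

section merge

variable {α : Type*} {n : ℕ} (op : α → α → α)

theorem merge_lt {i : Fin (n + 1)} {v : Fin (n + 2) → α} {l : Fin (n + 1)} (h : l < i) :
    merge op i v l = v l.castSucc :=
  Fin.contractNth_apply_of_lt _ _ _ _ (by simpa using h)

theorem merge_eq {i : Fin (n + 1)} {v : Fin (n + 2) → α} :
    merge op i v i = op (v i.castSucc) (v i.succ) :=
  Fin.contractNth_apply_of_eq _ _ _ _ (by simp)

theorem merge_gt {i : Fin (n + 1)} {v : Fin (n + 2) → α} {l : Fin (n + 1)} (h : i < l) :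
    merge op i v l = v l.succ :=
  Fin.contractNth_apply_of_gt _ _ _ _ (by simpa using h)

theorem merge_merge (hop : ∀ a b c, op (op a b) c = op a (op b c)) (i : Fin (n + 1))
    (j : Fin (n + 2)) (hj : j ≤ i.castSucc) (v : Fin (n + 3) → α) :
    merge op i (merge op j v) =
      merge op (j.castLT (lt_of_le_of_lt hj i.castSucc_lt_last)) (merge op i.succ v) := by
  funext l
  simp only [merge, Fin.contractNth, Fin.val_castSucc, Fin.val_succ, Fin.val_castLT]
  have hj' : (j : ℕ) ≤ i := hj
  split_ifs <;> first | rfl | (exfalso; omega) | (rw [hop]; rfl) 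

/-- Moving the last entry of a string to the front and applying `f` to it. -/
def rotate (f : α → α) (v : Fin (n + 1) → α) : Fin (n + 1) → α :=
  Fin.cons (f (v (Fin.last n))) (Fin.init v)

theorem rotate_merge_castSucc (f : α → α) (j : Fin (n + 1)) (v : Fin (n + 3) → α) :
    rotate f (merge op j.castSucc v) = merge op j.succ (rotate f v) := by
  funext l
  refine Fin.cases ?_ (fun l => ?_) l
  · rw [merge_lt _ (Fin.succ_pos j)]
    simp only [rotate, Fin.cons_zero, Fin.castSucc_zero]
    rw [merge_gt _ (Fin.castSucc_lt_last j), Fin.succ_last]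
  · rcases lt_trichotomy l j with h | h | h
    · rw [merge_lt _ (Fin.succ_lt_succ_iff.2 h)]
      simp only [rotate, Fin.cons_succ, Fin.init, Fin.castSucc_succ]
      rw [merge_lt _ (by simpa using h)]
    · subst h
      rw [merge_eq]
      simp only [rotate, Fin.cons_succ, Fin.init, Fin.castSucc_succ]
      rw [merge_eq]
    · rw [merge_gt _ (Fin.succ_lt_succ_iff.2 h)]
      simp only [rotate, Fin.cons_succ, Fin.init]
      rw [merge_gt _ (by simpa using h)]
      rfl

theorem rotate_merge_last (f : α → α) (v : Fin (n + 2) → α)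
    (hf : f (op (v (Fin.last n).castSucc) (v (Fin.last (n + 1)))) =
      op (f (v (Fin.last n).castSucc)) (f (v (Fin.last (n + 1))))) :
    rotate f (merge op (Fin.last n) v) = merge op 0 (rotate f (rotate f v)) := by
  funext l
  refine Fin.cases ?_ (fun l => ?_) l
  · rw [merge_eq]
    simp only [rotate, Fin.cons_zero]
    rw [merge_eq, Fin.succ_last, hf]
    congr 1
  · rw [merge_gt _ (Fin.succ_pos l)]
    simp only [rotate, Fin.cons_succ, Fin.init, Fin.castSucc_succ]
    rw [merge_lt _ (Fin.castSucc_lt_last l)]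

end merge

variable {C : Type u} [Category.{v} C] [Preadditive C] [Linear k C] [DGCategory k C]
variable {D : Type u'} [Category.{v'} D] [Preadditive D] [Linear k D] [DGCategory k D]

/-- Composition of total morphisms as a binary operation. -/
noncomputable abbrev cmp (x y : Tot C) : Tot C := mul k x y

theorem merge_update {n : ℕ} (i : Fin (n + 1)) (v : Fin (n + 2) → Tot C) (j : Fin (n + 2)) :
    ∃ (l : Fin (n + 1)) (L : Tot C →ₗ[k] Tot C), ∀ x,
      merge (cmp k) i (Function.update v j x) =
        Function.update (merge (cmp k) i v) l (L x) := by
  rcases lt_trichotomy j i.castSucc with h | h | h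
  · have hj : (j : ℕ) < i := h
    refine ⟨j.castLT (by omega), LinearMap.id, fun x => funext fun m => ?_⟩
    simp only [merge, Fin.contractNth, Function.update_apply, Fin.ext_iff, Fin.val_castSucc,
      Fin.val_succ, Fin.val_castLT, LinearMap.id_apply]
    split_ifs <;> first | rfl | (exfalso; omega)
  · subst h
    refine ⟨i, (mul k).flip (v i.succ), fun x => funext fun m => ?_⟩
    simp only [merge, Fin.contractNth, Function.update_apply, Fin.ext_iff, Fin.val_castSucc,
      Fin.val_succ, LinearMap.flip_apply]
    split_ifs with h₁ h₂ h₃ h₄ <;> first | rfl | (exfalso; omega) | skip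
    have : m = i := Fin.ext (by omega)
    subst this; rfl
  · have hj : (i : ℕ) < j := h
    by_cases h' : (j : ℕ) = i + 1
    · have : j = i.succ := Fin.ext h'
      subst this
      refine ⟨i, mul k (v i.castSucc), fun x => funext fun m => ?_⟩
      simp only [merge, Fin.contractNth, Function.update_apply, Fin.ext_iff, Fin.val_castSucc,
        Fin.val_succ]
      split_ifs with h₁ h₂ h₃ h₄ <;> first | rfl | (exfalso; omega) | skip
      have : m = i := Fin.ext (by omega)
      subst this; rfl
    · refine ⟨⟨j - 1, by omega⟩, LinearMap.id, fun x => funext fun m => ?_⟩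
      simp only [merge, Fin.contractNth, Function.update_apply, Fin.ext_iff, Fin.val_castSucc,
        Fin.val_succ, LinearMap.id_apply]
      split_ifs <;> first | rfl | (exfalso; omega)

variable (C) in
/-- The tensor power of the total morphism space with factors indexed by `0, …, n`. -/
abbrev TPow (n : ℕ) : Type (max w₀ u v) := ⨂[k] _ : Fin (n + 1), Tot C

/-- The elementary tensor `v₀ ⊗ ⋯ ⊗ vₙ`. -/
noncomputable abbrev tp {n : ℕ} (v : Fin (n + 1) → Tot C) : TPow k C n :=
  PiTensorProduct.tprod k v

/-- `α₀ ⊗ ⋯ ⊗ αₙ₊₁ ↦ α₀ ⊗ ⋯ ⊗ αᵢαᵢ₊₁ ⊗ ⋯ ⊗ αₙ₊₁`. -/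
noncomputable def face {n : ℕ} (i : Fin (n + 1)) : TPow k C (n + 1) →ₗ[k] TPow k C n :=
  PiTensorProduct.lift
    { toFun := fun v => tp k (merge (cmp k) i v)
      map_update_add' := fun v j x y => by
        obtain ⟨l, L, h⟩ := merge_update k i v j
        have h' : ∀ x, merge (cmp k) i (Function.update v j x) =
          Function.update (merge (cmp k) i v) l (L x) := fun x => by convert h x
        simp only [h', map_add, MultilinearMap.map_update_add]
      map_update_smul' := fun v j c x => by
        obtain ⟨l, L, h⟩ := merge_update k i v j
        have h' : ∀ x, merge (cmp k) i (Function.update v j x) =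
          Function.update (merge (cmp k) i v) l (L x) := fun x => by convert h x
        simp only [h', map_smul, MultilinearMap.map_update_smul] }

theorem face_tp {n : ℕ} (i : Fin (n + 1)) (v : Fin (n + 2) → Tot C) :
    face k i (tp k v) = tp k (merge (cmp k) i v) := by
  simp [face]

/-- The signed rotation
`α₀ ⊗ ⋯ ⊗ αₙ ↦ (-1) ^ (|αₙ| (|α₀| + ⋯ + |αₙ₋₁|)) F(αₙ) ⊗ α₀ ⊗ ⋯ ⊗ αₙ₋₁`
for homogeneous `αᵢ`: if `αₙ` has even degree there is no sign, and if it has odd degree then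
each other factor `αᵢ` contributes `(-1) ^ |αᵢ|`. -/
noncomputable def rot (F : C ⥤ C) [IsDGFunctor k F] (n : ℕ) : TPow k C n →ₗ[k] TPow k C n :=
  (PiTensorProduct.reindex k (fun _ => Tot C) (finRotate (n + 1))).toLinearMap ∘ₗ
    (PiTensorProduct.map (fun i => if i = Fin.last n then mapTot k F ∘ₗ evenPart k
        else LinearMap.id) +
      PiTensorProduct.map (fun i => if i = Fin.last n then mapTot k F ∘ₗ oddPart k else eps k))

theorem finRotate_symm_zero (n : ℕ) : (finRotate (n + 1)).symm 0 = Fin.last n := by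
  rw [Equiv.symm_apply_eq, finRotate_last]

theorem finRotate_symm_succ {n : ℕ} (i : Fin n) :
    (finRotate (n + 1)).symm i.succ = i.castSucc := by
  rw [Equiv.symm_apply_eq, finRotate_of_lt (by simp)]
  rfl

theorem rot_tp (F : C ⥤ C) [IsDGFunctor k F] {n : ℕ} (v : Fin (n + 1) → Tot C) :
    rot k F n (tp k v) =
      tp k (Fin.cons (mapTot k F (evenPart k (v (Fin.last n)))) (Fin.init v)) +
      tp k (Fin.cons (mapTot k F (oddPart k (v (Fin.last n)))) fun i => eps k (Fin.init v i)) := by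
  simp only [rot, LinearMap.comp_apply, LinearMap.add_apply, PiTensorProduct.map_tprod, map_add,
    LinearEquiv.coe_coe, PiTensorProduct.reindex_tprod]
  congr 2
  all_goals
    funext i
    refine Fin.cases ?_ (fun i => ?_) i
    · rw [finRotate_symm_zero]; simp
    · rw [finRotate_symm_succ]; simp [Fin.init, (Fin.castSucc_lt_last i).ne]

/-- The last face `α₀ ⊗ ⋯ ⊗ αₙ₊₁ ↦ ± F(αₙ₊₁) α₀ ⊗ α₁ ⊗ ⋯ ⊗ αₙ`, with the Koszul sign. -/
noncomputable def lastFace (F : C ⥤ C) [IsDGFunctor k F] (n : ℕ) :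
    TPow k C (n + 1) →ₗ[k] TPow k C n :=
  face k 0 ∘ₗ rot k F (n + 1)

/-- The alternating sum of the faces. -/
noncomputable def barD (F : C ⥤ C) [IsDGFunctor k F] (n : ℕ) :
    TPow k C (n + 1) →ₗ[k] TPow k C n :=
  (∑ i : Fin (n + 1), ((-1 : k) ^ (i : ℕ)) • face k i) + ((-1 : k) ^ (n + 1)) • lastFace k F n

/-- The operators `ε, …, ε, d, 1, …, 1` with `d` at the place `i`. -/
noncomputable def dOp (C : Type u) [Category.{v} C] [Preadditive C] [Linear k C] [DGCategory k C]
    {n : ℕ} (i j : Fin n) : Tot C →ₗ[k] Tot C :=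
  if j < i then eps k else if j = i then dTot k else LinearMap.id

/-- The differential of a tensor product of complexes,
`α₀ ⊗ ⋯ ⊗ αₙ ↦ ∑ i, (-1) ^ (|α₀| + ⋯ + |αᵢ₋₁|) α₀ ⊗ ⋯ ⊗ dαᵢ ⊗ ⋯ ⊗ αₙ`. -/
noncomputable def intD (C : Type u) [Category.{v} C] [Preadditive C] [Linear k C] [DGCategory k C]
    (n : ℕ) : TPow k C n →ₗ[k] TPow k C n :=
  ∑ i : Fin (n + 1), PiTensorProduct.map (dOp k C i)

theorem intD_tp {n : ℕ} (v : Fin (n + 1) → Tot C) :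
    intD k C n (tp k v) = ∑ i, tp k (fun j => dOp k C i j (v j)) := by
  simp [intD, LinearMap.sum_apply]

theorem eps_eps (x : Tot C) : eps k (eps k x) = x := by
  rw [scale_scale]
  induction x using tot_induction k (C := C) with
  | h0 => simp
  | hadd _ _ h h' => simp [h, h']
  | hmk X Y p a ha => 
    rw [ha.scale, ← mul_zpow]; simp

theorem dTot_eps (x : Tot C) : dTot k (eps k x) = - eps k (dTot k x) := by
  induction x using tot_induction k (C := C) with
  | h0 => simp
  | hadd _ _ h h' => simp [h, h']; abel
  | hmk X Y p a ha =>
    rw [ha.scale, ha.d.scale, zpow_add₀ (by simp)]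
    simp

theorem intD_intD (n : ℕ) : intD k C n ∘ₗ intD k C n = 0 := by
  have hlt : ∀ i j : Fin (n + 1), i < j →
      (PiTensorProduct.map (dOp k C i) : TPow k C n →ₗ[k] TPow k C n) ∘ₗ
        PiTensorProduct.map (dOp k C j) =
      - (PiTensorProduct.map (dOp k C j) : TPow k C n →ₗ[k] TPow k C n) ∘ₗ
        PiTensorProduct.map (dOp k C i) := by
    intro i j hij
    refine PiTensorProduct.ext (MultilinearMap.ext fun v => ?_)
    simp only [LinearMap.compMultilinearMap_apply, LinearMap.comp_apply, LinearMap.neg_apply,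
      PiTensorProduct.map_tprod]
    have : (fun l => dOp k C i l (dOp k C j l (v l))) =
        Function.update (fun l => dOp k C j l (dOp k C i l (v l))) i
          ((-1 : k) • dOp k C j i (dOp k C i i (v i))) := by
      funext l
      rw [Function.update_apply]
      split_ifs with h
      · subst h
        simp [dOp, hij, dTot_eps]
      · simp only [dOp, h, if_false]
        split_ifs <;> first | rfl | (exfalso; omega)
    rw [this, MultilinearMap.map_update_smul]
    simp
  have heq : ∀ i : Fin (n + 1),
      (PiTensorProduct.map (dOp k C i) : TPow k C n →ₗ[k] TPow k C n) ∘ₗ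
        PiTensorProduct.map (dOp k C i) = 0 := by
    intro i
    refine PiTensorProduct.ext (MultilinearMap.ext fun v => ?_)
    simp only [LinearMap.compMultilinearMap_apply, LinearMap.comp_apply,
      PiTensorProduct.map_tprod]
    exact MultilinearMap.map_coord_zero _ i (by simp [dOp, dTot_dTot])
  have : intD k C n ∘ₗ intD k C n = ∑ x : Fin (n + 1) × Fin (n + 1),
      (PiTensorProduct.map (dOp k C x.1) : TPow k C n →ₗ[k] TPow k C n) ∘ₗ
        PiTensorProduct.map (dOp k C x.2) := by
    refine LinearMap.ext fun x => ?_
    simp only [Fintype.sum_prod_type, intD, LinearMap.comp_apply, LinearMap.sum_apply, map_sum]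
    exact Finset.sum_comm
  rw [this]
  refine Finset.sum_involution (fun x _ => (x.2, x.1)) ?_ ?_ (by simp) (by simp)
  · rintro ⟨i, j⟩ -
    rcases lt_trichotomy i j with h | h | h
    · rw [hlt i j h]; exact neg_add_cancel _
    · subst h; simp [heq]
    · rw [hlt j i h]; exact add_neg_cancel _
  · rintro ⟨i, j⟩ - h h'
    obtain rfl : j = i := congrArg Prod.fst h'
    exact h (heq j)

theorem dOp_lt {n : ℕ} {i j : Fin n} (h : (j : ℕ) < i) (x : Tot C) : dOp k C i j x = eps k x := by
  rw [dOp, if_pos (by exact h)]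

theorem dOp_self {n : ℕ} {i j : Fin n} (h : (j : ℕ) = i) (x : Tot C) :
    dOp k C i j x = dTot k x := by
  rw [dOp, if_neg (by rw [Fin.lt_def]; omega), if_pos (Fin.ext h)]

theorem dOp_gt {n : ℕ} {i j : Fin n} (h : (i : ℕ) < j) (x : Tot C) : dOp k C i j x = x := by
  rw [dOp, if_neg (by rw [Fin.lt_def]; omega), if_neg (by rw [Fin.ext_iff]; omega),
    LinearMap.id_apply]

theorem intD_face {n : ℕ} (i : Fin (n + 1)) (x : TPow k C (n + 1)) :
    intD k C n (face k i x) = face k i (intD k C (n + 1) x) := by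
  suffices h : intD k C n ∘ₗ face k i = face k i ∘ₗ intD k C (n + 1) from LinearMap.congr_fun h x
  refine PiTensorProduct.ext (MultilinearMap.ext fun v => ?_)
  simp only [LinearMap.compMultilinearMap_apply, LinearMap.comp_apply, face_tp, intD_tp, map_sum]
  rw [Fin.sum_univ_succAbove _ i.castSucc, Fin.sum_univ_succAbove _ i,
    Fin.sum_univ_succAbove _ i, ← add_assoc]
  have hsa : i.castSucc.succAbove i = i.succ := Fin.succAbove_castSucc_self i
  congr 1
  · have h₁ : (fun j => dOp k C i j (merge (cmp k) i v j)) =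
        Function.update (fun j => dOp k C i j (merge (cmp k) i v j)) i
          (mul k (dTot k (v i.castSucc)) (v i.succ) +
            mul k (eps k (v i.castSucc)) (dTot k (v i.succ))) := by
      refine (Function.update_eq_self_iff.2 ?_).symm
      rw [merge_eq, cmp, dOp, if_neg (lt_irrefl _), if_pos rfl, dTot_mul]
    rw [h₁, hsa]
    refine (MultilinearMap.map_update_add (PiTensorProduct.tprod k) _ i _ _).trans ?_
    congr 2
    · funext l
      rcases lt_trichotomy l i with h | h | h
      · rw [Function.update_of_ne h.ne, merge_lt _ h, merge_lt _ h, dOp_lt k (by exact h),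
          dOp_lt k (by exact h)]
      · subst h
        rw [Function.update_self, merge_eq, cmp, dOp_self k rfl, dOp_gt k (by simp)]
      · rw [Function.update_of_ne h.ne', merge_gt _ h, merge_gt _ h, dOp_gt k (by exact h),
          dOp_gt k (by simpa using Nat.lt_succ_of_lt h)]
    · funext l
      rcases lt_trichotomy l i with h | h | h
      · rw [Function.update_of_ne h.ne, merge_lt _ h, merge_lt _ h, dOp_lt k (by exact h),
          dOp_lt k (by simpa using Nat.lt_succ_of_lt h)]
      · subst h
        rw [Function.update_self, merge_eq, cmp, dOp_self k (i := l.succ) rfl, dOp_lt k (by simp)]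
      · rw [Function.update_of_ne h.ne', merge_gt _ h, merge_gt _ h, dOp_gt k (by exact h),
          dOp_gt k (by simpa using h)]
  · refine Finset.sum_congr rfl fun m _ => ?_
    congr 1
    obtain ⟨i', hi'⟩ : ∃ i', i' = i.succAbove m := ⟨_, rfl⟩
    have hne : i' ≠ i := hi' ▸ Fin.succAbove_ne i m
    rw [← hi']
    have hval : (i' < i ∧ i.castSucc.succAbove (i') = i'.castSucc) ∨
        (i < i' ∧ i.castSucc.succAbove i' = i'.succ) := by
      rcases lt_or_gt_of_ne hne with h | h
      · exact Or.inl ⟨h, Fin.succAbove_of_castSucc_lt _ _ (by simpa using h)⟩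
      · exact Or.inr ⟨h, Fin.succAbove_of_le_castSucc _ _ (by simpa using h.le)⟩
    rcases hval with ⟨h, e⟩ | ⟨h, e⟩
    all_goals
      rw [e]
      rw [Fin.lt_def] at h
      funext l
      rcases lt_trichotomy l i with h' | h' | h'
      · rw [merge_lt _ h', merge_lt _ h']
        rw [Fin.lt_def] at h'
        simp only [dOp, Fin.lt_def, Fin.ext_iff, Fin.val_castSucc, Fin.val_succ] <;>
        split_ifs <;> first | rfl | (exfalso; omega)
      · subst h'
        rw [merge_eq, merge_eq]
        first
          | rw [dOp_gt k (by exact h), cmp, cmp, dOp_gt k (by simpa using h),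
              dOp_gt k (by simpa using Nat.lt_succ_of_lt h)]
          | rw [dOp_lt k (by exact h), cmp, cmp, dOp_lt k (by simpa using Nat.lt_succ_of_lt h),
              dOp_lt k (by simpa using h), eps_mul]
      · rw [merge_gt _ h', merge_gt _ h']
        rw [Fin.lt_def] at h'
        simp only [dOp, Fin.lt_def, Fin.ext_iff, Fin.val_castSucc, Fin.val_succ] <;>
        split_ifs <;> first | rfl | (exfalso; omega)

theorem eps_even (x : Tot C) : eps k (evenPart k x) = evenPart k x := by
  rw [scale_scale]
  congr 2
  funext p
  split_ifs with h
  · simp [h.neg_one_zpow]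
  · simp

theorem eps_odd (x : Tot C) : eps k (oddPart k x) = - oddPart k x := by
  induction x using tot_induction k (C := C) with
  | h0 => simp
  | hadd _ _ h h' => simp [h, h']; abel
  | hmk X Y p a ha =>
    rw [ha.scale, map_smul, ha.scale, smul_smul, ← neg_smul]
    congr 1
    split_ifs with h
    · simp
    · simp [(Int.not_even_iff_odd.1 h).neg_one_zpow]

theorem dTot_even (x : Tot C) : dTot k (evenPart k x) = oddPart k (dTot k x) :=
  dTot_scale k _ _ (fun p => by simp only [Int.even_add_one, ite_not]) x

theorem dTot_odd (x : Tot C) : dTot k (oddPart k x) = evenPart k (dTot k x) :=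
  dTot_scale k _ _ (fun p => by simp only [Int.even_add_one, ite_not]) x

theorem intD_rot (F : C ⥤ C) [IsDGFunctor k F] (n : ℕ) (x : TPow k C n) :
    intD k C n (rot k F n x) = rot k F n (intD k C n x) := by
  suffices h : intD k C n ∘ₗ rot k F n = rot k F n ∘ₗ intD k C n from LinearMap.congr_fun h x
  refine PiTensorProduct.ext (MultilinearMap.ext fun v => ?_)
  simp only [LinearMap.compMultilinearMap_apply, LinearMap.comp_apply, rot_tp, intD_tp, map_sum,
    map_add]
  rw [← Finset.sum_add_distrib, Fin.sum_univ_succ, Fin.sum_univ_castSucc, add_comm]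
  congr 1
  · refine Finset.sum_congr rfl fun m _ => ?_
    congr 1
    · congr 1
      funext l
      refine Fin.cases ?_ (fun l => ?_) l
      · rw [dOp_lt k (by simp), Fin.cons_zero, Fin.cons_zero, dOp_gt k (by simp), ← mapTot_scale,
          eps_even]
      · simp only [Fin.cons_succ, Fin.init, dOp, Fin.succ_lt_succ_iff, Fin.succ_inj,
          Fin.castSucc_lt_castSucc_iff, Fin.castSucc_inj]
    · have : (fun j => dOp k C m.succ j (Fin.cons (α := fun _ => Tot C)
          (mapTot k F (oddPart k (v (Fin.last n)))) (fun i => eps k (Fin.init v i)) j)) =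
          Function.update (Function.update (Fin.cons (α := fun _ => Tot C)
            (mapTot k F (oddPart k (dOp k C m.castSucc (Fin.last n) (v (Fin.last n)))))
            fun i => eps k (Fin.init (fun j => dOp k C m.castSucc j (v j)) i))
            0 ((-1 : k) • mapTot k F (oddPart k (v (Fin.last n))))) m.succ
            ((-1 : k) • eps k (dTot k (v m.castSucc))) := by
        funext l
        refine Fin.cases ?_ (fun l => ?_) l
        · rw [Function.update_of_ne (Fin.succ_ne_zero m).symm, Function.update_self,
            dOp_lt k (by simp), Fin.cons_zero, ← mapTot_scale, eps_odd]
          simp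
        · by_cases h : l = m
          · subst h
            rw [Function.update_self, dOp_self k rfl, Fin.cons_succ, dTot_eps]
            simp [Fin.init]
          · rw [Function.update_of_ne (fun h' => h (Fin.succ_injective _ h')),
              Function.update_of_ne (Fin.succ_ne_zero l), Fin.cons_succ, Fin.cons_succ]
            simp only [Fin.init, dOp, Fin.succ_lt_succ_iff, Fin.succ_inj,
              Fin.castSucc_lt_castSucc_iff, Fin.castSucc_inj, if_neg h]
            split_ifs <;> rfl
      rw [this]
      refine (MultilinearMap.map_update_smul (PiTensorProduct.tprod k) _ _ _ _).trans ?_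
      rw [Function.update_comm (Fin.succ_ne_zero m).symm]
      rw [MultilinearMap.map_update_smul, smul_smul, neg_one_mul, neg_neg, one_smul]
      congr 1
      funext l
      refine Fin.cases ?_ (fun l => ?_) l
      · rw [Function.update_self, Fin.cons_zero, dOp_gt k (by simp)]
      · rw [Function.update_of_ne (Fin.succ_ne_zero l)]
        by_cases h : l = m
        · subst h
          rw [Function.update_self, Fin.cons_succ, Fin.init, dOp_self k rfl]
        · rw [Function.update_of_ne (fun h' => h (Fin.succ_injective _ h'))]
  · rw [add_comm]
    congr 1
    · congr 1
      funext l
      refine Fin.cases ?_ (fun l => ?_) l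
      · rw [dOp_self k rfl, Fin.cons_zero, Fin.cons_zero, dOp_self k rfl, ← mapTot_dTot, dTot_odd]
      · rw [dOp_gt k (by simp), Fin.cons_succ, Fin.cons_succ, Fin.init, Fin.init,
          dOp_lt k (by simp)]
    · congr 1
      funext l
      refine Fin.cases ?_ (fun l => ?_) l
      · rw [dOp_self k rfl, Fin.cons_zero, Fin.cons_zero, dOp_self k rfl, ← mapTot_dTot, dTot_even]
      · rw [dOp_gt k (by simp), Fin.cons_succ, Fin.cons_succ, Fin.init, Fin.init,
          dOp_lt k (by simp), eps_eps]

theorem intD_barD (F : C ⥤ C) [IsDGFunctor k F] (n : ℕ) (x : TPow k C (n + 1)) :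
    intD k C n (barD k F n x) = barD k F n (intD k C (n + 1) x) := by
  simp only [barD, LinearMap.add_apply, LinearMap.sum_apply, LinearMap.smul_apply, map_add,
    map_sum, map_smul, intD_face, lastFace, LinearMap.comp_apply, intD_rot]

theorem merge_succAbove {α : Type*} (op : α → α → α) {n : ℕ} (i : Fin (n + 1))
    (v : Fin (n + 2) → α) (m : Fin n) :
    merge op i v (i.succAbove m) = v (i.castSucc.succAbove (i.succAbove m)) := by
  rcases lt_or_gt_of_ne (Fin.succAbove_ne i m) with h | h
  · rw [merge_lt _ h, Fin.succAbove_of_castSucc_lt i.castSucc _ (by simpa using h)]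
  · rw [merge_gt _ h, Fin.succAbove_of_le_castSucc i.castSucc _ (by simpa using h.le)]

theorem sum_merge {n : ℕ} (i : Fin (n + 1)) (p : Fin (n + 2) → ℤ) :
    ∑ l, merge (· + ·) i p l = ∑ l, p l := by
  rw [Fin.sum_univ_succAbove _ i, Fin.sum_univ_succAbove p i.castSucc,
    Fin.sum_univ_succAbove (fun l => p (i.castSucc.succAbove l)) i, merge_eq,
    Fin.succAbove_castSucc_self, add_assoc]
  simp only [merge_succAbove]

theorem sum_rotate {n : ℕ} (p : Fin (n + 1) → ℤ) : ∑ l, rotate id p l = ∑ l, p l := by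
  rw [Fin.sum_univ_succ, Fin.sum_univ_castSucc, add_comm]
  simp [rotate, Fin.init]

/-- `v₀, …, vₙ` are composable homogeneous morphisms `vᵢ : xᵢ₊₁ ⟶ xᵢ` of degrees `pᵢ`, and
`x₀ = F xₙ₊₁`. -/
structure IsStr (F : C ⥤ C) {n : ℕ} (x : Fin (n + 2) → C) (p : Fin (n + 1) → ℤ)
    (v : Fin (n + 1) → Tot C) : Prop where
  closed : x 0 = F.obj (x (Fin.last (n + 1)))
  arrow (i : Fin (n + 1)) : IsArrow k (x i.succ) (x i.castSucc) (p i) (v i)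

variable {k}

theorem IsStr.merge {F : C ⥤ C} {n : ℕ} {x : Fin (n + 3) → C} {p : Fin (n + 2) → ℤ}
    {v : Fin (n + 2) → Tot C} (h : IsStr k F x p v) (i : Fin (n + 1)) :
    IsStr k F (x ∘ i.succ.castSucc.succAbove) (DGHochschild.merge (· + ·) i p)
      (DGHochschild.merge (cmp k) i v) where
  closed := by
    simp only [Function.comp]
    rw [Fin.succAbove_of_castSucc_lt _ 0 (by simp [Fin.lt_def]),
      Fin.succAbove_of_le_castSucc _ (Fin.last _) (by simp [Fin.le_def]; omega)]
    exact h.closed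
  arrow l := by
    simp only [Function.comp]
    rcases lt_trichotomy l i with h' | h' | h'
    · rw [merge_lt _ h', merge_lt _ h',
        Fin.succAbove_of_castSucc_lt _ l.succ (by rw [Fin.lt_def] at h' ⊢; simpa using h'),
        Fin.succAbove_of_castSucc_lt _ l.castSucc
          (by rw [Fin.lt_def] at h' ⊢; simp; omega)]
      exact h.arrow l.castSucc
    · subst h'
      rw [merge_eq, merge_eq,
        Fin.succAbove_of_le_castSucc _ l.succ (by simp),
        Fin.succAbove_of_castSucc_lt _ l.castSucc (by simp [Fin.lt_def])]
      exact (h.arrow l.castSucc).mul (h.arrow l.succ)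
    · rw [merge_gt _ h', merge_gt _ h',
        Fin.succAbove_of_le_castSucc i.succ.castSucc l.succ
          (Nat.succ_le_succ (le_of_lt h')),
        Fin.succAbove_of_le_castSucc i.succ.castSucc l.castSucc
          (Nat.succ_le_of_lt h')]
      exact h.arrow l.succ

theorem IsStr.rotate {F : C ⥤ C} [IsDGFunctor k F] {n : ℕ} {x : Fin (n + 2) → C}
    {p : Fin (n + 1) → ℤ} {v : Fin (n + 1) → Tot C} (h : IsStr k F x p v) :
    IsStr k F (DGHochschild.rotate (fun _ => F.obj (x (Fin.last n).castSucc)) x)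
      (DGHochschild.rotate id p) (DGHochschild.rotate (mapTot k F) v) where
  closed := by
    simp only [DGHochschild.rotate, Fin.cons_zero]
    rw [← Fin.succ_last, Fin.cons_succ]
    rfl
  arrow l := by
    refine Fin.cases ?_ (fun l => ?_) l
    · simp only [DGHochschild.rotate, Fin.cons_zero, Fin.castSucc_zero, Fin.cons_succ, Fin.init,
        h.closed]
      exact (h.arrow (Fin.last n)).map F
    · exact h.arrow l.castSucc

theorem IsStr.map {F : C ⥤ C} {F' : D ⥤ D} (H : C ⥤ D) [IsDGFunctor k H]
    (hH : ∀ X, H.obj (F.obj X) = F'.obj (H.obj X)) {n : ℕ} {x : Fin (n + 2) → C}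
    {p : Fin (n + 1) → ℤ} {v : Fin (n + 1) → Tot C} (h : IsStr k F x p v) :
    IsStr k F' (fun i => H.obj (x i)) p (fun i => mapTot k H (v i)) where
  closed := by rw [h.closed, hH]
  arrow i := (h.arrow i).map H

theorem IsStr.dTot {F : C ⥤ C} {n : ℕ} {x : Fin (n + 2) → C}
    {p : Fin (n + 1) → ℤ} {v : Fin (n + 1) → Tot C} (h : IsStr k F x p v) (i : Fin (n + 1)) :
    IsStr k F x (Function.update p i (p i + 1)) (Function.update v i (dTot k (v i))) where
  closed := h.closed
  arrow j := by
    by_cases e : j = i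
    · subst e; simpa using (h.arrow j).d
    · simpa [e] using h.arrow j

variable (k)

theorem rot_str {F : C ⥤ C} [IsDGFunctor k F] {n : ℕ} {x : Fin (n + 2) → C}
    {p : Fin (n + 1) → ℤ} {v : Fin (n + 1) → Tot C} (h : IsStr k F x p v) :
    rot k F n (tp k v) = ((-1 : k) ^ (p (Fin.last n) * ∑ i : Fin n, p i.castSucc)) •
      tp k (rotate (mapTot k F) v) := by
  rw [rot_tp]
  have hl := h.arrow (Fin.last n)
  rw [hl.scale, hl.scale]
  by_cases hp : Even (p (Fin.last n))
  · simp only [hp, if_true, one_smul, zero_smul, map_zero]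
    rw [(hp.mul_right _).neg_one_zpow, one_smul]
    refine (congrArg₂ (· + ·) rfl ?_).trans (add_zero _)
    exact MultilinearMap.map_coord_zero _ 0 (by simp)
  · simp only [hp, if_false, one_smul, zero_smul, map_zero]
    have h1 : (-1 : k) ^ (p (Fin.last n) * ∑ i : Fin n, p i.castSucc) =
        ∏ i : Fin (n + 1), Fin.cons (α := fun _ => k) 1
          (fun i : Fin n => (-1 : k) ^ p i.castSucc) i := by
      rw [Fin.prod_univ_succ, zpow_mul, (Int.not_even_iff_odd.1 hp).neg_one_zpow]
      simp only [Fin.cons_zero, Fin.cons_succ, one_mul]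
      generalize (Finset.univ : Finset (Fin n)) = s
      induction s using Finset.induction_on with
      | empty => simp
      | insert a s ha ih => rw [Finset.sum_insert ha, Finset.prod_insert ha,
          zpow_add₀ (by simp), ih]
    rw [h1, ← MultilinearMap.map_smul_univ]
    refine (congrArg₂ (· + ·) ?_ ?_).trans (zero_add _)
    · exact MultilinearMap.map_coord_zero _ 0 (by simp)
    · congr 1
      funext i
      refine Fin.cases ?_ (fun i => ?_) i
      · simp [rotate]
      · simp only [rotate, Fin.cons_succ, Fin.init]
        rw [(h.arrow i.castSucc).scale]

theorem tp_dOp_str {F : C ⥤ C} [IsDGFunctor k F] {n : ℕ} {x : Fin (n + 2) → C}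
    {p : Fin (n + 1) → ℤ} {v : Fin (n + 1) → Tot C} (h : IsStr k F x p v) (i : Fin (n + 1)) :
    tp k (fun j => dOp k C i j (v j)) = (∏ j, if j < i then (-1 : k) ^ p j else 1) •
      tp k (Function.update v i (dTot k (v i))) := by
  rw [← MultilinearMap.map_smul_univ]
  congr 1
  funext j
  rcases lt_trichotomy j i with h' | h' | h'
  · rw [dOp_lt k h', (h.arrow j).scale, if_pos h', Function.update_of_ne h'.ne]
  · subst h'; rw [dOp_self k rfl]; simp
  · rw [dOp_gt k h', if_neg h'.not_gt, Function.update_of_ne h'.ne']; simp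

theorem rot_face_castSucc {F : C ⥤ C} [IsDGFunctor k F] {n : ℕ} {x : Fin (n + 4) → C}
    {p : Fin (n + 3) → ℤ} {v : Fin (n + 3) → Tot C} (h : IsStr k F x p v) (j : Fin (n + 1)) :
    rot k F (n + 1) (face k j.castSucc (tp k v)) =
      face k j.succ (rot k F (n + 2) (tp k v)) := by
  rw [face_tp, rot_str k (h.merge _), rot_str k h, map_smul, face_tp,
    rotate_merge_castSucc]
  congr 2
  have h1 := sum_merge j.castSucc p
  rw [Fin.sum_univ_castSucc, Fin.sum_univ_castSucc p] at h1
  have h2 : merge (· + ·) j.castSucc p (Fin.last (n + 1)) = p (Fin.last (n + 2)) := by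
    rw [merge_gt _ (Fin.castSucc_lt_last j), Fin.succ_last]
  rw [h2] at h1 ⊢
  rw [add_right_cancel h1]

theorem rot_face_last {F : C ⥤ C} [IsDGFunctor k F] {n : ℕ} {x : Fin (n + 3) → C}
    {p : Fin (n + 2) → ℤ} {v : Fin (n + 2) → Tot C} (h : IsStr k F x p v) :
    rot k F n (face k (Fin.last n) (tp k v)) =
      face k 0 (rot k F (n + 1) (rot k F (n + 1) (tp k v))) := by
  rw [face_tp, rot_str k (h.merge _), rot_str k h, map_smul, rot_str k h.rotate, map_smul, map_smul,
    face_tp, smul_smul, rotate_merge_last]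
  swap
  · have h1 := h.arrow (Fin.last n).castSucc
    have h2 := h.arrow (Fin.last (n + 1))
    exact h1.map_mul F h2
  congr 1
  rw [← zpow_add₀ (by simp)]
  have h2 : merge (· + ·) (Fin.last n) p (Fin.last n) =
      p (Fin.last n).castSucc + p (Fin.last (n + 1)) := by rw [merge_eq, Fin.succ_last]
  have h3 : ∀ i : Fin n, merge (· + ·) (Fin.last n) p i.castSucc = p i.castSucc.castSucc :=
    fun i => merge_lt _ (Fin.castSucc_lt_last i)
  have h4 : rotate id p (Fin.last (n + 1)) = p (Fin.last n).castSucc := rfl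
  have h5 : ∑ i : Fin (n + 1), rotate id p i.castSucc =
      p (Fin.last (n + 1)) + ∑ i : Fin n, p i.castSucc.castSucc := by
    rw [Fin.sum_univ_succ]; rfl
  rw [h2, h4, h5, Fin.sum_univ_castSucc]
  simp only [h3]
  set a := p (Fin.last n).castSucc
  set b := p (Fin.last (n + 1))
  set S := ∑ i : Fin n, p i.castSucc.castSucc
  have : b * (S + a) + a * (b + S) = (a + b) * S + 2 * (a * b) := by ring
  rw [this, zpow_add₀ (by simp), zpow_mul _ 2]
  simp

/-- All the faces `0, …, n + 1`. -/
noncomputable def face' (F : C ⥤ C) [IsDGFunctor k F] {n : ℕ} (i : Fin (n + 2)) :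
    TPow k C (n + 1) →ₗ[k] TPow k C n :=
  Fin.lastCases (lastFace k F n) (fun i => face k i) i

theorem face'_castSucc (F : C ⥤ C) [IsDGFunctor k F] {n : ℕ} (i : Fin (n + 1)) :
    face' k F i.castSucc = face (C := C) k i := by simp [face']

theorem face'_last (F : C ⥤ C) [IsDGFunctor k F] {n : ℕ} :
    face' k F (Fin.last (n + 1)) = lastFace k F n := by simp [face']

theorem barD_eq (F : C ⥤ C) [IsDGFunctor k F] (n : ℕ) :
    barD k F n = ∑ i : Fin (n + 2), ((-1 : k) ^ (i : ℕ)) • face' k F i := by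
  rw [Fin.sum_univ_castSucc, face'_last]
  simp [face'_castSucc, barD]

theorem face_face {n : ℕ} (i : Fin (n + 1)) (j : Fin (n + 2)) (hj : j ≤ i.castSucc)
    (x : TPow k C (n + 2)) :
    face k i (face k j x) =
      face k (j.castLT (lt_of_le_of_lt hj i.castSucc_lt_last)) (face k i.succ x) := by
  suffices h : face (C := C) k i ∘ₗ face k j = face k _ ∘ₗ face k i.succ from
    LinearMap.congr_fun h x
  refine PiTensorProduct.ext (MultilinearMap.ext fun v => ?_)
  simp only [LinearMap.compMultilinearMap_apply, LinearMap.comp_apply, face_tp]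
  rw [merge_merge _ (mul_assoc_tot k) i j hj]

theorem face'_face' {F : C ⥤ C} [IsDGFunctor k F] {n : ℕ} {x : Fin (n + 4) → C}
    {p : Fin (n + 3) → ℤ} {v : Fin (n + 3) → Tot C} (h : IsStr k F x p v)
    (i : Fin (n + 2)) (j : Fin (n + 3)) (hj : j ≤ i.castSucc) :
    face' k F i (face' k F j (tp k v)) =
      face' k F (j.castLT (lt_of_le_of_lt hj i.castSucc_lt_last))
        (face' k F i.succ (tp k v)) := by
  obtain ⟨j, rfl⟩ : ∃ j', j = Fin.castSucc j' :=
    ⟨j.castLT (lt_of_le_of_lt hj i.castSucc_lt_last), rfl⟩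
  rw [face'_castSucc, Fin.castLT_castSucc]
  induction i using Fin.lastCases with
  | cast i =>
    obtain ⟨j, rfl⟩ : ∃ j', j = Fin.castSucc j' := ⟨j.castLT (by
      have : (j : ℕ) ≤ i := hj
      have := i.2
      omega), rfl⟩
    rw [face'_castSucc, face'_castSucc, ← Fin.castSucc_succ, face'_castSucc,
      face_face k i j.castSucc hj]
    rfl
  | last =>
    rw [Fin.succ_last, face'_last, face'_last]
    simp only [lastFace, LinearMap.comp_apply]
    induction j using Fin.lastCases with
    | cast j =>
      rw [face'_castSucc, rot_face_castSucc k h]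
      exact (face_face k j 0 (Fin.zero_le _) _).symm
    | last =>
      rw [face'_last, rot_face_last k h]
      simp only [lastFace, LinearMap.comp_apply]
      have e := rot_face_castSucc k h.rotate (0 : Fin (n + 1))
      rw [Fin.castSucc_zero] at e
      rw [rot_str k h]
      simp only [map_smul]
      rw [e]
      exact congrArg _ (face_face k 0 0 le_rfl _)

theorem alternating_sum_eq_zero {M : Type*} [AddCommGroup M] [Module k M] {n : ℕ}
    (a : Fin (n + 2) → Fin (n + 3) → M)
    (h : ∀ (i : Fin (n + 2)) (j : Fin (n + 3)) (hj : j ≤ i.castSucc),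
      a i j = a (j.castLT (lt_of_le_of_lt hj i.castSucc_lt_last)) i.succ) :
    ∑ i : Fin (n + 2), ∑ j : Fin (n + 3), (((-1 : k) ^ (i : ℕ)) * ((-1 : k) ^ (j : ℕ))) • a i j = 0 := by
  rw [← Finset.sum_product', Finset.univ_product_univ]
  let S : Finset (Fin (n + 2) × Fin (n + 3)) := {ij | (ij.2 : ℕ) ≤ (ij.1 : ℕ)}
  rw [← Finset.sum_add_sum_compl S, ← eq_neg_iff_add_eq_zero, ← Finset.sum_neg_distrib]
  let φ : ∀ ij : Fin (n + 2) × Fin (n + 3), ij ∈ S → Fin (n + 2) × Fin (n + 3) := fun ij hij =>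
    (Fin.castLT ij.2 (lt_of_le_of_lt (Finset.mem_filter.mp hij).right (Fin.is_lt ij.1)), ij.1.succ)
  apply Finset.sum_bij φ
  · intro ij hij
    simp_rw [S, φ, Finset.compl_filter, Finset.mem_filter_univ, Fin.val_succ,
      Fin.val_castLT] at hij ⊢
    omega
  · rintro ⟨i, j⟩ hij ⟨i', j'⟩ hij' h
    rw [Prod.mk_inj]
    exact ⟨by simpa [φ] using! congr_arg Prod.snd h,
      by simpa [φ, Fin.castSucc_castLT] using! congr_arg Fin.castSucc (congr_arg Prod.fst h)⟩
  · rintro ⟨i', j'⟩ hij'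
    simp_rw [S, Finset.compl_filter, Finset.mem_filter_univ, not_le] at hij'
    refine ⟨(j'.pred <| ?_, Fin.castSucc i'), ?_, ?_⟩
    · rintro rfl
      simp only [Fin.val_zero, not_lt_zero] at hij'
    · simpa [S] using! Nat.le_sub_one_of_lt hij'
    · simp only [φ, Fin.castLT_castSucc, Fin.succ_pred]
  · rintro ⟨i, j⟩ hij
    have hij' : j ≤ i.castSucc := by simpa [S] using! hij
    dsimp only [φ]
    rw [h i j hij', ← neg_smul]
    congr 1
    simp only [Fin.val_succ, Fin.val_castLT, pow_succ]
    ring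

theorem barD_barD {F : C ⥤ C} [IsDGFunctor k F] {n : ℕ} {x : Fin (n + 4) → C}
    {p : Fin (n + 3) → ℤ} {v : Fin (n + 3) → Tot C} (h : IsStr k F x p v) :
    barD k F n (barD k F (n + 1) (tp k v)) = 0 := by
  rw [← alternating_sum_eq_zero k (fun i j => face' k F i (face' k F j (tp k v)))
    (fun i j hj => face'_face' k h i j hj)]
  simp only [barD_eq, LinearMap.sum_apply, LinearMap.smul_apply, map_sum, map_smul,
    Finset.smul_sum, smul_smul]
  rw [Finset.sum_comm]
  exact Finset.sum_congr rfl fun i _ => Finset.sum_congr rfl fun j _ => by rw [mul_comm]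

/-- A basic chain `α₀ ⊗ ⋯ ⊗ αₙ` of total (cohomological) degree `q` of the Hochschild complex of
`C` twisted by `F`: composable homogeneous morphisms `αᵢ : xᵢ₊₁ ⟶ xᵢ`, where `x₀ = F xₙ₊₁`, with
`|α₀| + ⋯ + |αₙ| - n = q`. -/
structure BasicChain (F : C ⥤ C) (n : ℕ) (q : ℤ) where
  x : Fin (n + 2) → C
  closed : x 0 = F.obj (x (Fin.last (n + 1)))
  α (i : Fin (n + 1)) : x i.succ ⟶ x i.castSucc
  p : Fin (n + 1) → ℤ
  mem (i : Fin (n + 1)) : α i ∈ DGCategory.gr (k := k) (x i.succ) (x i.castSucc) (p i)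
  deg : ∑ i, p i = q + n

variable (C) in
/-- The direct sum of all the tensor powers of the total morphism space. -/
def TSum : Type (max w₀ u v) := DirectSum ℕ fun n => TPow k C n

noncomputable instance : AddCommGroup (TSum k C) :=
  inferInstanceAs (AddCommGroup (DirectSum ℕ fun n => TPow k C n))

noncomputable instance : Module k (TSum k C) :=
  inferInstanceAs (Module k (DirectSum ℕ fun n => TPow k C n))

/-- The inclusion of the `n`-th summand. -/
noncomputable def single (n : ℕ) : TPow k C n →ₗ[k] TSum k C :=
  DirectSum.lof k ℕ (fun n => TPow k C n) n

noncomputable def liftT {M : Type*} [AddCommGroup M] [Module k M]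
    (φ : ∀ n, TPow k C n →ₗ[k] M) : TSum k C →ₗ[k] M :=
  DirectSum.toModule k ℕ M φ

theorem liftT_single {M : Type*} [AddCommGroup M] [Module k M]
    (φ : ∀ n, TPow k C n →ₗ[k] M) (n : ℕ) (x : TPow k C n) :
    liftT k φ (single k n x) = φ n x :=
  DirectSum.toModule_lof (φ := φ) k n x

/-- The differential on the `n`-th summand: `(-1) ^ n` times the differential of the tensor
product of complexes, plus the alternating sum of the faces if `n > 0`. -/
noncomputable def colD (F : C ⥤ C) [IsDGFunctor k F] : ∀ n : ℕ, TPow k C n →ₗ[k] TSum k C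
  | 0 => single k 0 ∘ₗ intD k C 0
  | n + 1 => ((-1 : k) ^ (n + 1)) • (single k (n + 1) ∘ₗ intD k C (n + 1)) +
      single k n ∘ₗ barD k F n

/-- The total differential. -/
noncomputable def totD (F : C ⥤ C) [IsDGFunctor k F] : TSum k C →ₗ[k] TSum k C :=
  liftT k (colD k F)

variable {k}

/-- The tensor `α₀ ⊗ ⋯ ⊗ αₙ` of a basic chain. -/
noncomputable def BasicChain.tens {F : C ⥤ C} {n : ℕ} {q : ℤ} (c : BasicChain k F n q) :
    TSum k C :=
  single k n (tp k fun i => inc k (c.α i))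

variable (k)

/-- The degree `q` part of the Hochschild complex of `C` twisted by `F`: the subspace
`⨁ (n, x₁, …, xₙ₊₁), Hom(x₁, F xₙ₊₁) ⊗ Hom(x₂, x₁) ⊗ ⋯ ⊗ Hom(xₙ₊₁, xₙ)` (in total degree `q`) of
the sum of the tensor powers of the total morphism space, which is spanned by the basic chains. -/
noncomputable def piece (F : C ⥤ C) (q : ℤ) : Submodule k (TSum k C) :=
  Submodule.span k {t | ∃ (n : ℕ) (c : BasicChain k F n q), t = c.tens}

variable {k}

/-- A basic chain as an element of the Hochschild complex. -/
noncomputable def BasicChain.cls {F : C ⥤ C} {n : ℕ} {q : ℤ} (c : BasicChain k F n q) :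
    piece k F q :=
  ⟨c.tens, Submodule.subset_span ⟨n, c, rfl⟩⟩

theorem BasicChain.isStr {F : C ⥤ C} {n : ℕ} {q : ℤ} (c : BasicChain k F n q) :
    IsStr k F c.x c.p fun i => inc k (c.α i) where
  closed := c.closed
  arrow i := ⟨_, c.mem i, rfl⟩

theorem IsStr.mem_piece {F : C ⥤ C} {n : ℕ} {x : Fin (n + 2) → C} {p : Fin (n + 1) → ℤ}
    {v : Fin (n + 1) → Tot C} (h : IsStr k F x p v) {q : ℤ} (hq : ∑ i, p i = q + n) :
    single k n (tp k v) ∈ piece k F q := by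
  choose f hf hv using h.arrow
  refine Submodule.subset_span ⟨n, ⟨x, h.closed, f, p, hf, hq⟩, ?_⟩
  rw [BasicChain.tens]
  congr 2
  exact funext hv

theorem piece_induction {F : C ⥤ C} {q : ℤ} {P : TSum k C → Prop} {t : TSum k C}
    (ht : t ∈ piece k F q) (h0 : P 0) (hadd : ∀ s t, P s → P t → P (s + t))
    (hsmul : ∀ (a : k) t, P t → P (a • t))
    (hstr : ∀ (n : ℕ) (x : Fin (n + 2) → C) (p : Fin (n + 1) → ℤ) (v : Fin (n + 1) → Tot C),
      IsStr k F x p v → ∑ i, p i = q + n → P (single k n (tp k v))) : P t := by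
  refine Submodule.span_induction (p := fun t _ => P t) ?_ h0 (fun s t _ _ => hadd s t)
    (fun a t _ => hsmul a t) ht
  rintro _ ⟨n, c, rfl⟩
  exact hstr n c.x c.p _ c.isStr c.deg

variable (k)

theorem intD_mem {F : C ⥤ C} [IsDGFunctor k F] {n : ℕ} {x : Fin (n + 2) → C}
    {p : Fin (n + 1) → ℤ} {v : Fin (n + 1) → Tot C} (h : IsStr k F x p v) {q : ℤ}
    (hq : ∑ i, p i = q + n) : single k n (intD k C n (tp k v)) ∈ piece k F (q + 1) := by
  rw [intD_tp, map_sum]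
  refine Submodule.sum_mem _ fun i _ => ?_
  rw [tp_dOp_str k h, map_smul]
  refine Submodule.smul_mem _ _ ((h.dTot i).mem_piece ?_)
  rw [Finset.sum_update_of_mem (Finset.mem_univ i), ← Finset.compl_eq_univ_sdiff]
  have := Fintype.sum_eq_add_sum_compl i p
  omega

theorem barD_mem {F : C ⥤ C} [IsDGFunctor k F] {n : ℕ} {x : Fin (n + 3) → C}
    {p : Fin (n + 2) → ℤ} {v : Fin (n + 2) → Tot C} (h : IsStr k F x p v) {q : ℤ}
    (hq : ∑ i, p i = q + (n + 1 : ℕ)) :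
    single k n (barD k F n (tp k v)) ∈ piece k F (q + 1) := by
  simp only [barD, LinearMap.add_apply, LinearMap.sum_apply, LinearMap.smul_apply, map_add,
    map_sum, map_smul]
  refine Submodule.add_mem _ (Submodule.sum_mem _ fun i _ => Submodule.smul_mem _ _ ?_)
    (Submodule.smul_mem _ _ ?_)
  · rw [face_tp]
    exact (h.merge i).mem_piece (by rw [sum_merge, hq]; push_cast; ring)
  · rw [lastFace, LinearMap.comp_apply, rot_str k h, map_smul, map_smul, face_tp]
    exact Submodule.smul_mem _ _ ((h.rotate.merge 0).mem_piece
      (by rw [sum_merge, sum_rotate, hq]; push_cast; ring))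

theorem totD_mem (F : C ⥤ C) [IsDGFunctor k F] {q : ℤ} {t : TSum k C} (ht : t ∈ piece k F q) :
    totD k F t ∈ piece k F (q + 1) := by
  refine piece_induction (P := fun t => totD k F t ∈ piece k F (q + 1)) ht
    (by rw [map_zero]; exact zero_mem _) (fun s t hs ht => by rw [map_add]; exact add_mem hs ht)
    (fun a t ht => by rw [map_smul]; exact Submodule.smul_mem _ _ ht) ?_
  intro n x p v h hq
  rw [totD, liftT_single]
  cases n with
  | zero => exact intD_mem k h hq
  | succ n =>
    rw [colD, LinearMap.add_apply, LinearMap.smul_apply]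
    exact add_mem (Submodule.smul_mem _ _ (intD_mem k h hq)) (barD_mem k h hq)

theorem intD_intD_apply (n : ℕ) (x : TPow k C n) : intD k C n (intD k C n x) = 0 :=
  LinearMap.congr_fun (intD_intD k n) x

theorem totD_totD (F : C ⥤ C) [IsDGFunctor k F] {q : ℤ} {t : TSum k C} (ht : t ∈ piece k F q) :
    totD k F (totD k F t) = 0 := by
  refine piece_induction (P := fun t => totD k F (totD k F t) = 0) ht
    (by rw [map_zero, map_zero]) (fun s t hs ht => by rw [map_add, map_add, hs, ht, add_zero])
    (fun a t ht => by rw [map_smul, map_smul, ht, smul_zero]) ?_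
  intro n x p v h hq
  have hs : ∀ n (y : TPow k C n), totD k F (single k n y) = colD k F n y :=
    fun n y => liftT_single k _ n y
  rw [hs]
  cases n with
  | zero =>
    simp only [colD, LinearMap.comp_apply]
    rw [hs, colD, LinearMap.comp_apply, intD_intD_apply, map_zero]
  | succ n =>
    simp only [colD, LinearMap.add_apply, LinearMap.smul_apply, LinearMap.comp_apply, map_add,
      map_smul]
    rw [hs, hs, colD, LinearMap.add_apply, LinearMap.smul_apply, LinearMap.comp_apply,
      intD_intD_apply, map_zero, smul_zero, zero_add, LinearMap.comp_apply, ← intD_barD]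
    cases n with
    | zero =>
      simp [colD]
    | succ n =>
      rw [colD, LinearMap.add_apply, LinearMap.smul_apply, LinearMap.comp_apply,
        LinearMap.comp_apply, barD_barD k h, map_zero, add_zero, ← add_smul, pow_succ]
      simp

/-- The Hochschild complex `C_•(C; F)` of a DG category `C` with coefficients in the bimodule
`(a, b) ↦ Hom(b, F a)`: the total complex (convolution), graded cohomologically. -/
noncomputable def Hoch (F : C ⥤ C) [IsDGFunctor k F] :
    CochainComplex (ModuleCat.{max w₀ u v} k) ℤ where
  X q := ModuleCat.of k (piece k F q)
  d q r := if h : q + 1 = r then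
    ModuleCat.ofHom ((totD k F).restrict fun _ ht => h ▸ totD_mem k F ht) else 0
  shape q r h := dif_neg h
  d_comp_d' q r s hqr hrs := by
    obtain rfl : q + 1 = r := hqr
    obtain rfl : q + 1 + 1 = s := hrs
    rw [dif_pos rfl, dif_pos rfl, ← ModuleCat.ofHom_comp]
    refine congrArg ModuleCat.ofHom (LinearMap.ext fun t => Subtype.ext ?_)
    exact totD_totD k F t.2

/-- The Hochschild homology `HH_•(C; F)` in cohomological degree `q`. -/
noncomputable abbrev HH (F : C ⥤ C) [IsDGFunctor k F] (q : ℤ) : ModuleCat.{max w₀ u v} k :=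
  (Hoch k F).homology q

section Functoriality

variable {F : C ⥤ C} {F' : D ⥤ D} [IsDGFunctor k F] [IsDGFunctor k F']

/-- The map induced on sums of tensor powers by a DG functor. -/
noncomputable def mapT (H : C ⥤ D) [IsDGFunctor k H] : TSum k C →ₗ[k] TSum k D :=
  liftT k fun n => single k n ∘ₗ PiTensorProduct.map fun _ => mapTot k H

theorem mapT_tp (H : C ⥤ D) [IsDGFunctor k H] {n : ℕ} (v : Fin (n + 1) → Tot C) :
    mapT k H (single k n (tp k v)) = single k n (tp k fun i => mapTot k H (v i)) := by
  rw [mapT, liftT_single, LinearMap.comp_apply, PiTensorProduct.map_tprod]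

theorem inc_map_congr {H H' : C ⥤ D} (h : H = H') {X Y : C} (f : X ⟶ Y) :
    inc k (H.map f) = inc k (H'.map f) := by subst h; rfl

theorem mapTot_comm (H : C ⥤ D) [IsDGFunctor k H] (hH : F ⋙ H = H ⋙ F') (a : Tot C) :
    mapTot k H (mapTot k F a) = mapTot k F' (mapTot k H a) := by
  induction a using tot_induction k (C := C) with
  | h0 => simp
  | hadd _ _ h h' => simp [h, h']
  | hmk X Y p a ha =>
    obtain ⟨f, -, rfl⟩ := ha
    simp only [mapTot_inc]
    exact inc_map_congr k hH f

theorem map_intD (H : C ⥤ D) [IsDGFunctor k H] {n : ℕ} (v : Fin (n + 1) → Tot C) :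
    PiTensorProduct.map (fun _ => mapTot k H) (intD k C n (tp k v)) =
      intD k D n (tp k fun i => mapTot k H (v i)) := by
  rw [intD_tp, intD_tp, map_sum]
  refine Finset.sum_congr rfl fun i _ => ?_
  rw [PiTensorProduct.map_tprod]
  congr 1
  funext j
  simp only [dOp]
  split_ifs
  · exact mapTot_scale k H _ _
  · exact mapTot_dTot k H _
  · rfl

theorem map_face {n : ℕ} (H : C ⥤ D) [IsDGFunctor k H] {x : Fin (n + 3) → C}
    {p : Fin (n + 2) → ℤ} {v : Fin (n + 2) → Tot C} (h : IsStr k F x p v) (i : Fin (n + 1)) :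
    PiTensorProduct.map (fun _ => mapTot k H) (face k i (tp k v)) =
      face k i (tp k fun i => mapTot k H (v i)) := by
  rw [face_tp, face_tp, PiTensorProduct.map_tprod]
  congr 1
  funext l
  rcases lt_trichotomy l i with h' | h' | h'
  · rw [merge_lt _ h', merge_lt _ h']
  · subst h'
    rw [merge_eq, merge_eq]
    exact (h.arrow l.castSucc).map_mul H (h.arrow l.succ)
  · rw [merge_gt _ h', merge_gt _ h']

theorem map_barD {n : ℕ} (H : C ⥤ D) [IsDGFunctor k H] (hH : F ⋙ H = H ⋙ F')
    {x : Fin (n + 3) → C} {p : Fin (n + 2) → ℤ} {v : Fin (n + 2) → Tot C}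
    (h : IsStr k F x p v) :
    PiTensorProduct.map (fun _ => mapTot k H) (barD k F n (tp k v)) =
      barD k F' n (tp k fun i => mapTot k H (v i)) := by
  have h' := h.map (F' := F') H (fun X => Functor.congr_obj hH X)
  simp only [barD, LinearMap.add_apply, LinearMap.sum_apply, LinearMap.smul_apply, map_add,
    map_sum, map_smul, map_face k H h]
  congr 2
  rw [lastFace, lastFace, LinearMap.comp_apply, LinearMap.comp_apply, rot_str k h, rot_str k h',
    map_smul, map_smul, map_smul, map_face k H h.rotate]
  congr 3
  funext l
  refine Fin.cases ?_ (fun l => ?_) l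
  · exact mapTot_comm k H hH _
  · rfl

theorem mapT_totD (H : C ⥤ D) [IsDGFunctor k H] (hH : F ⋙ H = H ⋙ F') {q : ℤ} {t : TSum k C}
    (ht : t ∈ piece k F q) : mapT k H (totD k F t) = totD k F' (mapT k H t) := by
  refine piece_induction (P := fun t => mapT k H (totD k F t) = totD k F' (mapT k H t)) ht
    (by simp) (fun s t hs ht => by simp only [map_add, hs, ht])
    (fun a t ht => by simp only [map_smul, ht]) ?_
  intro n x p v h hq
  rw [mapT_tp, totD, totD, liftT_single, liftT_single]
  cases n with
  | zero =>
    simp only [colD, LinearMap.comp_apply]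
    rw [mapT, liftT_single, LinearMap.comp_apply, map_intD]
  | succ n =>
    simp only [colD, LinearMap.add_apply, LinearMap.smul_apply, LinearMap.comp_apply, map_add,
      map_smul]
    rw [mapT, liftT_single, liftT_single, LinearMap.comp_apply, LinearMap.comp_apply, map_intD,
      map_barD k H hH h]

theorem mapT_mem (H : C ⥤ D) [IsDGFunctor k H] (hH : F ⋙ H = H ⋙ F') {q : ℤ} {t : TSum k C}
    (ht : t ∈ piece k F q) : mapT k H t ∈ piece k F' q := by
  refine piece_induction (P := fun t => mapT k H t ∈ piece k F' q) ht
    (by rw [map_zero]; exact zero_mem _) (fun s t hs ht => by rw [map_add]; exact add_mem hs ht)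
    (fun a t ht => by rw [map_smul]; exact Submodule.smul_mem _ _ ht) ?_
  intro n x p v h hq
  rw [mapT_tp]
  exact (h.map (F' := F') H (fun X => Functor.congr_obj hH X)).mem_piece hq

/-- The morphism of Hochschild complexes `α₀ ⊗ ⋯ ⊗ αₙ ↦ H(α₀) ⊗ ⋯ ⊗ H(αₙ)` induced by a DG
functor `H` with `H F = F' H`. -/
noncomputable def hochMap {C D : Type u} [Category.{v} C] [Preadditive C] [Linear k C]
    [DGCategory k C] [Category.{v} D] [Preadditive D] [Linear k D] [DGCategory k D]
    {F : C ⥤ C} {F' : D ⥤ D} [IsDGFunctor k F] [IsDGFunctor k F']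
    (H : C ⥤ D) [IsDGFunctor k H] (hH : F ⋙ H = H ⋙ F') : Hoch k F ⟶ Hoch k F' where
  f q := ModuleCat.ofHom ((mapT k H).restrict fun _ ht => mapT_mem k H hH ht)
  comm' q r h := by
    obtain rfl : q + 1 = r := h
    simp only [Hoch, dif_pos]
    rw [← ModuleCat.ofHom_comp, ← ModuleCat.ofHom_comp]
    refine congrArg ModuleCat.ofHom (LinearMap.ext fun t => Subtype.ext ?_)
    exact (mapT_totD k H hH t.2).symm

end Functoriality

section Coinvariants

universe t

variable {k}
variable {G : Type v} [Group G]

section Modules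

variable (M : G → Type t) [∀ g, AddCommGroup (M g)] [∀ g, Module k (M g)]
  (a : ∀ h g : G, M g →ₗ[k] M (h * g * h⁻¹))
variable {N : G → Type t} [∀ g, AddCommGroup (N g)] [∀ g, Module k (N g)]
  {b : ∀ h g : G, N g →ₗ[k] N (h * g * h⁻¹)}

/-- The action of `h : G` on `⨁ g, M g` given by maps `M g → M (h g h⁻¹)`. -/
noncomputable def conjAct (h : G) : DirectSum G M →ₗ[k] DirectSum G M :=
  DirectSum.toModule k G _ fun g => DirectSum.lof k G M (h * g * h⁻¹) ∘ₗ a h g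

/-- The subspace spanned by the elements `y - h.y`. -/
def coinvKer : Submodule k (DirectSum G M) :=
  Submodule.span k {z | ∃ (h : G) (y : DirectSum G M), z = y - conjAct M a h y}

/-- The coinvariants of the action of `G` on `⨁ g, M g`. -/
abbrev Coinv : Type (max v t) := DirectSum G M ⧸ coinvKer M a

/-- The class in the coinvariants of an element of the summand `M g`. -/
noncomputable def coinvMk (g : G) : M g →ₗ[k] Coinv M a :=
  (coinvKer M a).mkQ ∘ₗ DirectSum.lof k G M g

theorem coinvMk_conj (h g : G) (x : M g) :
    coinvMk M a (h * g * h⁻¹) (a h g x) = coinvMk M a g x := by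
  have e : conjAct M a h (DirectSum.lof k G M g x) =
      DirectSum.lof k G M (h * g * h⁻¹) (a h g x) := by
    simp [conjAct, DirectSum.toModule_lof]
  exact ((Submodule.Quotient.eq (coinvKer M a)).2
    (Submodule.subset_span ⟨h, DirectSum.lof k G M g x, by rw [e]⟩)).symm

variable {M a}

/-- The linear map on coinvariants defined by compatible maps on the summands. -/
noncomputable def coinvLift {P : Type*} [AddCommGroup P] [Module k P] (φ : ∀ g, M g →ₗ[k] P)
    (hφ : ∀ h g x, φ (h * g * h⁻¹) (a h g x) = φ g x) : Coinv M a →ₗ[k] P :=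
  (coinvKer M a).liftQ (DirectSum.toModule k G P φ) (by
    rw [coinvKer, Submodule.span_le]
    rintro _ ⟨h, y, rfl⟩
    rw [SetLike.mem_coe, LinearMap.mem_ker, map_sub, sub_eq_zero]
    suffices e : DirectSum.toModule k G P φ =
        DirectSum.toModule k G P φ ∘ₗ conjAct M a h from LinearMap.congr_fun e y
    refine DirectSum.linearMap_ext k fun g => LinearMap.ext fun x => ?_
    simp [conjAct, DirectSum.toModule_lof, hφ])

theorem coinvLift_mk {P : Type*} [AddCommGroup P] [Module k P] (φ : ∀ g, M g →ₗ[k] P)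
    (hφ : ∀ h g x, φ (h * g * h⁻¹) (a h g x) = φ g x) (g : G) (x : M g) :
    coinvLift φ hφ (coinvMk M a g x) = φ g x := by
  simp [coinvLift, coinvMk, DirectSum.toModule_lof]

theorem coinv_ext {P : Type*} [AddCommGroup P] [Module k P] {φ ψ : Coinv M a →ₗ[k] P}
    (h : ∀ g x, φ (coinvMk M a g x) = ψ (coinvMk M a g x)) : φ = ψ :=
  Submodule.linearMap_qext _ (DirectSum.linearMap_ext k fun g => LinearMap.ext fun x => h g x)

end Modules

variable (K : G → CochainComplex (ModuleCat.{t} k) ℤ) (a : ∀ h g : G, K g ⟶ K (h * g * h⁻¹))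

theorem coinv_d_compat (q r : ℤ) (h g : G) (x : (K g).X q) :
    (coinvMk (fun g => (K g).X r) (fun h g => ((a h g).f r).hom) (h * g * h⁻¹) ∘ₗ
      ((K (h * g * h⁻¹)).d q r).hom) (((a h g).f q).hom x) =
    (coinvMk (fun g => (K g).X r) (fun h g => ((a h g).f r).hom) g ∘ₗ ((K g).d q r).hom) x := by
  have e : ((K (h * g * h⁻¹)).d q r).hom (((a h g).f q).hom x) =
      ((a h g).f r).hom (((K g).d q r).hom x) := by
    have := (a h g).comm q r
    exact congrArg (fun f => f.hom x) this
  rw [LinearMap.comp_apply, e, coinvMk_conj (fun g => (K g).X r)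
    (fun h g => ((a h g).f r).hom)]
  rfl

/-- The complex of coinvariants `(⨁ g, K g)_G` of complexes `K g` with maps
`K g ⟶ K (h g h⁻¹)`. -/
noncomputable def coinvComplex : CochainComplex (ModuleCat.{max v t} k) ℤ where
  X q := ModuleCat.of k (Coinv (fun g => (K g).X q) fun h g => ((a h g).f q).hom)
  d q r := ModuleCat.ofHom (coinvLift
    (fun g => coinvMk (fun g => (K g).X r) (fun h g => ((a h g).f r).hom) g ∘ₗ ((K g).d q r).hom)
    (coinv_d_compat K a q r))
  shape q r h := by
    refine ModuleCat.hom_ext (coinv_ext fun g x => ?_)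
    rw [ModuleCat.hom_ofHom, coinvLift_mk, (K g).shape q r h]
    simp
  d_comp_d' q r s _ _ := by
    refine ModuleCat.hom_ext (coinv_ext fun g x => ?_)
    rw [ModuleCat.hom_comp, ModuleCat.hom_ofHom, ModuleCat.hom_ofHom, LinearMap.comp_apply,
      coinvLift_mk, LinearMap.comp_apply, coinvLift_mk, LinearMap.comp_apply]
    have e : ((K g).d r s).hom (((K g).d q r).hom x) = 0 :=
      congrArg (fun f => f.hom x) ((K g).d_comp_d q r s)
    rw [e]
    simp

end Coinvariants

section CoinvariantsHomology

universe t

variable {k}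
variable {G : Type v} [Group G]
variable (K : G → CochainComplex (ModuleCat.{max v t} k) ℤ) (a : ∀ h g : G, K g ⟶ K (h * g * h⁻¹))

/-- The canonical morphism of complexes `K g ⟶ (⨁ g, K g)_G`. -/
noncomputable def coinvIncl (g : G) : K g ⟶ coinvComplex.{w₀, v, max v t} K a where
  f q := ModuleCat.ofHom (coinvMk (fun g => (K g).X q) (fun h g => ((a h g).f q).hom) g)
  comm' q r _ := by
    refine ModuleCat.hom_ext (LinearMap.ext fun x => ?_)
    exact coinvLift_mk (k := k) (M := fun g => (K g).X q)
      (a := fun h g => ((a h g).f q).hom)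
      (fun g => coinvMk (fun g => (K g).X r) (fun h g => ((a h g).f r).hom) g ∘ₗ
        ((K g).d q r).hom) (coinv_d_compat K a q r) g x

theorem coinvIncl_conj (h g : G) : a h g ≫ coinvIncl K a (h * g * h⁻¹) = coinvIncl K a g := by
  ext q x
  exact coinvMk_conj (fun g => (K g).X q) (fun h g => ((a h g).f q).hom) h g x

/-- The coinvariants `(⨁ g, H^q(K g))_G` of the homology. -/
abbrev CoinvHomology (q : ℤ) : Type (max v t) :=
  Coinv (fun g => (K g).homology q) fun h g => (HomologicalComplex.homologyMap (a h g) q).hom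

/-- The canonical map `(⨁ g, H^q(K g))_G → H^q((⨁ g, K g)_G)`. -/
noncomputable def coinvHomologyMap (q : ℤ) :
    CoinvHomology K a q →ₗ[k] (coinvComplex.{w₀, v, max v t} K a).homology q :=
  coinvLift (fun g => (HomologicalComplex.homologyMap (coinvIncl K a g) q).hom) (fun h g x => by
    rw [← coinvIncl_conj K a h g, HomologicalComplex.homologyMap_comp]
    rfl)

end CoinvariantsHomology

section Maps

variable {k}
variable {G : Type v} [Group G] (ρ : StrongAction k G C)

theorem StrongAction.conj_comm (h g : G) :
    ρ.F g ⋙ ρ.F h = ρ.F h ⋙ ρ.F (h * g * h⁻¹) := by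
  rw [← ρ.map_mul, ← ρ.map_mul, inv_mul_cancel_right]

/-- The action `h : C_•(C; g) ⟶ C_•(C; h g h⁻¹)`,
`α₀ ⊗ ⋯ ⊗ αₙ ↦ h(α₀) ⊗ ⋯ ⊗ h(αₙ)`. -/
noncomputable def hochAct (h g : G) : Hoch k (ρ.F g) ⟶ Hoch k (ρ.F (h * g * h⁻¹)) :=
  hochMap k (ρ.F h) (ρ.conj_comm h g)

/-- The complex `(⨁ g, C_•(C; g))_G`. -/
noncomputable def twistedHoch : CochainComplex (ModuleCat.{max w₀ u v} k) ℤ :=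
  coinvComplex.{w₀, v, max w₀ u v} (fun g => Hoch k (ρ.F g)) (hochAct ρ)

/-- The vector space `(⨁ g, HH_•(C; g))_G` in degree `q`. -/
abbrev TwistedHH (q : ℤ) : Type (max w₀ u v) :=
  CoinvHomology.{w₀, v, max w₀ u} (fun g => Hoch k (ρ.F g)) (hochAct ρ) q

/-- The canonical map `(⨁ g, HH_•(C; g))_G → H((⨁ g, C_•(C; g))_G)` in degree `q`. -/
noncomputable def twistedHHMap (q : ℤ) : TwistedHH ρ q →ₗ[k] (twistedHoch ρ).homology q :=
  coinvHomologyMap.{w₀, v, max w₀ u} (fun g => Hoch k (ρ.F g)) (hochAct ρ) q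

/-- The class in `(⨁ g, C_•(C; g))_G` of a basic chain of `C_•(C; g)`. -/
noncomputable def coinvCls {g : G} {n : ℕ} {q : ℤ} (c : BasicChain k (ρ.F g) n q) :
    (twistedHoch ρ).X q :=
  coinvMk (fun g => (Hoch k (ρ.F g)).X q) (fun h g => ((hochAct ρ h g).f q).hom) g c.cls

/-- A basic chain `(α₀, σ₀) ⊗ ⋯ ⊗ (αₙ, σₙ)` of total degree `q` of the Hochschild complex of
`C ⋊ G`, where `(αᵢ, σᵢ) : xᵢ₊₁ ⟶ xᵢ`, i.e. `αᵢ : σᵢ xᵢ₊₁ ⟶ xᵢ`, and `x₀ = xₙ₊₁`. -/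
structure CrossedChain (n : ℕ) (q : ℤ) where
  x : Fin (n + 2) → C
  closed : x 0 = x (Fin.last (n + 1))
  σ : Fin (n + 1) → G
  α (i : Fin (n + 1)) : (ρ.F (σ i)).obj (x i.succ) ⟶ x i.castSucc
  p : Fin (n + 1) → ℤ
  mem (i : Fin (n + 1)) : α i ∈ DGCategory.gr (k := k) _ _ (p i)
  deg : ∑ i, p i = q + n

variable {ρ}

/-- The chain `(α₀, σ₀) ⊗ ⋯ ⊗ (αₙ, σₙ)` of `C_•(C ⋊ G)`. -/
noncomputable def CrossedChain.toChain {n : ℕ} {q : ℤ} (c : CrossedChain ρ n q) :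
    BasicChain k (𝟭 (Semidirect ρ)) n q where
  x i := ⟨c.x i⟩
  closed := congrArg Semidirect.mk c.closed
  α i := Semidirect.homMk ⟨c.x i.succ⟩ ⟨c.x i.castSucc⟩ (c.σ i) (c.α i)
  p := c.p
  mem i := Semidirect.homMk_mem _ (c.mem i)
  deg := c.deg

/-- The product `σᵢ σᵢ₊₁ ⋯ σₙ` (which is `1` for `i = n + 1`). -/
def tailProd {n : ℕ} (σ : Fin (n + 1) → G) (i : Fin (n + 2)) : G :=
  ((List.ofFn σ).drop i).prod

theorem tailProd_last {n : ℕ} (σ : Fin (n + 1) → G) : tailProd σ (Fin.last (n + 1)) = 1 := by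
  rw [tailProd, List.drop_of_length_le (by rw [List.length_ofFn]; rfl), List.prod_nil]

theorem tailProd_castSucc {n : ℕ} (σ : Fin (n + 1) → G) (i : Fin (n + 1)) :
    tailProd σ i.castSucc = σ i * tailProd σ i.succ := by
  simp only [tailProd, Fin.val_castSucc, Fin.val_succ]
  rw [List.drop_eq_getElem_cons (by rw [List.length_ofFn]; exact i.2), List.prod_cons,
    List.getElem_ofFn]

theorem tailProd_inv {n : ℕ} (σ : Fin (n + 1) → G) (i : Fin (n + 1)) :
    (tailProd σ i.succ)⁻¹ = (tailProd σ i.castSucc)⁻¹ * σ i := by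
  rw [tailProd_castSucc]; group

theorem CrossedChain.obj_eq {n : ℕ} {q : ℤ} (c : CrossedChain ρ n q) (i : Fin (n + 1)) :
    (ρ.F (tailProd c.σ i.succ)⁻¹).obj (c.x i.succ) =
      (ρ.F (tailProd c.σ i.castSucc)⁻¹).obj ((ρ.F (c.σ i)).obj (c.x i.succ)) := by
  rw [tailProd_inv, ρ.obj_mul]

/-- The chain `(σ₀⋯σₙ)⁻¹(α₀) ⊗ (σ₁⋯σₙ)⁻¹(α₁) ⊗ ⋯ ⊗ σₙ⁻¹(αₙ)` of `C_•(C; (σ₀⋯σₙ)⁻¹)`.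
The `eqToHom` only identifies equal objects. -/
noncomputable def CrossedChain.nu {n : ℕ} {q : ℤ} (c : CrossedChain ρ n q) :
    BasicChain k (ρ.F (tailProd c.σ 0)⁻¹) n q where
  x i := (ρ.F (tailProd c.σ i)⁻¹).obj (c.x i)
  closed := by rw [tailProd_last, inv_one, ρ.obj_one, c.closed]
  α i := eqToHom (c.obj_eq i) ≫ (ρ.F (tailProd c.σ i.castSucc)⁻¹).map (c.α i)
  p := c.p
  mem i := eqToHom_comp_mem k _ (IsDGFunctor.map_mem (c.mem i))
  deg := c.deg

/-- The chain `h(α₀) ⊗ ⋯ ⊗ h(αₙ)` of `C_•(C; h g h⁻¹)`. -/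
noncomputable def BasicChain.act {g : G} {n : ℕ} {q : ℤ} (c : BasicChain k (ρ.F g) n q) (h : G) :
    BasicChain k (ρ.F (h * g * h⁻¹)) n q where
  x i := (ρ.F h).obj (c.x i)
  closed := by
    rw [c.closed]
    exact Functor.congr_obj (ρ.conj_comm h g) _
  α i := (ρ.F h).map (c.α i)
  p := c.p
  mem i := IsDGFunctor.map_mem (c.mem i)
  deg := c.deg

variable (ρ) in
/-- The morphism `(α, 1)` of `C ⋊ G`. -/
noncomputable def Semidirect.ofHom {X Y : C} (α : X ⟶ Y) :
    (⟨X⟩ : Semidirect ρ) ⟶ (⟨Y⟩ : Semidirect ρ) :=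
  Semidirect.homMk ⟨X⟩ ⟨Y⟩ 1 (eqToHom (ρ.obj_one X) ≫ α)

variable (ρ) in
/-- The morphism `(id, g) : Y ⟶ g Y` of `C ⋊ G`. -/
noncomputable def Semidirect.shift (g : G) (Y : C) :
    (⟨Y⟩ : Semidirect ρ) ⟶ (⟨(ρ.F g).obj Y⟩ : Semidirect ρ) :=
  Semidirect.homMk ⟨Y⟩ ⟨(ρ.F g).obj Y⟩ g (𝟙 ((ρ.F g).obj Y))

theorem Semidirect.ofHom_mem {X Y : C} {α : X ⟶ Y} {p : ℤ}
    (h : α ∈ DGCategory.gr (k := k) X Y p) :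
    Semidirect.ofHom ρ α ∈ DGCategory.gr (k := k) (⟨X⟩ : Semidirect ρ) ⟨Y⟩ p :=
  Semidirect.homMk_mem _ (eqToHom_comp_mem k _ h)

theorem Semidirect.shift_mem (g : G) (Y : C) :
    Semidirect.shift ρ g Y ∈ DGCategory.gr (k := k) (⟨Y⟩ : Semidirect ρ) ⟨(ρ.F g).obj Y⟩ 0 :=
  Semidirect.homMk_mem _ (DGCategory.id_mem _)

/-- The chain `((id, g⁻¹) ∘ (α₀, 1)) ⊗ (α₁, 1) ⊗ ⋯ ⊗ (αₙ, 1)` of `C_•(C ⋊ G)`, for a chain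
`α₀ ⊗ ⋯ ⊗ αₙ` of `C_•(C; g)`. -/
noncomputable def BasicChain.xi {g : G} {n : ℕ} {q : ℤ} (c : BasicChain k (ρ.F g) n q) :
    BasicChain k (𝟭 (Semidirect ρ)) n q where
  x := Fin.cons ⟨(ρ.F g⁻¹).obj (c.x 0)⟩ fun i => ⟨c.x i.succ⟩
  closed := by
    rw [← Fin.succ_last, Fin.cons_zero, Fin.cons_succ, c.closed, Functor.id_obj, ← ρ.obj_mul,
      inv_mul_cancel, ρ.obj_one]
    rfl
  α := Fin.cases (Semidirect.ofHom ρ (c.α 0) ≫ Semidirect.shift ρ g⁻¹ (c.x 0))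
    fun i => Semidirect.ofHom ρ (c.α i.succ)
  p := c.p
  mem i := by
    refine Fin.cases ?_ (fun i => ?_) i
    · have := DGCategory.comp_mem (Semidirect.ofHom_mem (ρ := ρ) (c.mem 0))
        (Semidirect.shift_mem (ρ := ρ) g⁻¹ (c.x 0))
      rw [zero_add] at this
      exact this
    · exact Semidirect.ofHom_mem (ρ := ρ) (c.mem i.succ)
  deg := c.deg

variable (ρ)

/-- The formula which defines `ν : C_•(C ⋊ G) → (⨁ g, C_•(C; g))_G`. -/
def IsNu (ν : Hoch k (𝟭 (Semidirect ρ)) ⟶ twistedHoch ρ) : Prop :=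
  ∀ (n : ℕ) (q : ℤ) (c : CrossedChain ρ n q), (ν.f q).hom c.toChain.cls = coinvCls ρ c.nu

/-- The formula which defines `ξ : (⨁ g, C_•(C; g))_G → C_•(C ⋊ G)`: the symmetrisation
`[α] ↦ |G|⁻¹ ∑ h, h.α` followed by the sum of the maps `ξ_g`. -/
def IsXi [Fintype G] (ξ : twistedHoch ρ ⟶ Hoch k (𝟭 (Semidirect ρ))) : Prop :=
  ∀ (g : G) (n : ℕ) (q : ℤ) (c : BasicChain k (ρ.F g) n q),
    (ξ.f q).hom (coinvCls ρ c) = ((Fintype.card G : k)⁻¹) • ∑ h : G, (c.act h).xi.cls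

end Maps

end Tensors

end DGHochschild

/-! In `C ⋊ G` the pair `(id, g)` is a closed isomorphism `X ⟶ g X` of degree 0. Take a chain of
labelled morphisms wᵢ = (αᵢ, σᵢ) : xᵢ₊₁ ⟶ xᵢ and h in G, and put γᵢ = h σ₀⋯σᵢ₋₁ and θᵢ = (id, γᵢ) :
xᵢ ⟶ γᵢ xᵢ. Replacing wᵢ by θᵢ wᵢ θᵢ₊₁⁻¹ = (γᵢ αᵢ, γᵢ σᵢ γᵢ₊₁⁻¹) trivialises every label with i > 0.
At place 0 one uses θₙ₊₁ w₀ θ₁⁻¹, whose label is the whole monodromy h σ₀⋯σₙ h⁻¹. The average over h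
of these normalised chains (`fullConj`) is exactly ξν of the given chain (`sum_xiAvg_nuT`).

Conjugation by isomorphisms is homotopic to the identity on Hochschild chains. The homotopy is the
alternating sum over j of the prisms w₀θ₁⁻¹, θ₁w₁θ₂⁻¹, …, θⱼwⱼθⱼ₊₁⁻¹, θⱼ₊₁, wⱼ₊₁, …, wₙ. By the face
relations everything cancels except the first face of the prism j = 0, which is w, and the last face
of the prism j = n, which is `fullConj` (`prism_alternating_sum`, `barD_prismSum_succ`). For a fixed
h the prisms do not commute with the last face, because rotating a string changes the initial value
of its gauge; the sum over all h does commute (`prismOp_tn`). Dividing by |G| gives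
`totD_prismHomotopy_add`, hence ξν = id - (dH + Hd).

In the other direction, ξ_g produces strings with labels (g⁻¹, 1, …, 1), from which ν recovers the
original chain in the component g (`nuPow_xiPow`). The symmetrisation disappears in the
coinvariants, so νξ = id (`nuLin_xi`). That ν commutes with the differentials then needs no
computation with faces: ξ is injective, and ξν = id - (dH + Hd) commutes with d (`nuLin_d`).

Finally, averaging over G splits the projection to coinvariants, both for complexes and for
homology, and this inverts the canonical map (`coinvHomologyMap_bijective`).

Both ν and the prisms depend on the labels of all factors at once. They are defined by a multilinear
formula for each string of labels and extended by `labLift`; identities are verified on strings of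
labelled homogeneous morphisms, which span the complex (`crossed_induction`). -/

namespace DGHochschild

open scoped Classical
open PiTensorProduct
open scoped TensorProduct

/-! ### The combinatorial cancellation in a prism decomposition -/

section AlternatingSums

/-- Here `A i j` stands for face `i` of prism `j`, and `B i j` for prism `j` of face `i`. Passing a
face through a prism shifts exactly one of the two indices by one, so matching terms of `A` and `B`
have opposite signs and cancel. What is left in prism `j` are the faces `j` and `j + 1`, which touch
the inserted entry; by `hdiag` these telescope. -/
theorem prism_alternating_sum {k M : Type*} [Field k] [AddCommGroup M] [Module k M] (N : ℕ)
    (A B : ℕ → ℕ → M)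
    (hlt : ∀ i j, i ≤ j → j < N → A i (j + 1) = B i j)
    (hgt : ∀ i j, j < i → i ≤ N → A (i + 1) j = B i j)
    (hdiag : ∀ j, j < N → A (j + 1) (j + 1) = A (j + 1) j) :
    (∑ j ∈ Finset.range (N + 1), ∑ i ∈ Finset.range (N + 2), (-1 : k) ^ (i + j) • A i j) +
      ∑ j ∈ Finset.range N, ∑ i ∈ Finset.range (N + 1), (-1 : k) ^ (i + j) • B i j =
      A 0 0 - A (N + 1) N := by
  -- Row `j` consists of the faces before the diagonal, the two diagonal faces `j` and `j + 1`, and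
  -- the faces beyond; the latter are reindexed by one so as to face the rows of `B`.
  have split : ∀ j ∈ Finset.range (N + 1),
      ∑ i ∈ Finset.range (N + 2), (-1 : k) ^ (i + j) • A i j =
        ((∑ i ∈ Finset.range j, (-1 : k) ^ (i + j) • A i j) +
          ∑ i ∈ Finset.Ico (j + 1) (N + 1), (-1 : k) ^ (i + 1 + j) • A (i + 1) j) +
        (A j j - A (j + 1) j) := by
    intro j hj
    rw [Finset.mem_range] at hj
    rw [← Finset.sum_range_add_sum_Ico _ (show j ≤ N + 2 by omega),
      Finset.sum_eq_sum_Ico_succ_bot (by omega), Finset.sum_eq_sum_Ico_succ_bot (by omega),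
      Finset.sum_Ico_add' (fun i => (-1 : k) ^ (i + j) • A i j) (j + 1) (N + 1) 1]
    have e1 : (-1 : k) ^ (j + j) = 1 := by rw [← two_mul, pow_mul]; simp
    have e2 : (-1 : k) ^ (j + 1 + j) = -1 := by
      rw [show j + 1 + j = 2 * j + 1 by ring, pow_succ, pow_mul]; simp
    rw [e1, e2, one_smul, neg_one_smul]
    abel
  have splitB : ∀ j ∈ Finset.range N, ∑ i ∈ Finset.range (N + 1), (-1 : k) ^ (i + j) • B i j =
      (∑ i ∈ Finset.range (j + 1), (-1 : k) ^ (i + j) • B i j) +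
        ∑ i ∈ Finset.Ico (j + 1) (N + 1), (-1 : k) ^ (i + j) • B i j := by
    intro j hj
    rw [Finset.mem_range] at hj
    rw [Finset.sum_range_add_sum_Ico _ (by omega)]
  have hneg : ∀ (m : ℕ) (y : M), (-1 : k) ^ (m + 1) • y + (-1 : k) ^ m • y = 0 := by
    intro m y
    rw [pow_succ, mul_neg_one, neg_smul, neg_add_cancel]
  rw [Finset.sum_congr rfl split, Finset.sum_congr rfl splitB, Finset.sum_add_distrib,
    Finset.sum_add_distrib, Finset.sum_add_distrib]
  have e1 : (∑ j ∈ Finset.range (N + 1), ∑ i ∈ Finset.range j, (-1 : k) ^ (i + j) • A i j) +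
      ∑ j ∈ Finset.range N, ∑ i ∈ Finset.range (j + 1), (-1 : k) ^ (i + j) • B i j = 0 := by
    -- Row 0 of `A` has nothing before the diagonal, so row `j + 1` of `A` pairs with row `j` of
    -- `B`.
    rw [Finset.sum_range_succ']
    simp only [Finset.range_zero, Finset.sum_empty, add_zero]
    rw [← Finset.sum_add_distrib]
    refine Finset.sum_eq_zero fun j hj => ?_
    rw [← Finset.sum_add_distrib]
    refine Finset.sum_eq_zero fun i hi => ?_
    rw [Finset.mem_range] at hi hj
    rw [hlt i j (by omega) hj, ← add_assoc]
    exact hneg _ _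
  have e2 : (∑ j ∈ Finset.range (N + 1), ∑ i ∈ Finset.Ico (j + 1) (N + 1),
      (-1 : k) ^ (i + 1 + j) • A (i + 1) j) +
      ∑ j ∈ Finset.range N, ∑ i ∈ Finset.Ico (j + 1) (N + 1), (-1 : k) ^ (i + j) • B i j = 0 := by
    -- Row `N` of `A` has nothing beyond the diagonal; the other rows pair with those of `B` of the
    -- same index.
    rw [Finset.sum_range_succ]
    simp only [Finset.Ico_self, Finset.sum_empty, add_zero]
    rw [← Finset.sum_add_distrib]
    refine Finset.sum_eq_zero fun j hj => ?_
    rw [← Finset.sum_add_distrib]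
    refine Finset.sum_eq_zero fun i hi => ?_
    rw [Finset.mem_Ico] at hi
    rw [hgt i j (by omega) (by omega), add_right_comm]
    exact hneg _ _
  have e3 : ∑ j ∈ Finset.range (N + 1), (A j j - A (j + 1) j) = A 0 0 - A (N + 1) N := by
    rw [Finset.sum_range_succ, Finset.sum_congr rfl fun j hj => by
      rw [← hdiag j (Finset.mem_range.1 hj)], Finset.sum_range_sub' (fun j => A j j)]
    abel
  rw [e3, ← sub_eq_zero]
  refine Eq.trans ?_ ((congrArg₂ (· + ·) e1 e2).trans (add_zero 0))
  abel

end AlternatingSums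

/-! ### Chains as sequences indexed by natural numbers -/

section Strings

variable (k : Type w₀) [Field k] {C : Type u} [Category.{v} C] [Preadditive C] [Linear k C]
  [DGCategory k C]

/-- The elementary tensor `w₀ ⊗ ⋯ ⊗ wₙ` of a sequence. -/
noncomputable def tn (n : ℕ) (w : ℕ → Tot C) : TPow k C n := tp k fun i : Fin (n + 1) => w i

/-- Merging the entries `i` and `i + 1` of a sequence by means of `op`. -/
def mergeN {α : Type*} (op : α → α → α) (i : ℕ) (w : ℕ → α) (l : ℕ) : α :=
  if l < i then w l else if l = i then op (w i) (w (i + 1)) else w (l + 1)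

/-- Moving the entry `n` of a sequence to the front and applying `f` to it. -/
def rotN {α : Type*} (f : α → α) (n : ℕ) (w : ℕ → α) (l : ℕ) : α :=
  if l = 0 then f (w n) else w (l - 1)

variable {k} in
theorem tn_congr {n : ℕ} {w w' : ℕ → Tot C} (h : ∀ l ≤ n, w l = w' l) :
    tn k n w = tn k n w' := by
  rw [tn, tn]
  congr 1
  funext i
  exact h i (Nat.lt_succ_iff.1 i.2)

theorem face_tn {n i : ℕ} (hi : i < n + 1) (w : ℕ → Tot C) :
    face k ⟨i, hi⟩ (tn k (n + 1) w) = tn k n (mergeN (cmp k) i w) := by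
  rw [tn, face_tp, tn]
  congr 1
  funext l
  simp only [merge, Fin.contractNth, mergeN, Fin.castSucc_mk, Fin.val_castSucc, Fin.val_succ]
  split_ifs with h1 h2
  · rfl
  · rw [h2]
  · rfl

/-- All the faces, indexed by natural numbers. -/
noncomputable def faceN (F : C ⥤ C) [IsDGFunctor k F] (n i : ℕ) :
    TPow k C (n + 1) →ₗ[k] TPow k C n :=
  if h : i < n + 1 then face k ⟨i, h⟩ else lastFace k F n

theorem barD_eq_faceN (F : C ⥤ C) [IsDGFunctor k F] (n : ℕ) (t : TPow k C (n + 1)) :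
    barD k F n t = ∑ i ∈ Finset.range (n + 2), (-1 : k) ^ i • faceN k F n i t := by
  rw [Finset.sum_range_succ, Finset.sum_range]
  simp only [barD, faceN, Fin.is_lt, dif_pos, lt_irrefl, dif_neg, not_false_eq_true,
    LinearMap.add_apply, LinearMap.sum_apply, LinearMap.smul_apply, Fin.eta]

theorem faceN_tn (F : C ⥤ C) [IsDGFunctor k F] {n i : ℕ} (hi : i ≤ n) (w : ℕ → Tot C) :
    faceN k F n i (tn k (n + 1) w) = tn k n (mergeN (cmp k) i w) := by
  rw [faceN, dif_pos (Nat.lt_succ_iff.2 hi), face_tn]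

/-- `w₀, …, wₙ` are composable homogeneous morphisms `wᵢ : xᵢ₊₁ ⟶ xᵢ` of degrees `pᵢ`, and
`x₀ = F xₙ₊₁`. -/
structure IsStrN (F : C ⥤ C) (n : ℕ) (x : ℕ → C) (p : ℕ → ℤ) (w : ℕ → Tot C) : Prop where
  closed : x 0 = F.obj (x (n + 1))
  arrow (i : ℕ) (hi : i ≤ n) : IsArrow k (x (i + 1)) (x i) (p i) (w i)

variable {k}

theorem IsStrN.isStr {F : C ⥤ C} {n : ℕ} {x : ℕ → C} {p : ℕ → ℤ} {w : ℕ → Tot C}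
    (h : IsStrN k F n x p w) :
    IsStr k F (fun i : Fin (n + 2) => x i) (fun i : Fin (n + 1) => p i)
      (fun i : Fin (n + 1) => w i) where
  closed := h.closed
  arrow i := by simpa using h.arrow i (Nat.lt_succ_iff.1 i.2)

/-- `Fin.ofNat` extends the indices periodically. Only the entries in range are constrained, so the
choice of extension is immaterial. -/
theorem IsStr.isStrN {F : C ⥤ C} {n : ℕ} {x : Fin (n + 2) → C} {p : Fin (n + 1) → ℤ}
    {v : Fin (n + 1) → Tot C} (h : IsStr k F x p v) :
    IsStrN k F n (fun l => x (Fin.ofNat (n + 2) l)) (fun l => p (Fin.ofNat (n + 1) l))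
      (fun l => v (Fin.ofNat (n + 1) l)) where
  closed := by
    have e : (Fin.ofNat (n + 2) (n + 1)) = Fin.last (n + 1) := Fin.ext (Nat.mod_eq_of_lt (by omega))
    simpa [e] using h.closed
  arrow i hi := by
    have e1 : Fin.ofNat (n + 2) (i + 1) = (Fin.ofNat (n + 1) i).succ :=
      Fin.ext (by simp [Nat.mod_eq_of_lt (show i + 1 < n + 2 by omega), Nat.mod_eq_of_lt (show i < n + 1 by omega)])
    have e2 : Fin.ofNat (n + 2) i = (Fin.ofNat (n + 1) i).castSucc :=
      Fin.ext (by simp [Nat.mod_eq_of_lt (show i < n + 2 by omega), Nat.mod_eq_of_lt (show i < n + 1 by omega)])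
    rw [e1, e2]
    exact h.arrow _

theorem tp_eq_tn {n : ℕ} (v : Fin (n + 1) → Tot C) :
    tp k v = tn k n fun l => v (Fin.ofNat (n + 1) l) := by
  rw [tn]
  congr 1
  funext i
  simp

theorem IsStrN.mem_piece {F : C ⥤ C} {n : ℕ} {x : ℕ → C} {p : ℕ → ℤ} {w : ℕ → Tot C}
    (h : IsStrN k F n x p w) {q : ℤ} (hq : ∑ i ∈ Finset.range (n + 1), p i = q + n) :
    single k n (tn k n w) ∈ piece k F q :=
  h.isStr.mem_piece (by rw [← hq, Finset.sum_range])

theorem piece_inductionN {F : C ⥤ C} {q : ℤ} {P : TSum k C → Prop} {t : TSum k C}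
    (ht : t ∈ piece k F q) (h0 : P 0) (hadd : ∀ s t, P s → P t → P (s + t))
    (hsmul : ∀ (a : k) t, P t → P (a • t))
    (hstr : ∀ (n : ℕ) (x : ℕ → C) (p : ℕ → ℤ) (w : ℕ → Tot C),
      IsStrN k F n x p w → ∑ i ∈ Finset.range (n + 1), p i = q + n →
        P (single k n (tn k n w))) : P t := by
  refine piece_induction ht h0 hadd hsmul fun n x p v h hq => ?_
  rw [tp_eq_tn]
  exact hstr n _ _ _ h.isStrN (by rw [← hq, Finset.sum_range]; simp)

/-- For homogeneous entries the even and odd parts in `rot` collapse to a single Koszul sign, by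
`rot_str`. -/
theorem lastFace_tn {F : C ⥤ C} [IsDGFunctor k F] {n : ℕ} {x : ℕ → C} {p : ℕ → ℤ}
    {w : ℕ → Tot C} (h : IsStrN k F (n + 1) x p w) :
    lastFace k F n (tn k (n + 1) w) = ((-1 : k) ^ (p (n + 1) * ∑ i ∈ Finset.range (n + 1), p i)) •
      tn k n (mergeN (cmp k) 0 (rotN (mapTot k F) (n + 1) w)) := by
  rw [lastFace, LinearMap.comp_apply, tn, rot_str k h.isStr, map_smul, Finset.sum_range]
  congr 1
  rw [← face_tn k (Nat.succ_pos n)]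
  refine congrArg _ (congrArg _ (funext fun l => ?_))
  refine Fin.cases ?_ (fun l => ?_) l
  · simp [rotate, rotN]
  · simp [rotate, rotN, Fin.init]

theorem faceN_tn_last {F : C ⥤ C} [IsDGFunctor k F] {n : ℕ} {x : ℕ → C} {p : ℕ → ℤ}
    {w : ℕ → Tot C} (h : IsStrN k F (n + 1) x p w) :
    faceN k F n (n + 1) (tn k (n + 1) w) =
      ((-1 : k) ^ (p (n + 1) * ∑ i ∈ Finset.range (n + 1), p i)) •
        tn k n (mergeN (cmp k) 0 (rotN (mapTot k F) (n + 1) w)) := by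
  rw [faceN, dif_neg (lt_irrefl _), lastFace_tn h]

variable (k C) in
/-- The operators `ε, …, ε, d, 1, …` with `d` at the place `i`. -/
noncomputable def dOpN (i l : ℕ) : Tot C →ₗ[k] Tot C :=
  if l < i then eps k else if l = i then dTot k else LinearMap.id

theorem intD_tn (n : ℕ) (w : ℕ → Tot C) :
    intD k C n (tn k n w) =
      ∑ i ∈ Finset.range (n + 1), tn k n fun l => dOpN k C i l (w l) := by
  rw [tn, intD_tp, Finset.sum_range]
  refine Finset.sum_congr rfl fun i _ => congrArg _ (funext fun l => ?_)
  simp only [dOp, dOpN, Fin.lt_def, Fin.ext_iff]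

variable (k) in
theorem mapTot_id (a : Tot C) : mapTot k (𝟭 C) a = a := by
  induction a using tot_induction k (C := C) with
  | h0 => simp
  | hadd _ _ h h' => simp [h, h']
  | hmk X Y p a ha =>
    obtain ⟨f, -, rfl⟩ := ha
    rw [mapTot_inc]; rfl

variable (k) in
theorem inc_eqToHom_comp {X Y Z : C} (h : X = Y) (f : Y ⟶ Z) :
    inc k (eqToHom h ≫ f) = inc k f := by
  subst h; simp

variable (k) in
theorem IsArrow.mul_id {X Y : C} {p : ℤ} {a : Tot C} (ha : IsArrow k X Y p a) :
    DGHochschild.mul k a (inc k (𝟙 X)) = a := by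
  obtain ⟨f, -, rfl⟩ := ha
  rw [mul_inc, Category.id_comp]

end Strings

/-! ### Prisms over a string, their faces and their internal differential -/

section Prism

variable (k : Type w₀) [Field k] {C : Type u} [Category.{v} C] [Preadditive C] [Linear k C]
  [DGCategory k C]

/-- Closed isomorphisms `θᵢ : xᵢ ⟶ yᵢ` of degree `0` with inverses `φᵢ`. -/
structure Gauge (x y : ℕ → C) (θ φ : ℕ → Tot C) : Prop where
  fwd (i : ℕ) : IsArrow k (x i) (y i) 0 (θ i)
  bwd (i : ℕ) : IsArrow k (y i) (x i) 0 (φ i)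
  inv (i : ℕ) : mul k (φ i) (θ i) = inc k (𝟙 (x i))
  d_fwd (i : ℕ) : dTot k (θ i) = 0
  d_bwd (i : ℕ) : dTot k (φ i) = 0

/-- Omitting the entry `i + 1` of a sequence. -/
def skip {α : Type*} (i : ℕ) (a : ℕ → α) (l : ℕ) : α := if l ≤ i then a l else a (l + 1)

/-- The string `w₀ φ₁, θ₁ w₁ φ₂, θ₂ w₂ φ₃, …`. -/
noncomputable def gconj (w θ φ : ℕ → Tot C) (l : ℕ) : Tot C :=
  if l = 0 then mul k (w 0) (φ 1) else mul k (θ l) (mul k (w l) (φ (l + 1)))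

/-- The string `w₀ φ₁, θ₁ w₁ φ₂, …, θⱼ wⱼ φⱼ₊₁, θⱼ₊₁, wⱼ₊₁, wⱼ₊₂, …`. -/
noncomputable def prism (j : ℕ) (w θ φ : ℕ → Tot C) (l : ℕ) : Tot C :=
  if l ≤ j then gconj k w θ φ l else if l = j + 1 then θ (j + 1) else w (l - 1)

/-- The string `θₙ₊₁ w₀ φ₁, θ₁ w₁ φ₂, θ₂ w₂ φ₃, …`. -/
noncomputable def fullConj (n : ℕ) (w θ φ : ℕ → Tot C) (l : ℕ) : Tot C :=
  if l = 0 then mul k (θ (n + 1)) (mul k (w 0) (φ 1))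
  else mul k (θ l) (mul k (w l) (φ (l + 1)))

/-- The objects of a prism. -/
def prismObj (j : ℕ) (x y : ℕ → C) (l : ℕ) : C :=
  if l = 0 then x 0 else if l ≤ j + 1 then y l else x (l - 1)

/-- The degrees of a prism. -/
def prismDeg (j : ℕ) (p : ℕ → ℤ) (l : ℕ) : ℤ :=
  if l ≤ j then p l else if l = j + 1 then 0 else p (l - 1)

/-- The inserted entry has degree 0, so a prism keeps the internal degree, and with it the Koszul
signs. The condition `j < m` puts the inserted place `j + 1` inside the range. -/
theorem sum_prismDeg {j m : ℕ} (h : j < m) (p : ℕ → ℤ) :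
    ∑ i ∈ Finset.range (m + 1), prismDeg j p i = ∑ i ∈ Finset.range m, p i := by
  induction m, h using Nat.le_induction with
  | base =>
    rw [Finset.sum_range_succ]
    simp only [prismDeg, Nat.succ_eq_add_one, Nat.not_succ_le_self, if_false, if_true, add_zero]
    exact Finset.sum_congr rfl fun i hi => if_pos (Nat.lt_succ_iff.1 (Finset.mem_range.1 hi))
  | succ m hm ih =>
    rw [Finset.sum_range_succ, ih, Finset.sum_range_succ _ m]
    congr 1
    rw [prismDeg, if_neg (by omega), if_neg (by omega), Nat.add_sub_cancel]

/-- The index map skips `j + 1`: it lists the places of a prism that come from a factor of the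
original string, leaving the inserted place as the extra term. -/
theorem sum_range_eq_sum_ne {M : Type*} [AddCommMonoid M] {j n : ℕ} (h : j ≤ n) (f : ℕ → M) :
    ∑ i ∈ Finset.range (n + 2), f i =
      (∑ i ∈ Finset.range (n + 1), f (if i ≤ j then i else i + 1)) + f (j + 1) := by
  induction n, h using Nat.le_induction with
  | base =>
    rw [Finset.sum_range_succ]
    congr 1
    exact Finset.sum_congr rfl fun i hi => by
      rw [if_pos (Nat.lt_succ_iff.1 (Finset.mem_range.1 hi))]
  | succ n hn ih =>
    rw [Finset.sum_range_succ, ih, Finset.sum_range_succ _ (n + 1), if_neg (by omega)]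
    exact add_right_comm _ _ _

variable {k}

theorem IsStrN.merge {F : C ⥤ C} {n i : ℕ} {x : ℕ → C} {p : ℕ → ℤ} {w : ℕ → Tot C}
    (h : IsStrN k F (n + 1) x p w) (hi : i ≤ n) :
    IsStrN k F n (DGHochschild.skip i x) (mergeN (· + ·) i p) (mergeN (cmp k) i w) where
  closed := by
    simp only [DGHochschild.skip, Nat.zero_le, if_true, if_neg (show ¬ n + 1 ≤ i by omega)]
    exact h.closed
  arrow l hl := by
    simp only [DGHochschild.skip, mergeN]
    split_ifs <;> first | (exfalso; omega) | exact h.arrow _ (by omega) | skip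
    subst l
    exact (h.arrow i (by omega)).mul (h.arrow (i + 1) (by omega))

/-- Entry 0 is conjugated only on its source side. Its target stays `x 0`, so the partially
conjugated string still closes up with the unconjugated end. -/
theorem IsStrN.gconj_zero {F : C ⥤ C} {n : ℕ} {x y : ℕ → C} {p : ℕ → ℤ} {w θ φ : ℕ → Tot C}
    (h : IsStrN k F n x p w) (hg : Gauge k x y θ φ) :
    IsArrow k (y 1) (x 0) (p 0) (gconj k w θ φ 0) := by
  have := (h.arrow 0 (Nat.zero_le n)).mul (hg.bwd 1)
  rw [add_zero] at this
  exact this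

theorem IsStrN.gconj_succ {F : C ⥤ C} {n : ℕ} {x y : ℕ → C} {p : ℕ → ℤ} {w θ φ : ℕ → Tot C}
    (h : IsStrN k F n x p w) (hg : Gauge k x y θ φ) {l : ℕ} (h0 : l ≠ 0) (hl : l ≤ n) :
    IsArrow k (y (l + 1)) (y l) (p l) (gconj k w θ φ l) := by
  have := (hg.fwd l).mul ((h.arrow l hl).mul (hg.bwd (l + 1)))
  rw [add_zero, zero_add] at this
  rw [gconj, if_neg h0]
  exact this

theorem IsStrN.prism {F : C ⥤ C} {n : ℕ} {x y : ℕ → C} {p : ℕ → ℤ} {w θ φ : ℕ → Tot C}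
    (h : IsStrN k F n x p w) (hg : Gauge k x y θ φ) {j : ℕ} (hj : j ≤ n) :
    IsStrN k F (n + 1) (prismObj j x y) (prismDeg j p) (prism k j w θ φ) where
  closed := by
    rw [prismObj, if_pos rfl, prismObj, if_neg (by omega), if_neg (by omega)]
    exact h.closed
  arrow l hl := by
    simp only [prismObj, prismDeg, DGHochschild.prism, Nat.succ_ne_zero, if_false,
      Nat.add_sub_cancel, Nat.add_le_add_iff_right]
    by_cases h1 : l ≤ j
    · simp only [if_pos h1]
      by_cases h0 : l = 0
      · subst h0
        exact h.gconj_zero hg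
      · rw [if_neg h0, if_pos (by omega)]
        exact h.gconj_succ hg h0 (by omega)
    · simp only [if_neg h1]
      by_cases h2 : l = j + 1
      · subst h2
        simp only [Nat.succ_ne_zero, if_false, le_refl, if_true]
        exact hg.fwd _
      · rw [if_neg (by omega), if_neg (by omega), if_neg h2, if_neg h2]
        have := h.arrow (l - 1) (by omega)
        rwa [Nat.sub_add_cancel (by omega)] at this

/-- The source of all cancellations in prisms; only the one-sided identity `φ θ = 1` is needed. -/
theorem mul_gauge_cancel {F : C ⥤ C} {n : ℕ} {x y : ℕ → C} {p : ℕ → ℤ} {w θ φ : ℕ → Tot C}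
    (h : IsStrN k F n x p w) (hg : Gauge k x y θ φ) {i : ℕ} (hi : i ≤ n) :
    mul k (mul k (w i) (φ (i + 1))) (θ (i + 1)) = w i := by
  rw [mul_assoc_tot, hg.inv, (h.arrow i hi).mul_id]

theorem mul_gauge_cancel_assoc {F : C ⥤ C} {n : ℕ} {x y : ℕ → C} {p : ℕ → ℤ}
    {w θ φ : ℕ → Tot C} (h : IsStrN k F n x p w) (hg : Gauge k x y θ φ) {i : ℕ} (hi : i ≤ n)
    (z : Tot C) :
    mul k (mul k (w i) (φ (i + 1))) (mul k (θ (i + 1)) z) = mul k (w i) z := by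
  rw [← mul_assoc_tot, mul_gauge_cancel h hg hi]

/-- Both merged factors are already conjugated, so the inner pair `φ θ` at place `i + 1` cancels.
The merged string is conjugated by the gauge without that place. -/
theorem mergeN_prism_lt {F : C ⥤ C} {n : ℕ} {x y : ℕ → C} {p : ℕ → ℤ} {w θ φ : ℕ → Tot C}
    (h : IsStrN k F n x p w) (hg : Gauge k x y θ φ) {i j : ℕ} (hij : i ≤ j) (hj : j < n) :
    mergeN (cmp k) i (prism k (j + 1) w θ φ) =
      prism k j (mergeN (cmp k) i w) (skip i θ) (skip i φ) := by
  funext l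
  rcases lt_trichotomy l i with hl | rfl | hl
  · rw [mergeN, if_pos hl, prism, if_pos (by omega), prism, if_pos (by omega)]
    simp only [gconj, skip, mergeN, if_pos hl, if_pos hl.le, if_pos (show 0 < i by omega),
      if_pos (show 1 ≤ i by omega), if_pos (show l + 1 ≤ i by omega)]
  · rw [mergeN, if_neg (lt_irrefl _), if_pos rfl, prism, if_pos (by omega), prism,
      if_pos (by omega), prism, if_pos hij]
    simp only [gconj, skip, mergeN, Nat.succ_ne_zero, if_false, le_refl, if_true, lt_irrefl,
      if_neg (show ¬ l + 1 ≤ l by omega), cmp]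
    split_ifs with h0 h1 h2 <;> first | (exfalso; omega) | skip
    · subst h0
      rw [mul_gauge_cancel_assoc h hg (Nat.zero_le n), mul_assoc_tot]
    · rw [mul_assoc_tot k (θ l), mul_gauge_cancel_assoc h hg (by omega), mul_assoc_tot k (w l)]
  · rw [mergeN, if_neg (by omega), if_neg (by omega), prism, prism]
    by_cases h1 : l ≤ j
    · rw [if_pos (by omega), if_pos h1]
      simp only [gconj, skip, mergeN, Nat.succ_ne_zero, if_false, if_neg (show l ≠ 0 by omega),
        if_neg (show ¬ l < i by omega), if_neg (show l ≠ i by omega),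
        if_neg (show ¬ l ≤ i by omega), if_neg (show ¬ l + 1 ≤ i by omega)]
    · rw [if_neg (by omega), if_neg h1]
      by_cases h2 : l = j + 1
      · rw [if_pos (by omega), if_pos h2, skip, if_neg (by omega)]
      · rw [if_neg (by omega), if_neg h2, mergeN, if_neg (by omega), if_neg (by omega)]
        congr 1
        omega

/-- The merge takes place among the factors after the inserted entry, which are not conjugated;
hence nothing has to cancel and no gauge condition appears. -/
theorem mergeN_prism_gt (w θ φ : ℕ → Tot C) {i j : ℕ} (hij : j < i) :
    mergeN (cmp k) (i + 1) (prism k j w θ φ) =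
      prism k j (mergeN (cmp k) i w) (skip i θ) (skip i φ) := by
  funext l
  by_cases h1 : l ≤ j
  · rw [mergeN, if_pos (by omega), prism, if_pos h1, prism, if_pos h1]
    simp only [gconj, skip, mergeN, if_pos (show l < i by omega), if_pos (show l ≤ i by omega),
      if_pos (show 0 < i by omega), if_pos (show 1 ≤ i by omega),
      if_pos (show l + 1 ≤ i by omega)]
  by_cases h2 : l = j + 1
  · rw [mergeN, if_pos (by omega), prism, if_neg h1, if_pos h2, prism, if_neg h1, if_pos h2, skip,
      if_pos (by omega)]
  have e : ∀ m, j + 1 < m → prism k j w θ φ m = w (m - 1) := fun m hm => by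
    rw [prism, if_neg (by omega), if_neg (by omega)]
  rw [prism, if_neg h1, if_neg h2, mergeN, mergeN, e l (by omega), e (i + 1) (by omega),
    e (i + 1 + 1) (by omega), e (l + 1) (by omega)]
  split_ifs <;> first | rfl | (exfalso; omega) | (congr 1; omega)

/-- Absorbing the inserted entry from the right into `θ w φ`, or multiplying the next unconjugated
factor by the inserted entry from the left, gives the same product `θ w` at place `j + 1`. -/
theorem mergeN_prism_diag {F : C ⥤ C} {n : ℕ} {x y : ℕ → C} {p : ℕ → ℤ} {w θ φ : ℕ → Tot C}
    (h : IsStrN k F n x p w) (hg : Gauge k x y θ φ) {j : ℕ} (hj : j < n) :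
    mergeN (cmp k) (j + 1) (prism k (j + 1) w θ φ) = mergeN (cmp k) (j + 1) (prism k j w θ φ) := by
  funext l
  rw [mergeN, mergeN]
  split_ifs with h1 h2
  · rw [prism, if_pos (by omega), prism, if_pos (by omega)]
  · simp only [prism, cmp, gconj, le_refl, if_true, Nat.succ_ne_zero, if_false,
      if_neg (show ¬ j + 1 + 1 ≤ j + 1 by omega), if_neg (show ¬ j + 1 ≤ j by omega),
      if_neg (show ¬ j + 1 + 1 ≤ j by omega), if_neg (show ¬ j + 1 + 1 = j + 1 by omega),
      Nat.add_sub_cancel]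
    rw [mul_assoc_tot, mul_gauge_cancel h hg (by omega)]
  · rw [prism, if_neg (by omega), if_neg (by omega), prism, if_neg (by omega), if_neg (by omega)]

theorem mergeN_prism_zero {F : C ⥤ C} {n : ℕ} {x y : ℕ → C} {p : ℕ → ℤ} {w θ φ : ℕ → Tot C}
    (h : IsStrN k F n x p w) (hg : Gauge k x y θ φ) :
    mergeN (cmp k) 0 (prism k 0 w θ φ) = w := by
  funext l
  rw [mergeN, if_neg (by omega)]
  split_ifs with h0
  · subst h0
    exact mul_gauge_cancel h hg (Nat.zero_le n)
  · rw [prism, if_neg (by omega), if_neg (by omega), Nat.add_sub_cancel]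

/-- As `j < n`, the factor that is rotated to the front is not conjugated, and `φ 1` stays on the
right of entry 0. Place 0 of the gauge plays no role. -/
theorem mergeN_rotN_prism (w θ φ : ℕ → Tot C) {n j : ℕ} (hj : j < n) :
    mergeN (cmp k) 0 (rotN (mapTot k (𝟭 C)) (n + 1) (prism k j w θ φ)) =
      prism k j (mergeN (cmp k) 0 (rotN (mapTot k (𝟭 C)) n w)) θ φ := by
  funext l
  by_cases h0 : l = 0
  · subst h0
    simp only [mergeN, rotN, prism, gconj, lt_irrefl, if_false, if_true, zero_add, one_ne_zero,
      Nat.sub_self, Nat.zero_le, mapTot_id, cmp, if_neg (show ¬ n + 1 ≤ j by omega),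
      if_neg (show ¬ n + 1 = j + 1 by omega), Nat.add_sub_cancel]
    rw [mul_assoc_tot]
  · rw [mergeN, if_neg (by omega), if_neg h0, rotN, if_neg (by omega), Nat.add_sub_cancel,
      prism, prism]
    have e : ∀ m, m ≠ 0 → mergeN (cmp k) 0 (rotN (mapTot k (𝟭 C)) n w) m = w m := fun m hm => by
      rw [mergeN, if_neg (by omega), if_neg hm, rotN, if_neg (by omega), Nat.add_sub_cancel]
    split_ifs with h1 h2
    · rw [gconj, if_neg h0, gconj, if_neg h0, e l h0]
    · rfl
    · rw [e _ (by omega)]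

/-- In the prism `j = n` the inserted entry itself is last; rotating it to the front supplies the
missing left factor of entry 0. -/
theorem mergeN_rotN_prism_last (w θ φ : ℕ → Tot C) (n : ℕ) {l : ℕ} (hl : l ≤ n) :
    mergeN (cmp k) 0 (rotN (mapTot k (𝟭 C)) (n + 1) (prism k n w θ φ)) l =
      fullConj k n w θ φ l := by
  by_cases h0 : l = 0
  · subst h0
    simp only [mergeN, rotN, prism, gconj, fullConj, lt_irrefl, if_false, if_true, zero_add,
      one_ne_zero, Nat.sub_self, Nat.zero_le, mapTot_id, cmp, if_neg (show ¬ n + 1 ≤ n by omega)]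
  · rw [mergeN, if_neg (by omega), if_neg h0, rotN, if_neg (by omega), Nat.add_sub_cancel,
      prism, if_pos hl, gconj, if_neg h0, fullConj, if_neg h0]

section Faces

variable {n : ℕ} {x y : ℕ → C} {p : ℕ → ℤ} {w θ φ : ℕ → Tot C}

/-- No sign appears, since the entry moved to the front has degree 0. -/
theorem faceN_prism_last (h : IsStrN k (𝟭 C) n x p w) (hg : Gauge k x y θ φ) :
    faceN k (𝟭 C) n (n + 1) (tn k (n + 1) (prism k n w θ φ)) =
      tn k n (fullConj k n w θ φ) := by
  rw [faceN_tn_last (h.prism hg le_rfl), prismDeg, if_neg (by omega), if_pos rfl, zero_mul,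
    zpow_zero, one_smul]
  exact tn_congr fun l hl => mergeN_rotN_prism_last w θ φ n hl

theorem faceN_prism_rot (h : IsStrN k (𝟭 C) (n + 1) x p w) (hg : Gauge k x y θ φ) {j : ℕ}
    (hj : j < n + 1) :
    faceN k (𝟭 C) (n + 1) (n + 2) (tn k (n + 2) (prism k j w θ φ)) =
      ((-1 : k) ^ (p (n + 1) * ∑ i ∈ Finset.range (n + 1), p i)) •
        tn k (n + 1) (prism k j (mergeN (cmp k) 0 (rotN (mapTot k (𝟭 C)) (n + 1) w)) θ φ) := by
  rw [faceN_tn_last (h.prism hg hj.le), sum_prismDeg hj, mergeN_rotN_prism w θ φ hj, prismDeg,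
    if_neg (by omega), if_neg (by omega)]
  rfl

end Faces

theorem Gauge.eps_fwd {x y : ℕ → C} {θ φ : ℕ → Tot C} (hg : Gauge k x y θ φ) (i : ℕ) :
    eps k (θ i) = θ i := by
  rw [(hg.fwd i).scale, zpow_zero, one_smul]

theorem Gauge.eps_bwd {x y : ℕ → C} {θ φ : ℕ → Tot C} (hg : Gauge k x y θ φ) (i : ℕ) :
    eps k (φ i) = φ i := by
  rw [(hg.bwd i).scale, zpow_zero, one_smul]

/-- The gauge consists of closed elements of degree 0: the Koszul operator fixes them, and in the
Leibniz rule only the differential of the middle factor survives. -/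
theorem gconj_dOpN {x y : ℕ → C} {θ φ : ℕ → Tot C} (hg : Gauge k x y θ φ) (i : ℕ)
    (w : ℕ → Tot C) (l : ℕ) :
    gconj k (fun l => dOpN k C i l (w l)) θ φ l = dOpN k C i l (gconj k w θ φ l) := by
  simp only [gconj]
  split_ifs with h0
  · subst h0
    simp only [dOpN]
    split_ifs
    · rw [eps_mul, hg.eps_bwd]
    · rw [dTot_mul, hg.d_bwd, map_zero, add_zero]
    · rfl
  · simp only [dOpN]
    split_ifs
    · rw [eps_mul, eps_mul, hg.eps_bwd, hg.eps_fwd]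
    · rw [dTot_mul, dTot_mul, hg.d_bwd, map_zero, add_zero, hg.d_fwd, map_zero,
        LinearMap.zero_apply, zero_add, hg.eps_fwd]
    · rfl

/-- A factor `i ≤ j` keeps its place in the prism, a later one moves right by one. The Koszul signs
agree because the entry in between has degree 0. -/
theorem prism_dOpN {x y : ℕ → C} {θ φ : ℕ → Tot C} (hg : Gauge k x y θ φ) (i j : ℕ)
    (w : ℕ → Tot C) :
    prism k j (fun l => dOpN k C i l (w l)) θ φ =
      fun l => dOpN k C (if i ≤ j then i else i + 1) l (prism k j w θ φ l) := by
  funext l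
  simp only [prism, gconj_dOpN hg]
  split_ifs with h1 h2 h3 h4 h5
  · rfl
  · simp only [dOpN]
    rw [if_pos (by omega), if_pos (by omega)]
  · rw [dOpN, if_neg (by omega), if_neg (by omega), LinearMap.id_apply]
  · rw [dOpN, if_pos (by omega), hg.eps_fwd]
  · rw [dOpN, dOpN, if_neg (by omega), if_neg (by omega), if_neg (by omega), if_neg (by omega)]
  · simp only [dOpN]
    split_ifs <;> first | rfl | (exfalso; omega)

theorem intD_prism {x y : ℕ → C} {θ φ : ℕ → Tot C} (hg : Gauge k x y θ φ) {n j : ℕ} (hj : j ≤ n)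
    (w : ℕ → Tot C) :
    intD k C (n + 1) (tn k (n + 1) (prism k j w θ φ)) =
      ∑ i ∈ Finset.range (n + 1),
        tn k (n + 1) (prism k j (fun l => dOpN k C i l (w l)) θ φ) := by
  rw [intD_tn, sum_range_eq_sum_ne hj]
  simp only [prism_dOpN hg]
  refine (congrArg₂ (· + ·) rfl ?_).trans (add_zero _)
  -- The extra term differentiates the inserted entry, which is closed.
  refine MultilinearMap.map_coord_zero _ ⟨j + 1, by omega⟩ ?_
  simp [dOpN, prism, hg.d_fwd]

end Prism

/-! ### Labelled strings in the semidirect product and their gauges -/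

section CrossedStrings

variable {k : Type w₀} [Field k] {C : Type u} [Category.{v} C] [Preadditive C] [Linear k C]
  [DGCategory k C] {G : Type v} [Group G] {ρ : StrongAction k G C}

/-- `a` is a morphism `(α, g) : X ⟶ Y` of `C ⋊ G` with `α` of degree `p`. -/
def IsLab (X Y : Semidirect ρ) (g : G) (p : ℤ) (a : Tot (Semidirect ρ)) : Prop :=
  ∃ α : (ρ.F g).obj X.obj ⟶ Y.obj, α ∈ DGCategory.gr (k := k) _ _ p ∧
    a = inc k (Semidirect.homMk X Y g α : X ⟶ Y)

theorem IsLab.isArrow {X Y : Semidirect ρ} {g : G} {p : ℤ} {a : Tot (Semidirect ρ)}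
    (h : IsLab X Y g p a) : IsArrow k X Y p a := by
  obtain ⟨α, hα, rfl⟩ := h
  exact ⟨_, Semidirect.homMk_mem g hα, rfl⟩

theorem IsLab.mul {X Y Z : Semidirect ρ} {g h : G} {p q : ℤ} {a b : Tot (Semidirect ρ)}
    (ha : IsLab Y Z g p a) (hb : IsLab X Y h q b) :
    IsLab X Z (g * h) (p + q) (DGHochschild.mul k a b) := by
  obtain ⟨α, hα, rfl⟩ := ha
  obtain ⟨β, hβ, rfl⟩ := hb
  exact ⟨_, eqToHom_comp_mem k _ (DGCategory.comp_mem (IsDGFunctor.map_mem hβ) hα),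
    (mul_inc k _ _).trans (congrArg _ (Semidirect.compHom_mk g h α β))⟩

theorem IsLab.d {X Y : Semidirect ρ} {g : G} {p : ℤ} {a : Tot (Semidirect ρ)}
    (h : IsLab X Y g p a) : IsLab X Y g (p + 1) (dTot k a) := by
  obtain ⟨α, hα, rfl⟩ := h
  exact ⟨_, DGCategory.d_mem hα, (dTot_inc k _).trans (congrArg _ (Semidirect.homD_mk g α))⟩

theorem IsLab.smul {X Y : Semidirect ρ} {g : G} {p : ℤ} {a : Tot (Semidirect ρ)}
    (h : IsLab X Y g p a) (c : k) : IsLab X Y g p (c • a) := by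
  obtain ⟨α, hα, rfl⟩ := h
  exact ⟨c • α, Submodule.smul_mem _ _ hα, by rw [map_smul]; exact (map_smul _ _ _).symm⟩

/-- `w₀, …, wₙ` are composable homogeneous morphisms `wᵢ = (αᵢ, σᵢ) : xᵢ₊₁ ⟶ xᵢ` of `C ⋊ G` of
degrees `pᵢ`, and `x₀ = xₙ₊₁`. -/
structure IsCross (n : ℕ) (x : ℕ → Semidirect ρ) (σ : ℕ → G) (p : ℕ → ℤ)
    (w : ℕ → Tot (Semidirect ρ)) : Prop where
  closed : x 0 = x (n + 1)
  arrow (i : ℕ) (hi : i ≤ n) : IsLab (x (i + 1)) (x i) (σ i) (p i) (w i)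

variable {n : ℕ} {x : ℕ → Semidirect ρ} {σ : ℕ → G} {p : ℕ → ℤ} {w : ℕ → Tot (Semidirect ρ)}

theorem IsCross.isStrN (h : IsCross n x σ p w) : IsStrN k (𝟭 (Semidirect ρ)) n x p w where
  closed := h.closed
  arrow i hi := (h.arrow i hi).isArrow

theorem IsCross.merge (h : IsCross (n + 1) x σ p w) {i : ℕ} (hi : i ≤ n) :
    IsCross n (skip i x) (mergeN (· * ·) i σ) (mergeN (· + ·) i p) (mergeN (cmp k) i w) where
  closed := (h.isStrN.merge hi).closed
  arrow l hl := by
    simp only [skip, mergeN]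
    split_ifs <;> first | (exfalso; omega) | exact h.arrow _ (by omega) | skip
    subst l
    exact (h.arrow i (by omega)).mul (h.arrow (i + 1) (by omega))

/-- The rotated last factor ends at `x (n + 1)`, which becomes the new object at place 0; the
objects at the other places are unchanged. -/
theorem IsCross.rotate (h : IsCross (n + 1) x σ p w) :
    IsCross n (fun l => if l = 0 then x (n + 1) else x l)
      (mergeN (· * ·) 0 (rotN id (n + 1) σ)) (mergeN (· + ·) 0 (rotN id (n + 1) p))
      (mergeN (cmp k) 0 (rotN (mapTot k (𝟭 (Semidirect ρ))) (n + 1) w)) where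
  closed := by simp
  arrow l hl := by
    by_cases h0 : l = 0
    · subst h0
      have h1 := h.arrow (n + 1) le_rfl
      rw [← h.closed] at h1
      simpa [mergeN, rotN, mapTot_id] using h1.mul (h.arrow 0 (Nat.zero_le _))
    · simpa [mergeN, rotN, h0] using h.arrow l (by omega)

theorem IsCross.dOpN (h : IsCross n x σ p w) (i : ℕ) :
    IsCross n x σ (fun l => if l = i then p l + 1 else p l)
      (fun l => DGHochschild.dOpN k (Semidirect ρ) i l (w l)) where
  closed := h.closed
  arrow l hl := by
    have hw := h.arrow l hl
    simp only [DGHochschild.dOpN]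
    rcases lt_trichotomy l i with h1 | h1 | h1
    · rw [if_pos h1, if_neg h1.ne, hw.isArrow.scale]
      exact hw.smul _
    · subst h1
      rw [if_neg (lt_irrefl _), if_pos rfl, if_pos rfl]
      exact hw.d
    · rw [if_neg h1.not_gt, if_neg h1.ne', if_neg h1.ne']
      exact hw

variable (ρ) in
/-- The inverse `(id, g⁻¹) : g Y ⟶ Y` of `(id, g) : Y ⟶ g Y`. -/
noncomputable def Semidirect.unshift (g : G) (Y : C) :
    (⟨(ρ.F g).obj Y⟩ : Semidirect ρ) ⟶ (⟨Y⟩ : Semidirect ρ) :=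
  Semidirect.homMk ⟨(ρ.F g).obj Y⟩ ⟨Y⟩ g⁻¹
    (eqToHom (by rw [← ρ.obj_mul, inv_mul_cancel, ρ.obj_one]))

theorem Semidirect.shift_unshift (g : G) (Y : C) :
    Semidirect.shift ρ g Y ≫ Semidirect.unshift ρ g Y = 𝟙 _ := by
  rw [comp_def]
  refine (compHom_mk _ _ _ _).trans ?_
  refine Eq.trans ?_ (homMk_congr (inv_mul_cancel g) (eqToHom (ρ.obj_one Y)))
  congr 1
  simp

variable (k) in
/-- The morphism `(id, g) : X ⟶ g X` of `C ⋊ G`, in the total morphism space. -/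
noncomputable def shiftTot (g : G) (X : Semidirect ρ) : Tot (Semidirect ρ) :=
  inc k (Semidirect.shift ρ g X.obj)

variable (k) in
/-- The inverse of the morphism `(id, g) : X ⟶ g X` of `C ⋊ G`, in the total morphism space. -/
noncomputable def unshiftTot (g : G) (X : Semidirect ρ) : Tot (Semidirect ρ) :=
  inc k (Semidirect.unshift ρ g X.obj)

variable (k) in
/-- The morphisms `(id, γᵢ) : xᵢ ⟶ γᵢ xᵢ` of `C ⋊ G`. -/
noncomputable def gaugeFwd (γ : ℕ → G) (x : ℕ → Semidirect ρ) (i : ℕ) : Tot (Semidirect ρ) :=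
  shiftTot k (γ i) (x i)

variable (k) in
/-- The inverses of the morphisms `(id, γᵢ) : xᵢ ⟶ γᵢ xᵢ` of `C ⋊ G`. -/
noncomputable def gaugeBwd (γ : ℕ → G) (x : ℕ → Semidirect ρ) (i : ℕ) : Tot (Semidirect ρ) :=
  unshiftTot k (γ i) (x i)

/-- Any sequence `γ` gives a gauge. A relation between `γ` and the labels of the string matters only
later, to make the conjugated labels trivial. -/
theorem gauge_gaugeFwd (γ : ℕ → G) (x : ℕ → Semidirect ρ) :
    Gauge k x (fun i => ⟨(ρ.F (γ i)).obj (x i).obj⟩) (gaugeFwd k γ x) (gaugeBwd k γ x) where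
  fwd i := ⟨_, Semidirect.shift_mem _ _, rfl⟩
  bwd i := ⟨_, Semidirect.homMk_mem _ (eqToHom_mem k _), rfl⟩
  inv i := by
    rw [gaugeFwd, gaugeBwd, shiftTot, unshiftTot, mul_inc, Semidirect.shift_unshift]
  d_fwd i := by
    rw [gaugeFwd, shiftTot, dTot_inc]
    refine (congrArg _ (Semidirect.homD_mk _ _)).trans ?_
    rw [d_id, map_zero, map_zero]
  d_bwd i := by
    rw [gaugeBwd, unshiftTot, dTot_inc]
    refine (congrArg _ (Semidirect.homD_mk _ _)).trans ?_
    rw [d_eqToHom, map_zero, map_zero]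

theorem gaugeFwd_skip (γ : ℕ → G) (x : ℕ → Semidirect ρ) (i : ℕ) :
    gaugeFwd k (skip i γ) (skip i x) = skip i (gaugeFwd k γ x) := by
  funext l
  by_cases h : l ≤ i <;> simp only [gaugeFwd, skip, h, if_true, if_false]

theorem gaugeBwd_skip (γ : ℕ → G) (x : ℕ → Semidirect ρ) (i : ℕ) :
    gaugeBwd k (skip i γ) (skip i x) = skip i (gaugeBwd k γ x) := by
  funext l
  by_cases h : l ≤ i <;> simp only [gaugeBwd, skip, h, if_true, if_false]

/-- The sequence `h, h σ₀, h σ₀ σ₁, …`. -/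
def partialProd (h : G) (σ : ℕ → G) : ℕ → G
  | 0 => h
  | i + 1 => partialProd h σ i * σ i

theorem partialProd_eq_mul (h : G) (σ : ℕ → G) (i : ℕ) :
    partialProd h σ i = h * partialProd 1 σ i := by
  induction i with
  | zero => simp [partialProd]
  | succ i ih => rw [partialProd, partialProd, ih, mul_assoc]

/-- A sum over the initial value `h` of the gauge is therefore a sum over its value at any chosen
place. This is used at place 1 or 2 for the face relations, and at place `n + 1` to identify ξν. -/
theorem partialProd_bijective (σ : ℕ → G) (i : ℕ) :
    Function.Bijective fun h => partialProd h σ i := by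
  have : (fun h => partialProd h σ i) = fun h => h * partialProd 1 σ i :=
    funext fun h => partialProd_eq_mul h σ i
  rw [this]
  exact Group.mulRight_bijective _

theorem partialProd_congr {h : G} {σ σ' : ℕ → G} {i : ℕ} (e : ∀ l < i, σ l = σ' l) :
    partialProd h σ i = partialProd h σ' i := by
  induction i with
  | zero => rfl
  | succ i ih => rw [partialProd, partialProd, ih fun l hl => e l (by omega), e i (by omega)]

section LabelledLift

/-- The morphism space of `C` indexed by the source, the target and the label of a morphism of
`C ⋊ G`. -/
abbrev LabHom (κ : Semidirect ρ × Semidirect ρ × G) : Type v :=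
  (ρ.F κ.2.2).obj κ.1.obj ⟶ κ.2.1.obj

/-- A morphism of `C ⋊ G` with given source, target and label, in the total morphism space. -/
noncomputable def labInc (κ : Semidirect ρ × Semidirect ρ × G) :
    LabHom κ →ₗ[k] Tot (Semidirect ρ) where
  toFun α := inc k (Semidirect.homMk κ.1 κ.2.1 κ.2.2 α : κ.1 ⟶ κ.2.1)
  map_add' α β := by rw [map_add]; exact map_add _ _ _
  map_smul' c α := by rw [map_smul]; exact map_smul _ _ _

/-- The decomposition of the total morphism space of `C ⋊ G` according to labels. -/
noncomputable def toLab : Tot (Semidirect ρ) →ₗ[k]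
    DirectSum (Semidirect ρ × Semidirect ρ × G) (LabHom (ρ := ρ)) :=
  lift k fun X Y => DirectSum.toModule k G _ fun g =>
    DirectSum.lof k (Semidirect ρ × Semidirect ρ × G) (LabHom (ρ := ρ)) (X, Y, g)

theorem toLab_labInc (κ : Semidirect ρ × Semidirect ρ × G) (α : LabHom κ) :
    toLab (labInc (k := k) κ α) = DirectSum.lof k _ (LabHom (ρ := ρ)) κ α := by
  refine (lift_inc k _ _).trans ?_
  exact DirectSum.toModule_lof k _ _

/-- The linear map on a tensor power of the total morphism space of `C ⋊ G` with given values on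
the tensor products of labelled morphisms. -/
noncomputable def labLift {M : Type*} [AddCommGroup M] [Module k M] {n : ℕ}
    (T : ∀ κ : Fin (n + 1) → Semidirect ρ × Semidirect ρ × G,
      MultilinearMap k (fun i => LabHom (κ i)) M) : TPow k (Semidirect ρ) n →ₗ[k] M :=
  PiTensorProduct.lift ((MultilinearMap.fromDirectSumEquiv (R := k)
    (κ := fun _ : Fin (n + 1) => Semidirect ρ × Semidirect ρ × G)
    (M := fun _ => LabHom (ρ := ρ)) T).compLinearMap fun _ => toLab)

/-- The gauge at one factor depends on the labels of the preceding factors, so prisms and ν are not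
tensor products of operators on `Tot`. Distributing the tensor power over labels lets each string of
labels have its own formula. -/
theorem labLift_tp {M : Type*} [AddCommGroup M] [Module k M] {n : ℕ}
    (T : ∀ κ : Fin (n + 1) → Semidirect ρ × Semidirect ρ × G,
      MultilinearMap k (fun i => LabHom (κ i)) M)
    (κ : Fin (n + 1) → Semidirect ρ × Semidirect ρ × G) (α : ∀ i, LabHom (κ i)) :
    labLift T (tp k fun i => labInc (κ i) (α i)) = T κ α := by
  rw [labLift, PiTensorProduct.lift.tprod, MultilinearMap.compLinearMap_apply]
  simp only [toLab_labInc]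
  exact MultilinearMap.fromDirectSumEquiv_lof (R := k)
    (κ := fun _ : Fin (n + 1) => Semidirect ρ × Semidirect ρ × G)
    (M := fun _ => LabHom (ρ := ρ)) T κ α

end LabelledLift

end CrossedStrings

/-! ### The prism operators summed over all gauges, and their face relations -/

section PrismOperators

/-- Neither `θ 0` nor `φ 0` occurs in a prism, so place 0 of a gauge is free. -/
theorem tn_prism_congr {k : Type w₀} [Field k] {C : Type u} [Category.{v} C] [Preadditive C]
    [Linear k C] [DGCategory k C] {n j : ℕ} (hj : j ≤ n) {w w' θ θ' φ φ' : ℕ → Tot C}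
    (hw : ∀ l ≤ n, w l = w' l) (hθ : ∀ l, l ≠ 0 → l ≤ n + 1 → θ l = θ' l)
    (hφ : ∀ l, l ≠ 0 → l ≤ n + 1 → φ l = φ' l) :
    tn k (n + 1) (prism k j w θ φ) = tn k (n + 1) (prism k j w' θ' φ') := by
  refine tn_congr fun l hl => ?_
  simp only [prism, gconj]
  split_ifs with h1 h2 h3
  · rw [hw 0 (by omega), hφ 1 (by omega) (by omega)]
  · rw [hw l (by omega), hφ (l + 1) (by omega) (by omega), hθ l h2 (by omega)]
  · exact hθ _ (by omega) (by omega)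
  · exact hw _ (by omega)

variable {k : Type w₀} [Field k] {C : Type u} [Category.{v} C] [Preadditive C] [Linear k C]
  [DGCategory k C] {G : Type v} [Group G] {ρ : StrongAction k G C}

/-- The objects of a string of labelled morphisms. -/
def labObj {n : ℕ} (κ : Fin (n + 1) → Semidirect ρ × Semidirect ρ × G) : ℕ → Semidirect ρ
  | 0 => (κ 0).2.1
  | l + 1 => (κ (Fin.ofNat (n + 1) l)).1

/-- The labels of a string of labelled morphisms. -/
def labLabel {n : ℕ} (κ : Fin (n + 1) → Semidirect ρ × Semidirect ρ × G) (l : ℕ) : G :=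
  (κ (Fin.ofNat (n + 1) l)).2.2

/-- The operators by which a gauge acts on the factors of a string. -/
noncomputable def gconjOp (θ φ : ℕ → Tot (Semidirect ρ)) (l : ℕ) :
    Tot (Semidirect ρ) →ₗ[k] Tot (Semidirect ρ) :=
  if l = 0 then (mul k).flip (φ 1) else mul k (θ l) ∘ₗ (mul k).flip (φ (l + 1))

theorem gconjOp_apply (w θ φ : ℕ → Tot (Semidirect ρ)) (l : ℕ) :
    gconjOp θ φ l (w l) = gconj k w θ φ l := by
  by_cases h : l = 0
  · subst h; simp [gconjOp, gconj]
  · simp [gconjOp, gconj, h]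

/-- A prism as a multilinear function of a string of labelled morphisms. -/
noncomputable def prismMulti (n j : ℕ) (h : G)
    (κ : Fin (n + 1) → Semidirect ρ × Semidirect ρ × G) :
    MultilinearMap k (fun i => LabHom (κ i)) (TPow k (Semidirect ρ) (n + 1)) :=
  ((PiTensorProduct.tprod k (s := fun _ : Fin (n + 2) => Tot (Semidirect ρ))).curryMid
    (Fin.ofNat (n + 2) (j + 1))
      (gaugeFwd k (partialProd h (labLabel κ)) (labObj κ) (j + 1))).compLinearMap fun i =>
    (if (i : ℕ) ≤ j then gconjOp (gaugeFwd k (partialProd h (labLabel κ)) (labObj κ))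
      (gaugeBwd k (partialProd h (labLabel κ)) (labObj κ)) i else LinearMap.id) ∘ₗ labInc (κ i)

/-- Links the `curryMid` description in `prismMulti` with the sequence `prism`. The bound `j ≤ n`
ensures that `Fin.ofNat (n + 2) (j + 1)` does not wrap around. -/
theorem tp_insertNth {n j : ℕ} (hj : j ≤ n) (w θ φ : ℕ → Tot (Semidirect ρ)) :
    tp k ((Fin.ofNat (n + 2) (j + 1)).insertNth (α := fun _ => Tot (Semidirect ρ)) (θ (j + 1))
      fun i : Fin (n + 1) =>
        (if (i : ℕ) ≤ j then gconjOp θ φ i else LinearMap.id (R := k)) (w i)) =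
      tn k (n + 1) (prism k j w θ φ) := by
  rw [tn]
  congr 1
  have hv : ((Fin.ofNat (n + 2) (j + 1) : Fin (n + 2)) : ℕ) = j + 1 := Nat.mod_eq_of_lt (by omega)
  rw [Fin.insertNth_eq_iff]
  refine ⟨?_, funext fun i => ?_⟩
  · rw [hv, prism, if_neg (by omega), if_pos rfl]
  · rw [Fin.removeNth]
    by_cases h : (i : ℕ) ≤ j
    · rw [Fin.succAbove_of_castSucc_lt _ _ (by rw [Fin.lt_def, hv]; simpa using Nat.lt_succ_of_le h),
        if_pos h, gconjOp_apply, Fin.val_castSucc, prism, if_pos h]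
    · rw [Fin.succAbove_of_le_castSucc _ _ (by rw [Fin.le_def, hv]; simpa using h),
        if_neg h, LinearMap.id_apply, Fin.val_succ, prism, if_neg (by omega), if_neg (by omega),
        Nat.add_sub_cancel]

variable [Fintype G]

variable (k ρ) in
/-- The sum over all gauges of the prisms of a string of morphisms of `C ⋊ G`. -/
noncomputable def prismOp (n j : ℕ) :
    TPow k (Semidirect ρ) n →ₗ[k] TPow k (Semidirect ρ) (n + 1) :=
  labLift fun κ => ∑ h : G, prismMulti n j h κ

variable {n : ℕ} {x : ℕ → Semidirect ρ} {σ : ℕ → G} {p : ℕ → ℤ} {w : ℕ → Tot (Semidirect ρ)}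

theorem IsCross.exists_labInc (hc : IsCross (k := k) n x σ p w) :
    ∃ (κ : Fin (n + 1) → Semidirect ρ × Semidirect ρ × G) (α : ∀ i, LabHom (κ i)),
      (∀ i : Fin (n + 1), w i = labInc (κ i) (α i)) ∧ (∀ l ≤ n, labLabel κ l = σ l) ∧
        ∀ l, l ≤ n + 1 → labObj κ l = x l := by
  have hex : ∀ i : Fin (n + 1), IsLab (x (i + 1)) (x i) (σ i) (p i) (w i) :=
    fun i => hc.arrow i (Nat.lt_succ_iff.1 i.2)
  choose α hα hw using hex
  refine ⟨fun i => (x (i + 1), x i, σ i), α, hw, fun l hl => ?_, fun l hl => ?_⟩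
  · simp [labLabel, Nat.mod_eq_of_lt (Nat.lt_succ_iff.2 hl)]
  · cases l with
    | zero => rfl
    | succ l => simp [labObj, Nat.mod_eq_of_lt (show l < n + 1 by omega)]

theorem prismOp_tn_partialProd (hc : IsCross (k := k) n x σ p w) {j : ℕ} (hj : j ≤ n) :
    prismOp k ρ n j (tn k n w) = ∑ h : G, tn k (n + 1)
      (prism k j w (gaugeFwd k (partialProd h σ) x) (gaugeBwd k (partialProd h σ) x)) := by
  obtain ⟨κ, α, hw, hσ, hx⟩ := hc.exists_labInc
  have e : tn k n w = tp k fun i => labInc (κ i) (α i) := by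
    rw [tn]; exact congrArg _ (funext hw)
  rw [e, prismOp, labLift_tp, _root_.sum_apply]
  refine Finset.sum_congr rfl fun h _ => ?_
  -- The labels read off from `κ` agree with `σ` only in range, which suffices for the places up to
  -- `n + 1` seen by a prism.
  have hγ : ∀ l, l ≤ n + 1 → partialProd h (labLabel κ) l = partialProd h σ l := fun l hl =>
    partialProd_congr fun m hm => hσ m (by omega)
  rw [prismMulti, MultilinearMap.compLinearMap_apply, MultilinearMap.curryMid_apply_apply]
  simp only [LinearMap.comp_apply, ← hw]
  refine (tp_insertNth hj w _ _).trans (tn_prism_congr hj (fun _ _ => rfl) (fun l _ hl => ?_)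
    fun l _ hl => ?_)
  · rw [gaugeFwd, gaugeFwd, hγ l hl, hx l hl]
  · rw [gaugeBwd, gaugeBwd, hγ l hl, hx l hl]

/-- A prism sees the gauge only at places from 1 on, where the recursion determines it by its value
at 1. If that value runs once through G, the sum does not depend on the parametrisation of the
gauges. This freedom is needed because a gauge inherited from a string before merging or rotating
may start at a different value. -/
theorem prismOp_tn (hc : IsCross (k := k) n x σ p w) {j : ℕ} (hj : j ≤ n) (γ : G → ℕ → G)
    (hγ : ∀ h i, i ≠ 0 → i ≤ n → γ h i * σ i = γ h (i + 1))
    (hbij : Function.Bijective fun h => γ h 1) :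
    prismOp k ρ n j (tn k n w) = ∑ h : G, tn k (n + 1)
      (prism k j w (gaugeFwd k (γ h) x) (gaugeBwd k (γ h) x)) := by
  rw [prismOp_tn_partialProd hc hj]
  -- `e h` is the initial value for which `partialProd` takes the value `γ h 1` at place 1.
  let e : G ≃ G := (Equiv.ofBijective _ hbij).trans (Equiv.mulRight (σ 0)⁻¹)
  rw [← Equiv.sum_comp e]
  refine Finset.sum_congr rfl fun h _ => ?_
  have key : ∀ i, i ≤ n → partialProd (e h) σ (i + 1) = γ h (i + 1) := by
    intro i
    induction i with
    | zero => intro _; simp [partialProd, e]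
    | succ i ih =>
      intro hi
      rw [partialProd, ih (by omega), hγ h (i + 1) (by omega) hi]
  have key' : ∀ l, l ≠ 0 → l ≤ n + 1 → partialProd (e h) σ l = γ h l := fun l h0 hl => by
    have := key (l - 1) (by omega)
    rwa [Nat.sub_add_cancel (by omega)] at this
  refine tn_prism_congr hj (fun _ _ => rfl) (fun l h0 hl => ?_) fun l h0 hl => ?_
  · rw [gaugeFwd, gaugeFwd, key' l h0 hl]
  · rw [gaugeBwd, gaugeBwd, key' l h0 hl]

/-- Merging removes the object at place `i + 1` and multiplies the two labels next to it, so the old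
gauge with that place omitted satisfies the recursion for the new labels. -/
theorem prismOp_merge (hc : IsCross (k := k) (n + 1) x σ p w) {i j : ℕ} (hi : i ≤ n)
    (hj : j ≤ n) :
    prismOp k ρ n j (tn k n (mergeN (cmp k) i w)) = ∑ h : G, tn k (n + 1)
      (prism k j (mergeN (cmp k) i w) (skip i (gaugeFwd k (partialProd h σ) x))
        (skip i (gaugeBwd k (partialProd h σ) x))) := by
  rw [prismOp_tn (hc.merge hi) hj fun h => skip i (partialProd h σ)]
  · simp only [gaugeFwd_skip, gaugeBwd_skip]
  · intro h l h0 hl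
    simp only [skip, mergeN]
    split_ifs <;> first | (exfalso; omega) | rfl | skip
    subst l
    rw [← mul_assoc]
    rfl
  -- The value at place 1 is the old value at 1, or at 2 if `i = 0`.
  · simp only [skip]
    split_ifs
    · exact partialProd_bijective _ _
    · exact partialProd_bijective _ _

/-- Rotation changes only label 0, so the old gauge still satisfies the recursion from place 1 on.
It is, however, the gauge of the new string with initial value `h * (σ (n + 1))⁻¹` instead of `h`:
here the summation over the whole group is indispensable. -/
theorem prismOp_rotate (hc : IsCross (k := k) (n + 1) x σ p w) {j : ℕ} (hj : j ≤ n) :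
    prismOp k ρ n j
        (tn k n (mergeN (cmp k) 0 (rotN (mapTot k (𝟭 (Semidirect ρ))) (n + 1) w))) =
      ∑ h : G, tn k (n + 1) (prism k j
        (mergeN (cmp k) 0 (rotN (mapTot k (𝟭 (Semidirect ρ))) (n + 1) w))
          (gaugeFwd k (partialProd h σ) x) (gaugeBwd k (partialProd h σ) x)) := by
  rw [prismOp_tn hc.rotate hj fun h => partialProd h σ]
  · refine Finset.sum_congr rfl fun h _ => tn_prism_congr hj (fun _ _ => rfl)
      (fun l h0 _ => ?_) fun l h0 _ => ?_
    · rw [gaugeFwd, gaugeFwd, if_neg h0]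
    · rw [gaugeBwd, gaugeBwd, if_neg h0]
  · intro h l h0 hl
    simp [mergeN, rotN, h0, partialProd]
  · exact partialProd_bijective _ _

/-- Differentiating a factor, or applying the Koszul sign to it, keeps its label; so all terms have
the same gauges and `intD_prism` applies to each. -/
theorem intD_prismOp (hc : IsCross (k := k) n x σ p w) {j : ℕ} (hj : j ≤ n) :
    intD k (Semidirect ρ) (n + 1) (prismOp k ρ n j (tn k n w)) =
      prismOp k ρ n j (intD k (Semidirect ρ) n (tn k n w)) := by
  rw [prismOp_tn_partialProd hc hj, map_sum, intD_tn, map_sum]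
  simp only [fun h : G => intD_prism (gauge_gaugeFwd (k := k) (partialProd h σ) x) hj w]
  rw [Finset.sum_comm]
  refine Finset.sum_congr rfl fun i _ => ?_
  rw [prismOp_tn_partialProd (hc.dOpN i) hj]

theorem faceN_prismOp_lt (hc : IsCross (k := k) (n + 1) x σ p w) {i j : ℕ} (hij : i ≤ j)
    (hj : j < n + 1) :
    faceN k (𝟭 (Semidirect ρ)) (n + 1) i (prismOp k ρ (n + 1) (j + 1) (tn k (n + 1) w)) =
      prismOp k ρ n j (faceN k (𝟭 (Semidirect ρ)) n i (tn k (n + 1) w)) := by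
  rw [prismOp_tn_partialProd hc (by omega), map_sum, faceN_tn k _ (by omega),
    prismOp_merge hc (by omega) (by omega)]
  refine Finset.sum_congr rfl fun h _ => ?_
  rw [faceN_tn k _ (by omega), mergeN_prism_lt hc.isStrN (gauge_gaugeFwd _ _) hij hj]

theorem faceN_prismOp_gt (hc : IsCross (k := k) (n + 1) x σ p w) {i j : ℕ} (hij : j < i)
    (hi : i ≤ n + 1) :
    faceN k (𝟭 (Semidirect ρ)) (n + 1) (i + 1) (prismOp k ρ (n + 1) j (tn k (n + 1) w)) =
      prismOp k ρ n j (faceN k (𝟭 (Semidirect ρ)) n i (tn k (n + 1) w)) := by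
  rw [prismOp_tn_partialProd hc (by omega), map_sum]
  rcases hi.lt_or_eq with hi | rfl
  · rw [faceN_tn k _ (by omega), prismOp_merge hc (by omega) (by omega)]
    refine Finset.sum_congr rfl fun h _ => ?_
    rw [faceN_tn k _ (by omega), mergeN_prism_gt w _ _ hij]
  -- The cyclic face, where the relation holds only after summing over `h`.
  · rw [faceN_tn_last hc.isStrN, map_smul, prismOp_rotate hc (by omega), Finset.smul_sum]
    exact Finset.sum_congr rfl fun h _ => faceN_prism_rot hc.isStrN (gauge_gaugeFwd _ _) hij

theorem faceN_prismOp_diag (hc : IsCross (k := k) n x σ p w) {j : ℕ} (hj : j < n) :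
    faceN k (𝟭 (Semidirect ρ)) n (j + 1) (prismOp k ρ n (j + 1) (tn k n w)) =
      faceN k (𝟭 (Semidirect ρ)) n (j + 1) (prismOp k ρ n j (tn k n w)) := by
  rw [prismOp_tn_partialProd hc (by omega), prismOp_tn_partialProd hc (by omega), map_sum, map_sum]
  refine Finset.sum_congr rfl fun h _ => ?_
  rw [faceN_tn k _ (by omega), faceN_tn k _ (by omega),
    mergeN_prism_diag hc.isStrN (gauge_gaugeFwd _ _) hj]

/-- In this face the gauge cancels for every `h`, so each group element contributes the original
string. This is the factor |G| divided out in `prismHomotopy`. -/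
theorem faceN_prismOp_zero (hc : IsCross (k := k) n x σ p w) :
    faceN k (𝟭 (Semidirect ρ)) n 0 (prismOp k ρ n 0 (tn k n w)) =
      (Fintype.card G : k) • tn k n w := by
  rw [prismOp_tn_partialProd hc (by omega), map_sum]
  have : ∀ h : G, faceN k (𝟭 (Semidirect ρ)) n 0 (tn k (n + 1)
      (prism k 0 w (gaugeFwd k (partialProd h σ) x) (gaugeBwd k (partialProd h σ) x))) =
      tn k n w := fun h => by
    rw [faceN_tn k _ (by omega), mergeN_prism_zero hc.isStrN (gauge_gaugeFwd _ _)]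
  simp only [this, Finset.sum_const, Finset.card_univ, Nat.cast_smul_eq_nsmul]

theorem faceN_prismOp_last (hc : IsCross (k := k) n x σ p w) :
    faceN k (𝟭 (Semidirect ρ)) n (n + 1) (prismOp k ρ n n (tn k n w)) =
      ∑ h : G, tn k n (fullConj k n w (gaugeFwd k (partialProd h σ) x)
        (gaugeBwd k (partialProd h σ) x)) := by
  rw [prismOp_tn_partialProd hc le_rfl, map_sum]
  exact Finset.sum_congr rfl fun h _ => faceN_prism_last hc.isStrN (gauge_gaugeFwd _ _)

variable (k ρ) in
/-- The alternating sum of the prism operators. -/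
noncomputable def prismSum (n : ℕ) :
    TPow k (Semidirect ρ) n →ₗ[k] TPow k (Semidirect ρ) (n + 1) :=
  ∑ j ∈ Finset.range (n + 1), (-1 : k) ^ j • prismOp k ρ n j

theorem barD_prismSum (n : ℕ) (t : TPow k (Semidirect ρ) n) :
    barD k (𝟭 (Semidirect ρ)) n (prismSum k ρ n t) =
      ∑ j ∈ Finset.range (n + 1), ∑ i ∈ Finset.range (n + 2), (-1 : k) ^ (i + j) •
        faceN k (𝟭 (Semidirect ρ)) n i (prismOp k ρ n j t) := by
  simp only [barD_eq_faceN, prismSum, LinearMap.sum_apply, LinearMap.smul_apply, map_sum,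
    map_smul, Finset.smul_sum, smul_smul, pow_add]
  exact Finset.sum_congr rfl fun _ _ => Finset.sum_congr rfl fun _ _ => by rw [mul_comm]

theorem intD_prismSum (hc : IsCross (k := k) n x σ p w) :
    intD k (Semidirect ρ) (n + 1) (prismSum k ρ n (tn k n w)) =
      prismSum k ρ n (intD k (Semidirect ρ) n (tn k n w)) := by
  simp only [prismSum, LinearMap.sum_apply, LinearMap.smul_apply, map_sum, map_smul]
  refine Finset.sum_congr rfl fun j hj => ?_
  rw [intD_prismOp hc (Nat.lt_succ_iff.1 (Finset.mem_range.1 hj))]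

theorem barD_prismSum_zero (hc : IsCross (k := k) 0 x σ p w) :
    barD k (𝟭 (Semidirect ρ)) 0 (prismSum k ρ 0 (tn k 0 w)) =
      (Fintype.card G : k) • tn k 0 w - ∑ h : G, tn k 0
        (fullConj k 0 w (gaugeFwd k (partialProd h σ) x) (gaugeBwd k (partialProd h σ) x)) := by
  rw [← faceN_prismOp_zero hc, ← faceN_prismOp_last hc, barD_prismSum]
  -- A chain of length 0 has no faces: the second family is taken to be 0 and the hypotheses are
  -- vacuous.
  have := prism_alternating_sum (k := k) 0
    (fun i j => faceN k (𝟭 (Semidirect ρ)) 0 i (prismOp k ρ 0 j (tn k 0 w)))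
    (fun _ _ => (0 : TPow k (Semidirect ρ) 0))
    (by omega) (by omega) (by omega)
  rw [← this]
  simp

/-- The face relations above are exactly the hypotheses of `prism_alternating_sum`; the two
surviving faces are the string itself and its full conjugates. -/
theorem barD_prismSum_succ (hc : IsCross (k := k) (n + 1) x σ p w) :
    barD k (𝟭 (Semidirect ρ)) (n + 1) (prismSum k ρ (n + 1) (tn k (n + 1) w)) +
        prismSum k ρ n (barD k (𝟭 (Semidirect ρ)) n (tn k (n + 1) w)) =
      (Fintype.card G : k) • tn k (n + 1) w - ∑ h : G, tn k (n + 1)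
        (fullConj k (n + 1) w (gaugeFwd k (partialProd h σ) x)
          (gaugeBwd k (partialProd h σ) x)) := by
  rw [← faceN_prismOp_zero hc, ← faceN_prismOp_last hc,
    barD_prismSum]
  rw [← prism_alternating_sum (k := k) (n + 1)
    (fun i j => faceN k (𝟭 (Semidirect ρ)) (n + 1) i (prismOp k ρ (n + 1) j (tn k (n + 1) w)))
    (fun i j => prismOp k ρ n j (faceN k (𝟭 (Semidirect ρ)) n i (tn k (n + 1) w)))
    (fun i j hij hj => faceN_prismOp_lt hc hij hj) (fun i j hij hi => faceN_prismOp_gt hc hij hi)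
    (fun j hj => faceN_prismOp_diag hc hj)]
  congr 1
  simp only [barD_eq_faceN, prismSum, LinearMap.sum_apply, LinearMap.smul_apply, map_sum,
    map_smul, Finset.smul_sum, smul_smul, pow_add, mul_comm]
  rw [Finset.sum_comm]
  exact Finset.sum_congr rfl fun _ _ => Finset.sum_congr rfl fun _ _ => by rw [mul_comm]

end PrismOperators

/-! ### The homotopy on the total complex -/

section Homotopy

variable (k : Type w₀) [Field k] {C : Type u} [Category.{v} C] [Preadditive C] [Linear k C]
  [DGCategory k C] {G : Type v} [Group G] [Fintype G] (ρ : StrongAction k G C)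

/-- The contracting homotopy on the sum of the tensor powers. -/
noncomputable def prismHomotopy : TSum k (Semidirect ρ) →ₗ[k] TSum k (Semidirect ρ) :=
  (Fintype.card G : k)⁻¹ • liftT k fun n => single k (n + 1) ∘ₗ prismSum k ρ n

variable {k ρ}
variable {n : ℕ} {x : ℕ → Semidirect ρ} {σ : ℕ → G} {p : ℕ → ℤ} {w : ℕ → Tot (Semidirect ρ)}

theorem prismHomotopy_single (n : ℕ) (t : TPow k (Semidirect ρ) n) :
    prismHomotopy k ρ (single k n t) =
      (Fintype.card G : k)⁻¹ • single k (n + 1) (prismSum k ρ n t) := by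
  rw [prismHomotopy, LinearMap.smul_apply, liftT_single, LinearMap.comp_apply]

/-- Prisms commute with the internal differential, whose sign `(-1) ^ n` changes when the length
grows by one. The internal contributions to dH + Hd therefore cancel, and only the bar part remains.
-/
theorem totD_prismHomotopy_add (hG : (Fintype.card G : k) ≠ 0)
    (hc : IsCross (k := k) n x σ p w) :
    totD k (𝟭 (Semidirect ρ)) (prismHomotopy k ρ (single k n (tn k n w))) +
        prismHomotopy k ρ (totD k (𝟭 (Semidirect ρ)) (single k n (tn k n w))) =
      single k n (tn k n w) - (Fintype.card G : k)⁻¹ • ∑ h : G, single k n (tn k n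
        (fullConj k n w (gaugeFwd k (partialProd h σ) x) (gaugeBwd k (partialProd h σ) x))) := by
  have hs : ∀ n (y : TPow k (Semidirect ρ) n), totD k (𝟭 (Semidirect ρ)) (single k n y) =
      colD k (𝟭 (Semidirect ρ)) n y := fun n y => liftT_single k _ n y
  have expand : ∀ y : TPow k (Semidirect ρ) n, y = (Fintype.card G : k) • tn k n w -
      ∑ h : G, tn k n (fullConj k n w (gaugeFwd k (partialProd h σ) x)
        (gaugeBwd k (partialProd h σ) x)) →
      (Fintype.card G : k)⁻¹ • single k n y = single k n (tn k n w) -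
        (Fintype.card G : k)⁻¹ • ∑ h : G, single k n (tn k n
        (fullConj k n w (gaugeFwd k (partialProd h σ) x) (gaugeBwd k (partialProd h σ) x))) := by
    rintro _ rfl
    rw [map_sub, map_smul, smul_sub, inv_smul_smul₀ hG, map_sum]
  cases n with
  | zero =>
    rw [← expand _ (barD_prismSum_zero hc), prismHomotopy_single, map_smul, hs, hs, colD, colD,
      LinearMap.add_apply, LinearMap.smul_apply, LinearMap.comp_apply, LinearMap.comp_apply,
      LinearMap.comp_apply, prismHomotopy_single, ← intD_prismSum hc, ← smul_add]
    congr 1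
    simp only [zero_add, pow_one, neg_smul, one_smul]
    abel
  | succ n =>
    rw [← expand _ (barD_prismSum_succ hc), prismHomotopy_single, map_smul, hs, hs, colD, colD,
      LinearMap.add_apply, LinearMap.smul_apply, LinearMap.comp_apply, LinearMap.comp_apply,
      LinearMap.add_apply, LinearMap.smul_apply, LinearMap.comp_apply, LinearMap.comp_apply,
      map_add, map_smul, prismHomotopy_single, prismHomotopy_single, ← intD_prismSum hc,
      smul_comm ((-1 : k) ^ (n + 1)), ← smul_add, ← smul_add, map_add]
    congr 1
    rw [pow_succ _ (n + 1), mul_neg_one, neg_smul]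
    abel

/-- A prism is longer by one factor and has the same internal degree, so the total degree drops by
one. -/
theorem prismHomotopy_mem (hc : IsCross (k := k) n x σ p w) {q r : ℤ}
    (hq : ∑ i ∈ Finset.range (n + 1), p i = q + n) (hr : r + 1 = q) :
    prismHomotopy k ρ (single k n (tn k n w)) ∈ piece k (𝟭 (Semidirect ρ)) r := by
  rw [prismHomotopy_single, prismSum, LinearMap.sum_apply, map_sum]
  refine Submodule.smul_mem _ _ (Submodule.sum_mem _ fun j hj => ?_)
  have hj' : j ≤ n := Nat.lt_succ_iff.1 (Finset.mem_range.1 hj)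
  rw [LinearMap.smul_apply, map_smul, prismOp_tn_partialProd hc hj', map_sum]
  refine Submodule.smul_mem _ _ (Submodule.sum_mem _ fun h _ => ?_)
  refine (hc.isStrN.prism (gauge_gaugeFwd _ _) hj').mem_piece ?_
  rw [sum_prismDeg (by omega), hq, ← hr]
  push_cast
  ring

end Homotopy

/-! ### The calculus of labelled morphisms (α, g) -/

section Lab

variable {k : Type w₀} [Field k] {C : Type u} [Category.{v} C] [Preadditive C] [Linear k C]
  [DGCategory k C] {G : Type v} [Group G] (ρ : StrongAction k G C)

theorem mapTot_mapTot (g h : G) (a : Tot C) :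
    mapTot k (ρ.F g) (mapTot k (ρ.F h) a) = mapTot k (ρ.F (g * h)) a := by
  induction a using tot_induction k (C := C) with
  | h0 => simp
  | hadd _ _ h h' => simp [h, h']
  | hmk X Y p a ha =>
    obtain ⟨f, -, rfl⟩ := ha
    rw [mapTot_inc, mapTot_inc, mapTot_inc, ← Functor.comp_map]
    exact inc_map_congr k (ρ.map_mul g h).symm f

theorem mapTot_one (a : Tot C) : mapTot k (ρ.F 1) a = a := by
  induction a using tot_induction k (C := C) with
  | h0 => simp
  | hadd _ _ h h' => simp [h, h']
  | hmk X Y p a ha =>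
    obtain ⟨f, -, rfl⟩ := ha
    rw [mapTot_inc]
    exact inc_map_congr k ρ.map_one f

theorem StrongAction.obj_mul_inv (g : G) (X : C) : (ρ.F g).obj ((ρ.F g⁻¹).obj X) = X := by
  rw [← ρ.obj_mul, mul_inv_cancel, ρ.obj_one]

theorem StrongAction.obj_inv_mul (g : G) (X : C) : (ρ.F g⁻¹).obj ((ρ.F g).obj X) = X := by
  rw [← ρ.obj_mul, inv_mul_cancel, ρ.obj_one]

/-- The embedding `α ↦ (α, g)` of the total morphism space of `C` into that of `C ⋊ G`. -/
noncomputable def lab (g : G) : Tot C →ₗ[k] Tot (Semidirect ρ) :=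
  lift k fun Z Y =>
    { toFun := fun f => inc k (Semidirect.homMk ⟨(ρ.F g⁻¹).obj Z⟩ ⟨Y⟩ g
        (eqToHom (ρ.obj_mul_inv g Z) ≫ f) : (⟨(ρ.F g⁻¹).obj Z⟩ : Semidirect ρ) ⟶ ⟨Y⟩)
      map_add' := fun f f' => by
        rw [Preadditive.comp_add, map_add]; exact map_add _ _ _
      map_smul' := fun c f => by
        rw [Linear.comp_smul, map_smul]; exact map_smul _ _ _ }

theorem lab_inc' (g : G) {Z Y : C} (f : Z ⟶ Y) : lab ρ g (inc k f) =
    inc k (Semidirect.homMk ⟨(ρ.F g⁻¹).obj Z⟩ ⟨Y⟩ g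
        (eqToHom (ρ.obj_mul_inv g Z) ≫ f) : (⟨(ρ.F g⁻¹).obj Z⟩ : Semidirect ρ) ⟶ ⟨Y⟩) :=
  lift_inc k _ f

variable {ρ}

theorem lab_inc (g : G) {X Y : Semidirect ρ} (f : (ρ.F g).obj X.obj ⟶ Y.obj) :
    lab ρ g (inc k f) = inc k (Semidirect.homMk X Y g f : X ⟶ Y) := by
  rw [lab_inc']
  -- The source given by `lab` is g⁻¹(g X), only propositionally equal to X; with a variable object
  -- in its place the equality can be substituted.
  have key : ∀ (X' : C) (e : X' = X.obj),
      inc k (C := Semidirect ρ) (X := ⟨X'⟩) (Y := Y)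
        (Semidirect.homMk (⟨X'⟩ : Semidirect ρ) Y g (eqToHom (by rw [e]) ≫ f)) =
      inc k (C := Semidirect ρ) (X := X) (Y := Y) (Semidirect.homMk X Y g f) := by
    rintro _ rfl
    simp
  exact key _ (ρ.obj_inv_mul g X.obj)

/-- The composition law of `C ⋊ G`, valid on all of `Tot`: two labelled morphisms are composable in
`C ⋊ G` exactly when `a` and `g b` are composable in `C`, and otherwise both sides vanish. -/
theorem mul_lab (g h : G) (a b : Tot C) :
    mul k (lab ρ g a) (lab ρ h b) = lab ρ (g * h) (mul k a (mapTot k (ρ.F g) b)) := by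
  induction a using tot_induction k (C := C) with
  | h0 => simp
  | hadd _ _ h h' => simp [h, h']
  | hmk Z Y p a ha =>
    obtain ⟨f, -, rfl⟩ := ha
    induction b using tot_induction k (C := C) with
    | h0 => simp
    | hadd _ _ h h' => simp [h, h']
    | hmk Z' Y' p' b hb =>
      obtain ⟨f', -, rfl⟩ := hb
      by_cases e : (ρ.F g).obj Y' = Z
      · subst e
        -- Since h is bijective on objects, every source may be written as h X'.
        obtain ⟨X', rfl⟩ : ∃ X', (ρ.F h).obj X' = Z' := ⟨_, ρ.obj_mul_inv h Z'⟩
        rw [lab_inc (ρ := ρ) g (X := ⟨Y'⟩) (Y := ⟨Y⟩) f,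
          lab_inc (ρ := ρ) h (X := ⟨X'⟩) (Y := ⟨Y'⟩) f', mul_inc, mapTot_inc, mul_inc,
          ← inc_eqToHom_comp k (ρ.obj_mul g h X'),
          lab_inc (ρ := ρ) (g * h) (X := ⟨X'⟩) (Y := ⟨Y⟩)]
        exact congrArg _ (Semidirect.compHom_mk g h _ _)
      · rw [lab_inc', lab_inc', mapTot_inc, mul_inc_inc, mul_inc_inc, dif_neg e, map_zero,
          dif_neg]
        intro e'
        refine e ?_
        have := congrArg Semidirect.obj e'
        dsimp only at this
        rw [this, ρ.obj_mul_inv]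

theorem dTot_lab (g : G) (a : Tot C) : dTot k (lab ρ g a) = lab ρ g (dTot k a) := by
  induction a using tot_induction k (C := C) with
  | h0 => simp
  | hadd _ _ h h' => simp [h, h']
  | hmk Z Y p a ha =>
    obtain ⟨f, -, rfl⟩ := ha
    rw [lab_inc', dTot_inc, dTot_inc, lab_inc']
    refine congrArg _ ((Semidirect.homD_mk _ _).trans ?_)
    rw [d_eqToHom_comp]

theorem IsArrow.lab (g : G) {Z Y : C} {p : ℤ} {a : Tot C} (ha : IsArrow k Z Y p a) :
    IsArrow k (⟨(ρ.F g⁻¹).obj Z⟩ : Semidirect ρ) ⟨Y⟩ p (DGHochschild.lab ρ g a) := by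
  obtain ⟨f, hf, rfl⟩ := ha
  exact ⟨_, Semidirect.homMk_mem g (eqToHom_comp_mem k _ hf), lab_inc' ρ g f⟩

theorem scale_lab (c : ℤ → k) (g : G) (a : Tot C) :
    scale k c (lab ρ g a) = lab ρ g (scale k c a) := by
  induction a using tot_induction k (C := C) with
  | h0 => simp
  | hadd _ _ h h' => simp [h, h']
  | hmk Z Y p a ha => rw [ha.scale, (ha.lab g).scale, map_smul]

theorem inc_eqToHom {X Y : C} (h : X = Y) : inc k (eqToHom h) = inc k (𝟙 Y) := by
  subst h; rfl

theorem shiftTot_eq_lab (g : G) (X : Semidirect ρ) :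
    shiftTot k g X = lab ρ g (inc k (𝟙 ((ρ.F g).obj X.obj))) :=
  (lab_inc g (X := X) (Y := ⟨(ρ.F g).obj X.obj⟩) _).symm

theorem unshiftTot_eq_lab (g : G) (X : Semidirect ρ) :
    unshiftTot k g X = lab ρ g⁻¹ (inc k (𝟙 X.obj)) := by
  rw [← inc_eqToHom (ρ.obj_inv_mul g X.obj)]
  exact (lab_inc g⁻¹ (X := ⟨(ρ.F g).obj X.obj⟩) (Y := X) _).symm

theorem IsArrow.id_mul {X Y : C} {p : ℤ} {a : Tot C} (ha : IsArrow k X Y p a) :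
    DGHochschild.mul k (inc k (𝟙 Y)) a = a := by
  obtain ⟨f, -, rfl⟩ := ha
  rw [mul_inc, Category.comp_id]

/-- The effect of a gauge on one factor. The new label `g * s * g'⁻¹` is trivial precisely when `g'
= g * s`, which is the recursion of `partialProd`. -/
theorem shift_mul_lab_mul_unshift {g g' s : G} {X Y : Semidirect ρ} {p : ℤ} {a : Tot C}
    (ha : IsArrow k ((ρ.F s).obj X.obj) Y.obj p a) :
    mul k (shiftTot k g Y) (mul k (lab ρ s a) (unshiftTot k g' X)) =
      lab ρ (g * s * g'⁻¹) (mapTot k (ρ.F g) a) := by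
  rw [shiftTot_eq_lab, unshiftTot_eq_lab, mul_lab, mapTot_inc, CategoryTheory.Functor.map_id, ha.mul_id, mul_lab,
    (ha.map (ρ.F g)).id_mul, mul_assoc]

end Lab

/-! ### The maps ξ_g and the components of ν on tensor powers -/

section TensorFormulas

variable {k : Type w₀} [Field k] {C : Type u} [Category.{v} C] [Preadditive C] [Linear k C]
  [DGCategory k C] {G : Type v} [Group G] (ρ : StrongAction k G C)

/-- The string `(g⁻¹ w₀, g⁻¹), (w₁, 1), (w₂, 1), …` of morphisms of `C ⋊ G`. -/
noncomputable def xiStr (g : G) (w : ℕ → Tot C) (l : ℕ) : Tot (Semidirect ρ) :=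
  if l = 0 then lab ρ g⁻¹ (mapTot k (ρ.F g⁻¹) (w 0)) else lab ρ 1 (w l)

/-- The map `ξ_g` on a tensor power. -/
noncomputable def xiPow (g : G) (n : ℕ) : TPow k C n →ₗ[k] TPow k (Semidirect ρ) n :=
  PiTensorProduct.map fun i : Fin (n + 1) =>
    if (i : ℕ) = 0 then lab ρ g⁻¹ ∘ₗ mapTot k (ρ.F g⁻¹) else lab ρ 1

/-- The map `ξ_g` on the sum of the tensor powers. -/
noncomputable def xiT (g : G) : TSum k C →ₗ[k] TSum k (Semidirect ρ) :=
  liftT k fun n => single k n ∘ₗ xiPow ρ g n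

variable {ρ}

theorem xiPow_tp (g : G) {n : ℕ} (v : Fin (n + 1) → Tot C) :
    xiPow ρ g n (tp k v) = tp k fun i : Fin (n + 1) =>
      if (i : ℕ) = 0 then lab ρ g⁻¹ (mapTot k (ρ.F g⁻¹) (v i)) else lab ρ 1 (v i) := by
  rw [xiPow, PiTensorProduct.map_tprod]
  congr 1
  funext i
  split_ifs <;> rfl

theorem xiPow_tn (g : G) (n : ℕ) (w : ℕ → Tot C) :
    xiPow ρ g n (tn k n w) = tn k n (xiStr ρ g w) := by
  rw [tn, tn, xiPow_tp]
  congr 1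
  funext i
  simp only [xiStr]
  split_ifs with h
  · rw [h]
  · rfl

theorem xiT_single (g : G) (n : ℕ) (t : TPow k C n) :
    xiT ρ g (single k n t) = single k n (xiPow ρ g n t) := by
  rw [xiT, liftT_single, LinearMap.comp_apply]

variable {g : G} {n : ℕ} {x : ℕ → C} {p : ℕ → ℤ} {w : ℕ → Tot C}

/-- The twisted closing condition x₀ = g xₙ₊₁ becomes an honest one after replacing x₀ by g⁻¹ x₀ =
xₙ₊₁. -/
theorem IsStrN.xiStr (h : IsStrN k (ρ.F g) n x p w) :
    IsStrN k (𝟭 (Semidirect ρ)) n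
      (fun l => ⟨if l = 0 then (ρ.F g⁻¹).obj (x 0) else x l⟩) p (xiStr ρ g w) where
  closed := by
    simp only [if_true, Nat.succ_ne_zero, if_false, Functor.id_obj]
    rw [h.closed, ρ.obj_inv_mul]
  arrow l hl := by
    simp only [DGHochschild.xiStr, Nat.succ_ne_zero, if_false]
    split_ifs with h0
    · subst h0
      have := ((h.arrow 0 hl).map (ρ.F g⁻¹)).lab (ρ := ρ) g⁻¹
      rwa [inv_inv, ρ.obj_mul_inv] at this
    · have := (h.arrow l hl).lab (ρ := ρ) 1
      rwa [inv_one, ρ.obj_one] at this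

theorem xiPow_intD (g : G) (n : ℕ) (w : ℕ → Tot C) :
    intD k (Semidirect ρ) n (xiPow ρ g n (tn k n w)) = xiPow ρ g n (intD k C n (tn k n w)) := by
  rw [xiPow_tn, intD_tn, intD_tn, map_sum]
  refine Finset.sum_congr rfl fun i _ => ?_
  rw [xiPow_tn]
  congr 1
  funext l
  simp only [xiStr, dOpN]
  split_ifs <;> simp only [scale_lab, mapTot_scale, dTot_lab, mapTot_dTot, LinearMap.id_apply] <;>
    omega

/-- Factors with label 1 multiply as in `C`. At place 0 the label g⁻¹ acts on the next factor,
giving g⁻¹(w₀) g⁻¹(w₁) = g⁻¹(w₀ w₁). -/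
theorem mergeN_xiStr (h : IsStrN k (ρ.F g) (n + 1) x p w) {i : ℕ} (hi : i ≤ n) :
    mergeN (cmp k) i (xiStr ρ g w) = xiStr ρ g (mergeN (cmp k) i w) := by
  funext l
  simp only [mergeN, xiStr, cmp]
  split_ifs <;> first | rfl | (exfalso; omega) | skip
  · subst l; subst i
    rw [mul_lab, mul_one, (h.arrow 0 (by omega)).map_mul _ (h.arrow 1 (by omega))]
  · rw [mul_lab, mul_one, mapTot_one]

/-- The untwisted cyclic face in `C ⋊ G` matches the face twisted by g because (w, 1)(g⁻¹(w₀), g⁻¹)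
= (g⁻¹(g(w) w₀), g⁻¹). -/
theorem mergeN_rotN_xiStr (h : IsStrN k (ρ.F g) (n + 1) x p w) :
    mergeN (cmp k) 0 (rotN (mapTot k (𝟭 (Semidirect ρ))) (n + 1) (xiStr ρ g w)) =
      xiStr ρ g (mergeN (cmp k) 0 (rotN (mapTot k (ρ.F g)) (n + 1) w)) := by
  funext l
  by_cases h0 : l = 0
  · subst h0
    have h1 := (h.arrow (n + 1) le_rfl).map (ρ.F g)
    rw [← h.closed] at *
    have h2 := h.arrow 0 (Nat.zero_le _)
    simp only [mergeN, rotN, xiStr, cmp, lt_irrefl, if_false, if_true, zero_add, one_ne_zero,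
      Nat.sub_self, Nat.succ_ne_zero, mapTot_id]
    rw [mul_lab, one_mul, mapTot_one, h1.map_mul _ h2, mapTot_mapTot, inv_mul_cancel, mapTot_one]
  · simp [mergeN, rotN, xiStr, h0]

theorem xiPow_barD (h : IsStrN k (ρ.F g) (n + 1) x p w) :
    barD k (𝟭 (Semidirect ρ)) n (xiPow ρ g (n + 1) (tn k (n + 1) w)) =
      xiPow ρ g n (barD k (ρ.F g) n (tn k (n + 1) w)) := by
  rw [xiPow_tn, barD_eq_faceN, barD_eq_faceN, map_sum]
  refine Finset.sum_congr rfl fun i hi => ?_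
  rw [map_smul]
  congr 1
  rcases (Nat.lt_succ_iff.1 (Finset.mem_range.1 hi)).lt_or_eq with hi | rfl
  · rw [faceN_tn k _ (by omega), faceN_tn k _ (by omega), xiPow_tn,
      mergeN_xiStr h (by omega)]
  · rw [faceN_tn_last h, faceN_tn_last h.xiStr, map_smul, xiPow_tn, mergeN_rotN_xiStr h]

theorem xiT_totD {q : ℤ} {t : TSum k C} (ht : t ∈ piece k (ρ.F g) q) :
    totD k (𝟭 (Semidirect ρ)) (xiT ρ g t) = xiT ρ g (totD k (ρ.F g) t) := by
  refine piece_inductionN (P := fun t => totD k (𝟭 (Semidirect ρ)) (xiT ρ g t) =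
    xiT ρ g (totD k (ρ.F g) t)) ht (by simp) (fun s t hs ht => by simp only [map_add, hs, ht])
    (fun a t ht => by simp only [map_smul, ht]) ?_
  intro n x p w h hq
  rw [xiT_single, totD, totD, liftT_single, liftT_single]
  cases n with
  | zero =>
    simp only [colD, LinearMap.comp_apply]
    rw [xiT_single, xiPow_intD]
  | succ n =>
    simp only [colD, LinearMap.add_apply, LinearMap.smul_apply, LinearMap.comp_apply, map_add,
      map_smul]
    rw [xiT_single, xiT_single, xiPow_intD, xiPow_barD h]

theorem xiT_mem {q : ℤ} {t : TSum k C} (ht : t ∈ piece k (ρ.F g) q) :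
    xiT ρ g t ∈ piece k (𝟭 (Semidirect ρ)) q := by
  refine piece_inductionN (P := fun t => xiT ρ g t ∈ piece k (𝟭 (Semidirect ρ)) q) ht
    (by rw [map_zero]; exact zero_mem _) (fun s t hs ht => by rw [map_add]; exact add_mem hs ht)
    (fun a t ht => by rw [map_smul]; exact Submodule.smul_mem _ _ ht) ?_
  intro n x p w h hq
  rw [xiT_single, xiPow_tn]
  exact h.xiStr.mem_piece hq

variable (ρ) in
/-- The component at `g` of `ν` on a tensor power. -/
noncomputable def nuPow (g : G) (n : ℕ) : TPow k (Semidirect ρ) n →ₗ[k] TPow k C n :=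
  labLift fun κ => if (tailProd (fun i => (κ i).2.2) 0)⁻¹ = g then
    (PiTensorProduct.tprod k).compLinearMap fun i =>
      mapTot k (ρ.F (tailProd (fun i => (κ i).2.2) i.castSucc)⁻¹) ∘ₗ inc k
    else 0

variable (ρ) in
/-- The component at `g` of `ν` on the sum of the tensor powers. -/
noncomputable def nuT (g : G) : TSum k (Semidirect ρ) →ₗ[k] TSum k C :=
  liftT k fun n => single k n ∘ₗ nuPow ρ g n

/-- Each factor has to be a single morphism, so that the tensor lies in one labelled summand, where
`labLift` can be evaluated. -/
theorem nuPow_lab (g : G) {n : ℕ} (σ : Fin (n + 1) → G) (a : Fin (n + 1) → Tot C)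
    (ha : ∀ i, ∃ (X Y : C) (f : X ⟶ Y), a i = inc k f) :
    nuPow ρ g n (tp k fun i => lab ρ (σ i) (a i)) =
      if (tailProd σ 0)⁻¹ = g then
        tp k fun i => mapTot k (ρ.F (tailProd σ i.castSucc)⁻¹) (a i) else 0 := by
  choose X Y f hf using ha
  obtain rfl : a = fun i => inc k (f i) := funext hf
  have e : (fun i => lab ρ (σ i) (inc k (f i))) = fun i =>
      labInc (⟨(ρ.F (σ i)⁻¹).obj (X i)⟩, ⟨Y i⟩, σ i) (eqToHom (ρ.obj_mul_inv (σ i) (X i)) ≫ f i) :=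
    funext fun i => lab_inc' ρ (σ i) (f i)
  rw [e, nuPow]
  refine (labLift_tp _ (fun i => (⟨(ρ.F (σ i)⁻¹).obj (X i)⟩, ⟨Y i⟩, σ i)) _).trans ?_
  dsimp only
  split_ifs with h
  · rw [MultilinearMap.compLinearMap_apply]
    simp only [LinearMap.comp_apply, inc_eqToHom_comp]
  · rfl

theorem nuT_single (g : G) (n : ℕ) (t : TPow k (Semidirect ρ) n) :
    nuT ρ g (single k n t) = single k n (nuPow ρ g n t) := by
  rw [nuT, liftT_single, LinearMap.comp_apply]

theorem tailProd_eq_one {n : ℕ} {σ : Fin (n + 1) → G} (hσ : ∀ i, i ≠ 0 → σ i = 1)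
    (i : Fin (n + 2)) : i ≠ 0 → tailProd σ i = 1 := by
  induction i using Fin.reverseInduction with
  | last => exact fun _ => tailProd_last σ
  | cast i ih =>
    intro h0
    rw [tailProd_castSucc, ih (Fin.succ_ne_zero i), mul_one]
    exact hσ i fun h => h0 (by rw [h]; rfl)

/-- The labels are (g⁻¹, 1, …, 1), so the tail products are 1 beyond place 0 and g⁻¹ at place 0.
Hence only the component g is nonzero, and there the factor g⁻¹(w₀) is carried back to w₀. -/
theorem nuPow_xiPow (h : IsStrN k (ρ.F g) n x p w) (g' : G) :
    nuPow ρ g' n (xiPow ρ g n (tn k n w)) = if g = g' then tn k n w else 0 := by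
  rw [xiPow_tn]
  have e : tn k n (xiStr ρ g w) = tp k fun i : Fin (n + 1) =>
      lab ρ (if (i : ℕ) = 0 then g⁻¹ else 1)
        (if (i : ℕ) = 0 then mapTot k (ρ.F g⁻¹) (w i) else w i) := by
    rw [tn]
    congr 1
    funext i
    simp only [xiStr]
    split_ifs with h0
    · rw [h0]
    · rfl
  have hσ : ∀ i : Fin (n + 1), i ≠ 0 → (if (i : ℕ) = 0 then g⁻¹ else 1) = (1 : G) :=
    fun i hi => if_neg fun h0 => hi (Fin.ext h0)
  have h1 := tailProd_eq_one hσ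
  have h0 : tailProd (fun i : Fin (n + 1) => if (i : ℕ) = 0 then g⁻¹ else 1) 0 = g⁻¹ := by
    rw [← Fin.castSucc_zero, tailProd_castSucc, h1 _ (Fin.succ_ne_zero _)]
    simp
  rw [e, nuPow_lab, h0, inv_inv]
  · refine if_congr Iff.rfl ?_ rfl
    rw [tn]
    congr 1
    funext i
    by_cases hi : i = 0
    · subst hi
      simp only [Fin.val_zero, if_true, Fin.castSucc_zero, h0, inv_inv, mapTot_mapTot,
        mul_inv_cancel, mapTot_one]
    · rw [h1 _ (by simpa using hi), if_neg fun h0 : (i : ℕ) = 0 => hi (Fin.ext h0), inv_one,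
        mapTot_one]
  · intro i
    obtain ⟨f, -, hf⟩ := h.arrow i (Nat.lt_succ_iff.1 i.2)
    split_ifs
    · exact ⟨_, _, _, by rw [hf, mapTot_inc]⟩
    · exact ⟨_, _, f, hf⟩

theorem nuT_xiT (g' : G) {q : ℤ} {t : TSum k C} (ht : t ∈ piece k (ρ.F g) q) :
    nuT ρ g' (xiT ρ g t) = if g = g' then t else 0 := by
  refine piece_inductionN (P := fun t => nuT ρ g' (xiT ρ g t) = if g = g' then t else 0) ht
    (by simp) (fun s t hs ht => by rw [map_add, map_add, hs, ht]; split_ifs <;> simp)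
    (fun a t ht => by rw [map_smul, map_smul, ht]; split_ifs <;> simp) ?_
  intro n x p w h _
  rw [xiT_single, nuT_single, nuPow_xiPow h]
  split_ifs <;> simp

theorem CrossedChain.toChain_tens {n : ℕ} {q : ℤ} (c : CrossedChain ρ n q) :
    c.toChain.tens = single k n (tp k fun i => lab ρ (c.σ i) (inc k (c.α i))) := by
  rw [BasicChain.tens]
  congr 2
  funext i
  exact (lab_inc (c.σ i) (X := ⟨c.x i.succ⟩) (Y := ⟨c.x i.castSucc⟩) (c.α i)).symm

theorem CrossedChain.nu_tens {n : ℕ} {q : ℤ} (c : CrossedChain ρ n q) :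
    c.nu.tens = single k n (tp k fun i =>
      mapTot k (ρ.F (tailProd c.σ i.castSucc)⁻¹) (inc k (c.α i))) := by
  rw [BasicChain.tens]
  congr 2
  funext i
  rw [mapTot_inc]
  exact inc_eqToHom_comp k _ _

theorem nuT_toChain (g : G) {n : ℕ} {q : ℤ} (c : CrossedChain ρ n q) :
    nuT ρ g c.toChain.tens = if (tailProd c.σ 0)⁻¹ = g then c.nu.tens else 0 := by
  rw [c.toChain_tens, nuT_single, nuPow_lab _ _ _ fun i => ⟨_, _, c.α i, rfl⟩, c.nu_tens]
  split_ifs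
  · rfl
  · exact map_zero _

end TensorFormulas

/-! ### The complex of the semidirect product is spanned by labelled chains -/

section Span

variable {k : Type w₀} [Field k] {C : Type u} [Category.{v} C] [Preadditive C] [Linear k C]
  [DGCategory k C] {G : Type v} [Group G] {ρ : StrongAction k G C}

theorem ofNat_val_succ {n : ℕ} (i : Fin (n + 1)) : Fin.ofNat (n + 2) ((i : ℕ) + 1) = i.succ :=
  Fin.ext (Nat.mod_eq_of_lt (by omega))

theorem ofNat_val_castSucc {n : ℕ} (i : Fin (n + 1)) : Fin.ofNat (n + 2) (i : ℕ) = i.castSucc :=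
  Fin.ext (Nat.mod_eq_of_lt (by omega))

theorem ofNat_last (n : ℕ) : Fin.ofNat (n + 2) (n + 1) = Fin.last (n + 1) :=
  Fin.ext (Nat.mod_eq_of_lt (by omega))

theorem CrossedChain.isCross {n : ℕ} {q : ℤ} (c : CrossedChain ρ n q) :
    IsCross n (fun l => ⟨c.x (Fin.ofNat (n + 2) l)⟩) (fun l => c.σ (Fin.ofNat (n + 1) l))
      (fun l => c.p (Fin.ofNat (n + 1) l))
      (fun l => lab ρ (c.σ (Fin.ofNat (n + 1) l)) (inc k (c.α (Fin.ofNat (n + 1) l)))) where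
  closed := by
    rw [ofNat_last]
    exact congrArg _ c.closed
  arrow i hi := by
    obtain ⟨i, rfl⟩ : ∃ i' : Fin (n + 1), (i' : ℕ) = i := ⟨⟨i, by omega⟩, rfl⟩
    rw [ofNat_val_succ, ofNat_val_castSucc, Fin.ofNat_val_eq_self]
    exact ⟨c.α i, c.mem i, lab_inc _ (X := ⟨c.x i.succ⟩) (Y := ⟨c.x i.castSucc⟩) _⟩

theorem CrossedChain.toChain_tens_eq_tn {n : ℕ} {q : ℤ} (c : CrossedChain ρ n q) :
    c.toChain.tens = single k n (tn k n fun l =>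
      lab ρ (c.σ (Fin.ofNat (n + 1) l)) (inc k (c.α (Fin.ofNat (n + 1) l)))) := by
  rw [c.toChain_tens, tp_eq_tn]

variable [Fintype G]

/-- Expand every factor as the sum of its components over G and use multilinearity. The components
are homogeneous of the same degree, since homogeneity in `C ⋊ G` is tested on each label. -/
theorem BasicChain.tens_mem_span_crossed {n : ℕ} {q : ℤ}
    (c : BasicChain k (𝟭 (Semidirect ρ)) n q) :
    c.tens ∈ Submodule.span k {t | ∃ (n : ℕ) (c : CrossedChain ρ n q), t = c.toChain.tens} := by
  have e : ∀ i, inc k (c.α i) = ∑ g : G, inc k (C := Semidirect ρ) (X := c.x i.succ)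
      (Y := c.x i.castSucc) (Semidirect.homMk (c.x i.succ) (c.x i.castSucc) g
        (DirectSum.component k G (fun g => ((ρ.F g).obj (c.x i.succ).obj ⟶ (c.x i.castSucc).obj)) g (c.α i))) := by
    intro i
    rw [← map_sum]
    exact congrArg _ (DirectSum.sum_univ_of (c.α i)).symm
  rw [BasicChain.tens, tp, funext e, MultilinearMap.map_sum, map_sum]
  refine Submodule.sum_mem _ fun σ _ => Submodule.subset_span ⟨n, ?_⟩
  exact ⟨⟨fun i => (c.x i).obj, congrArg Semidirect.obj c.closed, σ, _, c.p,
    fun i => c.mem i (σ i), c.deg⟩, rfl⟩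

theorem crossed_induction {q : ℤ} {P : TSum k (Semidirect ρ) → Prop} {t : TSum k (Semidirect ρ)}
    (ht : t ∈ piece k (𝟭 (Semidirect ρ)) q) (h0 : P 0) (hadd : ∀ s t, P s → P t → P (s + t))
    (hsmul : ∀ (a : k) t, P t → P (a • t))
    (hc : ∀ (n : ℕ) (c : CrossedChain ρ n q), P c.toChain.tens) : P t := by
  have hle : piece k (𝟭 (Semidirect ρ)) q ≤
      Submodule.span k {t | ∃ (n : ℕ) (c : CrossedChain ρ n q), t = c.toChain.tens} := by
    rw [piece, Submodule.span_le]
    rintro _ ⟨n, c, rfl⟩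
    exact c.tens_mem_span_crossed
  refine Submodule.span_induction (p := fun t _ => P t) ?_ h0 (fun s t _ _ => hadd s t)
    (fun a t _ => hsmul a t) (hle ht)
  rintro _ ⟨n, c, rfl⟩
  exact hc n c

end Span

/-! ### The composite ξν as an average of gauge conjugates -/

section Composite

variable {k : Type w₀} [Field k] {C : Type u} [Category.{v} C] [Preadditive C] [Linear k C]
  [DGCategory k C] {G : Type v} [Group G] (ρ : StrongAction k G C)

theorem mapT_mapT (g h : G) (t : TSum k C) :
    mapT k (ρ.F g) (mapT k (ρ.F h) t) = mapT k (ρ.F (g * h)) t := by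
  suffices e : mapT k (ρ.F g) ∘ₗ mapT k (ρ.F h) = mapT k (ρ.F (g * h)) from LinearMap.congr_fun e t
  refine DirectSum.linearMap_ext k fun n =>
    PiTensorProduct.ext (MultilinearMap.ext fun v => ?_)
  change mapT k (ρ.F g) (mapT k (ρ.F h) (single k n (tp k v))) =
    mapT k (ρ.F (g * h)) (single k n (tp k v))
  simp only [mapT_tp, mapTot_mapTot]

variable [Fintype G]

/-- The average over `h` of the maps `ξ_{h g h⁻¹} h`. -/
noncomputable def xiAvg (g : G) : TSum k C →ₗ[k] TSum k (Semidirect ρ) :=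
  (Fintype.card G : k)⁻¹ • ∑ h : G, xiT ρ (h * g * h⁻¹) ∘ₗ mapT k (ρ.F h)

variable {ρ}

theorem xiAvg_apply (g : G) (t : TSum k C) : xiAvg ρ g t =
    (Fintype.card G : k)⁻¹ • ∑ h : G, xiT ρ (h * g * h⁻¹) (mapT k (ρ.F h) t) := by
  simp [xiAvg, LinearMap.sum_apply]

theorem xiAvg_mem {g : G} {q : ℤ} {t : TSum k C} (ht : t ∈ piece k (ρ.F g) q) :
    xiAvg ρ g t ∈ piece k (𝟭 (Semidirect ρ)) q := by
  rw [xiAvg_apply]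
  exact Submodule.smul_mem _ _ (Submodule.sum_mem _ fun h _ =>
    xiT_mem (mapT_mem k (ρ.F h) (ρ.conj_comm h g) ht))

theorem xiAvg_totD {g : G} {q : ℤ} {t : TSum k C} (ht : t ∈ piece k (ρ.F g) q) :
    totD k (𝟭 (Semidirect ρ)) (xiAvg ρ g t) = xiAvg ρ g (totD k (ρ.F g) t) := by
  rw [xiAvg_apply, xiAvg_apply, map_smul, map_sum]
  congr 1
  refine Finset.sum_congr rfl fun h _ => ?_
  rw [xiT_totD (mapT_mem k (ρ.F h) (ρ.conj_comm h g) ht),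
    mapT_totD k (ρ.F h) (ρ.conj_comm h g) ht]

/-- Acting by `h` first only translates the summation index. This invariance lets the average
descend to coinvariants. -/
theorem xiAvg_conj (h g : G) (t : TSum k C) :
    xiAvg ρ (h * g * h⁻¹) (mapT k (ρ.F h) t) = xiAvg ρ g t := by
  rw [xiAvg_apply, xiAvg_apply]
  congr 1
  rw [← Equiv.sum_comp (Equiv.mulRight h) fun h' =>
    xiT ρ (h' * g * h'⁻¹) (mapT k (ρ.F h') t)]
  refine Finset.sum_congr rfl fun h' _ => ?_
  rw [mapT_mapT, Equiv.coe_mulRight]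
  congr 2
  group

/-- Gauge and tail products are complementary parts of h σ₀⋯σₙ. This converts the inverse tail
products in ν into the gauge γᵢ = γₙ₊₁(σᵢ⋯σₙ)⁻¹. -/
theorem partialProd_mul_tailProd {n : ℕ} (h : G) (σ : Fin (n + 1) → G) (i : Fin (n + 2)) :
    partialProd h (fun l => σ (Fin.ofNat (n + 1) l)) i * tailProd σ i =
      partialProd h (fun l => σ (Fin.ofNat (n + 1) l)) (n + 1) := by
  induction i using Fin.reverseInduction with
  | last => rw [tailProd_last, mul_one]; rfl
  | cast i ih =>
    rw [← ih, tailProd_castSucc, ← mul_assoc, Fin.val_succ, partialProd, Fin.val_castSucc]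
    congr 2
    simp

/-- Only the component g = (σ₀⋯σₙ)⁻¹ of ν is nonzero. Symmetrising it by γₙ₊₁ turns (σᵢ⋯σₙ)⁻¹(αᵢ)
into γᵢ(αᵢ), which is the factor produced by conjugating with the gauge starting at `h`. -/
theorem sum_xiAvg_nuT {n : ℕ} {q : ℤ} (c : CrossedChain ρ n q) :
    ∑ g : G, xiAvg ρ g (nuT ρ g c.toChain.tens) = (Fintype.card G : k)⁻¹ • ∑ h : G, single k n
      (tn k n (fullConj k n
        (fun l => lab ρ (c.σ (Fin.ofNat (n + 1) l)) (inc k (c.α (Fin.ofNat (n + 1) l))))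
        (gaugeFwd k (partialProd h fun l => c.σ (Fin.ofNat (n + 1) l))
          fun l => ⟨c.x (Fin.ofNat (n + 2) l)⟩)
        (gaugeBwd k (partialProd h fun l => c.σ (Fin.ofNat (n + 1) l))
          fun l => ⟨c.x (Fin.ofNat (n + 2) l)⟩))) := by
  rw [Finset.sum_eq_single (tailProd c.σ 0)⁻¹ (fun g _ hg => by
    rw [nuT_toChain, if_neg hg.symm, map_zero]) (fun h => absurd (Finset.mem_univ _) h),
    nuT_toChain, if_pos rfl, xiAvg_apply, c.nu_tens]
  congr 1
  let σ : ℕ → G := fun l => c.σ (Fin.ofNat (n + 1) l)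
  -- The symmetrising element corresponds to the final value γₙ₊₁ of the gauge, not to its initial
  -- value.
  rw [← Equiv.sum_comp (Equiv.ofBijective _ (partialProd_bijective σ (n + 1)))]
  refine Finset.sum_congr rfl fun h _ => ?_
  rw [mapT_tp, xiT_single, xiPow_tp, tn]
  congr 2
  funext i
  have hγ := partialProd_mul_tailProd h c.σ i.castSucc
  have hγ' : partialProd h σ (n + 1) * (tailProd c.σ i.castSucc)⁻¹ = partialProd h σ i := by
    rw [mul_inv_eq_iff_eq_mul, ← hγ]; rfl
  have hs : partialProd h σ (i + 1) = partialProd h σ i * c.σ i := by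
    rw [partialProd]; congr 1; simp [σ]
  have ha : IsArrow k ((ρ.F (c.σ i)).obj (c.x i.succ)) (c.x i.castSucc) (c.p i) (inc k (c.α i)) :=
    ⟨c.α i, c.mem i, rfl⟩
  simp only [Equiv.ofBijective_apply, fullConj, gaugeFwd, gaugeBwd, mapTot_mapTot]
  by_cases h0 : i = 0
  · subst h0
    -- Closedness of the chain makes the last gauge isomorphism composable with factor 0.
    have hx : c.x (Fin.ofNat (n + 2) (n + 1)) = c.x (Fin.castSucc 0) := by
      rw [ofNat_last]; exact c.closed.symm
    have h1 : Fin.ofNat (n + 2) 1 = Fin.succ (0 : Fin (n + 1)) := ofNat_val_succ 0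
    have h2 : Fin.ofNat (n + 1) 0 = (0 : Fin (n + 1)) := rfl
    rw [if_pos (show ((0 : Fin (n + 1)) : ℕ) = 0 from rfl),
      if_pos (show ((0 : Fin (n + 1)) : ℕ) = 0 from rfl), hx, h1, h2,
      shift_mul_lab_mul_unshift (X := ⟨c.x (Fin.succ 0)⟩) (Y := ⟨c.x (Fin.castSucc 0)⟩) ha]
    change _ = lab ρ (partialProd h σ (n + 1) * c.σ 0 * (partialProd h σ 1)⁻¹)
      (mapTot k (ρ.F (partialProd h σ (n + 1))) (inc k (c.α 0)))
    have hs' : partialProd h σ 1 = partialProd h σ (n + 1) * (tailProd c.σ 0)⁻¹ * c.σ 0 := by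
      rw [← Fin.castSucc_zero, hγ']; exact hs
    have ht : tailProd c.σ (Fin.castSucc 0) = tailProd c.σ 0 := rfl
    -- With a = γₙ₊₁ and b = σ₀⋯σₙ, these compare the label and the group element acting on α₀ in
    -- the two descriptions of factor 0.
    have e1 : ∀ a b s : G, a * s * (a * b⁻¹ * s)⁻¹ = (a * b⁻¹ * a⁻¹)⁻¹ := fun a b s => by group
    have e2 : ∀ a b : G, (a * b⁻¹ * a⁻¹)⁻¹ * (a * b⁻¹) = a := fun a b => by group
    rw [ht, hs', e1, e2]
  · have h0' : (i : ℕ) ≠ 0 := fun h => h0 (Fin.ext h)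
    rw [if_neg h0', if_neg h0', ofNat_val_succ, ofNat_val_castSucc, Fin.ofNat_val_eq_self,
      shift_mul_lab_mul_unshift (X := ⟨c.x i.succ⟩) (Y := ⟨c.x i.castSucc⟩) ha]
    change _ = lab ρ (partialProd h σ i * c.σ i * (partialProd h σ (i + 1))⁻¹)
      (mapTot k (ρ.F (partialProd h σ i)) (inc k (c.α i)))
    rw [hs, hγ', mul_inv_cancel]

end Composite

/-! ### The universal property of the complex of coinvariants -/

section CoinvariantComplex

universe t

variable {k : Type w₀} [Field k] {G : Type v} [Group G]
variable (K : G → CochainComplex (ModuleCat.{max v t} k) ℤ) (a : ∀ h g : G, K g ⟶ K (h * g * h⁻¹))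

/-- The class in the coinvariants of an element of `K g` in degree `q`. -/
noncomputable def coinvClass (g : G) (q : ℤ) :
    (K g).X q →ₗ[k] (coinvComplex.{w₀, v, max v t} K a).X q :=
  ((coinvIncl K a g).f q).hom

theorem coinvClass_conj (h g : G) (q : ℤ) (x : (K g).X q) :
    coinvClass K a (h * g * h⁻¹) q (((a h g).f q).hom x) = coinvClass K a g q x :=
  coinvMk_conj (fun g => (K g).X q) (fun h g => ((a h g).f q).hom) h g x

variable {K a}

theorem coinvClass_ext {q : ℤ} {P : Type*} [AddCommGroup P] [Module k P]
    {φ ψ : (coinvComplex.{w₀, v, max v t} K a).X q →ₗ[k] P}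
    (h : ∀ g, φ ∘ₗ coinvClass K a g q = ψ ∘ₗ coinvClass K a g q) : φ = ψ :=
  coinv_ext (k := k) (M := fun g => (K g).X q) (a := fun h g => ((a h g).f q).hom)
    fun g x => LinearMap.congr_fun (h g) x

theorem coinvComplex_hom_ext {L : CochainComplex (ModuleCat.{max v t} k) ℤ}
    {φ ψ : coinvComplex.{w₀, v, max v t} K a ⟶ L}
    (h : ∀ g, coinvIncl K a g ≫ φ = coinvIncl K a g ≫ ψ) : φ = ψ := by
  refine HomologicalComplex.hom_ext _ _ fun q => ModuleCat.hom_ext (coinvClass_ext fun g => ?_)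
  exact congrArg (fun f => (f.f q).hom) (h g)

/-- The linear map on coinvariants in degree `q` defined by compatible morphisms. -/
noncomputable def coinvDescLin {L : CochainComplex (ModuleCat.{max v t} k) ℤ} (φ : ∀ g, K g ⟶ L)
    (hφ : ∀ h g, a h g ≫ φ (h * g * h⁻¹) = φ g) (q : ℤ) :
    (coinvComplex.{w₀, v, max v t} K a).X q →ₗ[k] L.X q :=
  coinvLift (k := k) (M := fun g => (K g).X q) (a := fun h g => ((a h g).f q).hom)
    (fun g => ((φ g).f q).hom) fun h g x => congrArg (fun f => (f.f q).hom x) (hφ h g)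

theorem coinvDescLin_class {L : CochainComplex (ModuleCat.{max v t} k) ℤ} (φ : ∀ g, K g ⟶ L)
    (hφ : ∀ h g, a h g ≫ φ (h * g * h⁻¹) = φ g) (q : ℤ) (g : G) (x : (K g).X q) :
    coinvDescLin φ hφ q (coinvClass K a g q x) = ((φ g).f q).hom x :=
  coinvLift_mk (k := k) (M := fun g => (K g).X q) (a := fun h g => ((a h g).f q).hom)
    (fun g => ((φ g).f q).hom) (fun h g x => congrArg (fun f => (f.f q).hom x) (hφ h g)) g x

/-- The morphism of complexes on coinvariants defined by compatible morphisms. -/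
noncomputable def coinvDesc {L : CochainComplex (ModuleCat.{max v t} k) ℤ} (φ : ∀ g, K g ⟶ L)
    (hφ : ∀ h g, a h g ≫ φ (h * g * h⁻¹) = φ g) : coinvComplex.{w₀, v, max v t} K a ⟶ L where
  f q := ModuleCat.ofHom (coinvDescLin φ hφ q)
  comm' q r _ := by
    refine ModuleCat.hom_ext (coinvClass_ext fun g => LinearMap.ext fun x => ?_)
    have e1 : ((coinvComplex.{w₀, v, max v t} K a).d q r).hom (coinvClass K a g q x) =
        coinvClass K a g r (((K g).d q r).hom x) :=
      congrArg (fun f => f.hom x) ((coinvIncl K a g).comm q r)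
    have e2 : (L.d q r).hom (((φ g).f q).hom x) = ((φ g).f r).hom (((K g).d q r).hom x) :=
      congrArg (fun f => f.hom x) ((φ g).comm q r)
    change (L.d q r).hom (coinvDescLin φ hφ q (coinvClass K a g q x)) =
      coinvDescLin φ hφ r (((coinvComplex.{w₀, v, max v t} K a).d q r).hom (coinvClass K a g q x))
    rw [e1, coinvDescLin_class, coinvDescLin_class, e2]

theorem coinvIncl_desc {L : CochainComplex (ModuleCat.{max v t} k) ℤ} (φ : ∀ g, K g ⟶ L)
    (hφ : ∀ h g, a h g ≫ φ (h * g * h⁻¹) = φ g) (g : G) :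
    coinvIncl K a g ≫ coinvDesc φ hφ = φ g :=
  HomologicalComplex.hom_ext _ _ fun q => ModuleCat.hom_ext (LinearMap.ext fun x =>
    coinvDescLin_class φ hφ q g x)

end CoinvariantComplex

/-! ### Construction of ξ and ν, and the two composites in each degree -/

section Morphisms

variable {k : Type w₀} [Field k] {C : Type u} [Category.{v} C] [Preadditive C] [Linear k C]
  [DGCategory k C]

theorem hoch_d_apply (F : C ⥤ C) [IsDGFunctor k F] {q r : ℤ} (h : q + 1 = r) (t : piece k F q) :
    (show piece k F r from ((Hoch k F).d q r).hom t).1 = totD k F t.1 := by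
  subst h
  simp only [Hoch, dif_pos]
  rfl

theorem piece_linearMap_ext {F : C ⥤ C} {q : ℤ} {P : Type*} [AddCommGroup P] [Module k P]
    {φ ψ : piece k F q →ₗ[k] P}
    (h : ∀ (n : ℕ) (c : BasicChain k F n q), φ c.cls = ψ c.cls) : φ = ψ := by
  refine LinearMap.ext fun x => ?_
  obtain ⟨x, hx⟩ := x
  refine Submodule.span_induction (p := fun x hx => φ ⟨x, hx⟩ = ψ ⟨x, hx⟩) ?_ ?_ ?_ ?_ hx
  · rintro _ ⟨n, c, rfl⟩
    exact h n c
  · exact (map_zero φ).trans (map_zero ψ).symm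
  · intro x y hx hy ex ey
    have e : (⟨x + y, add_mem hx hy⟩ : piece k F q) = ⟨x, hx⟩ + ⟨y, hy⟩ := rfl
    rw [e, map_add, map_add, ex, ey]
  · intro c x hx ex
    have e : (⟨c • x, Submodule.smul_mem _ c hx⟩ : piece k F q) = c • ⟨x, hx⟩ := rfl
    rw [e, map_smul, map_smul, ex]

variable {G : Type v} [Group G] (ρ : StrongAction k G C)

/-- The class in `(⨁ g, C_•(C; g))_G` of an element of `C_•(C; g)`. -/
noncomputable def twistedClass (g : G) (q : ℤ) :
    piece k (ρ.F g) q →ₗ[k] (twistedHoch ρ).X q :=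
  coinvClass.{w₀, v, max w₀ u} (fun g => Hoch k (ρ.F g)) (hochAct ρ) g q

theorem twistedClass_conj (h g : G) (q : ℤ) (x : piece k (ρ.F g) q) :
    twistedClass ρ (h * g * h⁻¹) q ⟨mapT k (ρ.F h) x.1, mapT_mem k _ (ρ.conj_comm h g) x.2⟩ =
      twistedClass ρ g q x :=
  coinvClass_conj.{w₀, v, max w₀ u} (fun g => Hoch k (ρ.F g)) (hochAct ρ) h g q x

variable {ρ} in
theorem twistedClass_ext {q : ℤ} {P : Type*} [AddCommGroup P] [Module k P]
    {φ ψ : (twistedHoch ρ).X q →ₗ[k] P}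
    (h : ∀ g, φ ∘ₗ twistedClass ρ g q = ψ ∘ₗ twistedClass ρ g q) : φ = ψ :=
  coinvClass_ext.{w₀, v, max w₀ u} (K := fun g => Hoch k (ρ.F g)) (a := hochAct ρ) h

/-- In factor 0 the composite (id, g⁻¹) ∘ (α₀, 1) is the single labelled morphism (g⁻¹(α₀), g⁻¹)
used by `xiStr`. -/
theorem xiT_tens {g : G} {n : ℕ} {q : ℤ} (c : BasicChain k (ρ.F g) n q) :
    xiT ρ g c.tens = c.xi.tens := by
  rw [BasicChain.tens, BasicChain.tens, xiT_single, xiPow_tp]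
  congr 2
  funext i
  refine Fin.cases ?_ (fun i => ?_) i
  · rw [if_pos (show ((0 : Fin (n + 1)) : ℕ) = 0 from rfl)]
    have h : IsArrow k (c.x (Fin.succ 0)) (c.x (Fin.castSucc 0)) (c.p 0) (inc k (c.α 0)) :=
      ⟨_, c.mem 0, rfl⟩
    have e : lab ρ 1 (inc k (c.α 0)) = inc k (Semidirect.ofHom ρ (c.α 0)) := by
      rw [← inc_eqToHom_comp k (ρ.obj_one (c.x (Fin.succ 0)))]
      exact lab_inc 1 (X := ⟨c.x (Fin.succ 0)⟩) (Y := ⟨c.x (Fin.castSucc 0)⟩) _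
    have e' := mul_inc k (Semidirect.shift ρ g⁻¹ (c.x 0)) (Semidirect.ofHom ρ (c.α 0))
    refine Eq.trans ?_ ((congrArg (mul k (shiftTot k g⁻¹ ⟨c.x (Fin.castSucc 0)⟩)) e).trans e')
    rw [shiftTot_eq_lab, mul_lab, mul_one, (h.map (ρ.F g⁻¹)).id_mul]
  · rw [if_neg (by simp)]
    rw [← inc_eqToHom_comp k (ρ.obj_one (c.x i.succ.succ))]
    exact lab_inc 1 (X := ⟨c.x i.succ.succ⟩) (Y := ⟨c.x i.succ.castSucc⟩) _

theorem mapT_tens {g : G} {n : ℕ} {q : ℤ} (c : BasicChain k (ρ.F g) n q) (h : G) :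
    mapT k (ρ.F h) c.tens = (c.act h).tens := by
  rw [BasicChain.tens, BasicChain.tens, mapT_tp]
  simp only [mapTot_inc]
  rfl

variable [Fintype G]

/-- The morphism `|G|⁻¹ ∑ h, ξ_{h g h⁻¹} h` of complexes. -/
noncomputable def xiHom (g : G) : Hoch k (ρ.F g) ⟶ Hoch k (𝟭 (Semidirect ρ)) where
  f q := ModuleCat.ofHom ((xiAvg ρ g).restrict fun _ ht => xiAvg_mem ht)
  comm' q r h := by
    obtain rfl : q + 1 = r := h
    simp only [Hoch, dif_pos]
    rw [← ModuleCat.ofHom_comp, ← ModuleCat.ofHom_comp]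
    refine congrArg ModuleCat.ofHom (LinearMap.ext fun t => Subtype.ext ?_)
    exact xiAvg_totD t.2

theorem hochAct_xiHom (h g : G) : hochAct ρ h g ≫ xiHom ρ (h * g * h⁻¹) = xiHom ρ g := by
  refine HomologicalComplex.hom_ext _ _ fun q => ModuleCat.hom_ext (LinearMap.ext fun t =>
    Subtype.ext ?_)
  exact xiAvg_conj h g _

/-- The morphism `ξ`. -/
noncomputable def xi : twistedHoch ρ ⟶ Hoch k (𝟭 (Semidirect ρ)) :=
  coinvDesc.{w₀, v, max w₀ u} (K := fun g => Hoch k (ρ.F g)) (a := hochAct ρ) (xiHom ρ)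
    (hochAct_xiHom ρ)

theorem xi_twistedClass (g : G) (q : ℤ) (t : piece k (ρ.F g) q) :
    ((xi ρ).f q).hom (twistedClass ρ g q t) =
      (⟨xiAvg ρ g t.1, xiAvg_mem t.2⟩ : piece k (𝟭 (Semidirect ρ)) q) :=
  coinvDescLin_class.{w₀, v, max w₀ u} (K := fun g => Hoch k (ρ.F g)) (a := hochAct ρ) (xiHom ρ)
    (hochAct_xiHom ρ) q g t

theorem isXi_xi : IsXi ρ (xi ρ) := by
  intro g n q c
  refine (xi_twistedClass ρ g q c.cls).trans (Subtype.ext ?_)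
  refine (xiAvg_apply g c.tens).trans ?_
  simp only [mapT_tens, xiT_tens]
  refine Eq.symm ((Submodule.coe_smul _ _).trans ?_)
  rw [Submodule.coe_sum]
  rfl

variable {ρ} in
theorem IsXi.unique {ξ ξ' : twistedHoch ρ ⟶ Hoch k (𝟭 (Semidirect ρ))} (h : IsXi ρ ξ)
    (h' : IsXi ρ ξ') : ξ' = ξ :=
  HomologicalComplex.hom_ext _ _ fun q => ModuleCat.hom_ext (twistedClass_ext fun g =>
    piece_linearMap_ext fun n c => (h' g n q c).trans (h g n q c).symm)

variable {ρ} in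
theorem nuT_mem (g : G) {q : ℤ} {t : TSum k (Semidirect ρ)}
    (ht : t ∈ piece k (𝟭 (Semidirect ρ)) q) : nuT ρ g t ∈ piece k (ρ.F g) q := by
  refine crossed_induction (P := fun t => nuT ρ g t ∈ piece k (ρ.F g) q) ht
    (by rw [map_zero]; exact zero_mem _) (fun s t hs ht => by rw [map_add]; exact add_mem hs ht)
    (fun a t ht => by rw [map_smul]; exact Submodule.smul_mem _ _ ht) fun n c => ?_
  rw [nuT_toChain]
  split_ifs with h
  · subst h
    exact c.nu.cls.2
  · exact zero_mem _

/-- The map `ν` in degree `q`. -/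
noncomputable def nuLin (q : ℤ) : piece k (𝟭 (Semidirect ρ)) q →ₗ[k] (twistedHoch ρ).X q :=
  ∑ g : G, twistedClass ρ g q ∘ₗ
    (nuT ρ g).restrict (p := piece k (𝟭 (Semidirect ρ)) q) (q := piece k (ρ.F g) q)
      fun _ ht => nuT_mem g ht

theorem nuLin_apply (q : ℤ) (t : piece k (𝟭 (Semidirect ρ)) q) :
    nuLin ρ q t = ∑ g : G, twistedClass ρ g q ⟨nuT ρ g t, nuT_mem g t.2⟩ := by
  rw [nuLin, LinearMap.sum_apply]
  rfl

theorem nuLin_eq_of_nuT {q : ℤ} {t : piece k (𝟭 (Semidirect ρ)) q} {g : G}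
    {s : piece k (ρ.F g) q} (hs : nuT ρ g t.1 = s.1) (h0 : ∀ g', g' ≠ g → nuT ρ g' t.1 = 0) :
    nuLin ρ q t = twistedClass ρ g q s := by
  rw [nuLin_apply, Finset.sum_eq_single g]
  · exact congrArg (twistedClass ρ g q) (Subtype.ext hs)
  · intro g' _ hg
    have e : (⟨nuT ρ g' t, nuT_mem g' t.2⟩ : piece k (ρ.F g') q) = 0 := Subtype.ext (h0 g' hg)
    rw [e, map_zero]
  · exact fun h => absurd (Finset.mem_univ _) h

theorem nuLin_toChain {n : ℕ} {q : ℤ} (c : CrossedChain ρ n q) :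
    nuLin ρ q c.toChain.cls = coinvCls ρ c.nu :=
  nuLin_eq_of_nuT ρ (s := c.nu.cls) ((nuT_toChain _ c).trans (if_pos rfl))
    fun _ hg => (nuT_toChain _ c).trans (if_neg hg.symm)

theorem nuLin_xiT {g : G} {q : ℤ} (t : piece k (ρ.F g) q) :
    nuLin ρ q ⟨xiT ρ g t.1, xiT_mem t.2⟩ = twistedClass ρ g q t :=
  nuLin_eq_of_nuT ρ ((nuT_xiT _ t.2).trans (if_pos rfl))
    fun _ hg => (nuT_xiT _ t.2).trans (if_neg hg.symm)

theorem xi_nuLin (q : ℤ) (t : piece k (𝟭 (Semidirect ρ)) q) :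
    (show piece k (𝟭 (Semidirect ρ)) q from ((xi ρ).f q).hom (nuLin ρ q t)).1 =
      ∑ g : G, xiAvg ρ g (nuT ρ g t) := by
  rw [nuLin_apply]
  have e := map_sum ((xi ρ).f q).hom
    (fun g => twistedClass ρ g q ⟨nuT ρ g t, nuT_mem g t.2⟩) Finset.univ
  simp only [xi_twistedClass] at e
  exact (congrArg Subtype.val e).trans (Submodule.coe_sum _ _ _)

variable {ρ}

/-- Both sides are linear, so labelled chains suffice; there the left side is the average of full
conjugates, which the prism homotopy connects with the chain. -/
theorem sum_xiAvg_nuT_eq (hG : (Fintype.card G : k) ≠ 0) {q : ℤ} {t : TSum k (Semidirect ρ)}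
    (ht : t ∈ piece k (𝟭 (Semidirect ρ)) q) :
    ∑ g : G, xiAvg ρ g (nuT ρ g t) = t - (totD k (𝟭 (Semidirect ρ)) (prismHomotopy k ρ t) +
      prismHomotopy k ρ (totD k (𝟭 (Semidirect ρ)) t)) := by
  refine crossed_induction (P := fun t => ∑ g : G, xiAvg ρ g (nuT ρ g t) =
    t - (totD k (𝟭 (Semidirect ρ)) (prismHomotopy k ρ t) +
      prismHomotopy k ρ (totD k (𝟭 (Semidirect ρ)) t))) ht (by simp)
    (fun s t hs ht => by simp only [map_add, Finset.sum_add_distrib, hs, ht]; abel)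
    (fun a t ht => by simp only [map_smul, ← Finset.smul_sum, ht, ← smul_add, ← smul_sub])
    fun n c => ?_
  rw [sum_xiAvg_nuT, c.toChain_tens_eq_tn, totD_prismHomotopy_add hG c.isCross, sub_sub_cancel]

theorem prismHomotopy_mem_piece {q r : ℤ} (hr : r + 1 = q) {t : TSum k (Semidirect ρ)}
    (ht : t ∈ piece k (𝟭 (Semidirect ρ)) q) :
    prismHomotopy k ρ t ∈ piece k (𝟭 (Semidirect ρ)) r := by
  refine crossed_induction (P := fun t => prismHomotopy k ρ t ∈ piece k (𝟭 (Semidirect ρ)) r) ht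
    (by rw [map_zero]; exact zero_mem _) (fun s t hs ht => by rw [map_add]; exact add_mem hs ht)
    (fun a t ht => by rw [map_smul]; exact Submodule.smul_mem _ _ ht) fun n c => ?_
  rw [c.toChain_tens_eq_tn]
  refine prismHomotopy_mem c.isCross ?_ hr
  rw [← c.deg, Finset.sum_range]
  simp

/-- Each summand of the symmetrisation is sent to the class of a translate of `x`, which is the
class of `x`; averaging |G| equal terms returns it. -/
theorem nuLin_xi (hG : (Fintype.card G : k) ≠ 0) (q : ℤ) (z : (twistedHoch ρ).X q) :
    nuLin ρ q (((xi ρ).f q).hom z) = z := by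
  suffices e : nuLin ρ q ∘ₗ ((xi ρ).f q).hom = LinearMap.id from LinearMap.congr_fun e z
  refine twistedClass_ext fun g => LinearMap.ext fun x => ?_
  change nuLin ρ q (((xi ρ).f q).hom (twistedClass ρ g q x)) = twistedClass ρ g q x
  have e : (⟨xiAvg ρ g x.1, xiAvg_mem x.2⟩ : piece k (𝟭 (Semidirect ρ)) q) =
      (Fintype.card G : k)⁻¹ • ∑ h : G, ⟨xiT ρ (h * g * h⁻¹) (mapT k (ρ.F h) x.1),
        xiT_mem (mapT_mem k (ρ.F h) (ρ.conj_comm h g) x.2)⟩ := by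
    refine Subtype.ext ((xiAvg_apply g x.1).trans ?_)
    rw [Submodule.coe_smul, Submodule.coe_sum]
  rw [xi_twistedClass, e, map_smul, map_sum]
  have e' : ∀ h : G, nuLin ρ q ⟨xiT ρ (h * g * h⁻¹) (mapT k (ρ.F h) x.1),
      xiT_mem (mapT_mem k (ρ.F h) (ρ.conj_comm h g) x.2)⟩ = twistedClass ρ g q x := fun h =>
    (nuLin_xiT ρ (g := h * g * h⁻¹)
      ⟨mapT k (ρ.F h) x.1, mapT_mem k (ρ.F h) (ρ.conj_comm h g) x.2⟩).trans
      (twistedClass_conj ρ h g q x)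
  rw [Finset.sum_congr rfl fun h _ => e' h, Finset.sum_const, Finset.card_univ,
    ← Nat.cast_smul_eq_nsmul k, inv_smul_smul₀ hG]

end Morphisms

/-! ### ν is a chain map, and ν and ξ are homotopy inverse -/

section Equivalence

variable {k : Type w₀} [Field k] {C : Type u} [Category.{v} C] [Preadditive C] [Linear k C]
  [DGCategory k C] {G : Type v} [Group G] [Fintype G] (ρ : StrongAction k G C)

theorem xi_injective (hG : (Fintype.card G : k) ≠ 0) (q : ℤ) :
    Function.Injective ((xi ρ).f q).hom :=
  Function.LeftInverse.injective (g := nuLin ρ q) (nuLin_xi hG q)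

/-- It suffices to compare after the injective chain map ξ. There ν becomes id - (dH + Hd), and both
sides reduce to dt - dHdt because d² = 0. -/
theorem nuLin_d (hG : (Fintype.card G : k) ≠ 0) (q r : ℤ) (h : q + 1 = r)
    (t : piece k (𝟭 (Semidirect ρ)) q) :
    ((twistedHoch ρ).d q r).hom (nuLin ρ q t) =
      nuLin ρ r (((Hoch k (𝟭 (Semidirect ρ))).d q r).hom t) := by
  refine xi_injective ρ hG r ?_
  have e1 : ((xi ρ).f r).hom (((twistedHoch ρ).d q r).hom (nuLin ρ q t)) =
      ((Hoch k (𝟭 (Semidirect ρ))).d q r).hom (((xi ρ).f q).hom (nuLin ρ q t)) :=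
    (congrArg (fun f => f.hom (nuLin ρ q t)) ((xi ρ).comm q r)).symm
  refine e1.trans (Subtype.ext ?_)
  refine (hoch_d_apply _ h _).trans ((congrArg _ ((xi_nuLin ρ q t).trans
    (sum_xiAvg_nuT_eq hG t.2))).trans ?_)
  refine Eq.trans ?_ ((xi_nuLin ρ r _).trans (sum_xiAvg_nuT_eq hG (Subtype.property _))).symm
  have e2 := hoch_d_apply (𝟭 (Semidirect ρ)) h t
  have e3 := totD_totD k (𝟭 (Semidirect ρ)) t.2
  have e4 := totD_totD k (𝟭 (Semidirect ρ)) (prismHomotopy_mem_piece (sub_add_cancel q 1) t.2)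
  rw [e2]
  simp only [map_sub, map_add, e3, e4, map_zero]
  abel

/-- The morphism `ν`. -/
noncomputable def nu (hG : (Fintype.card G : k) ≠ 0) :
    Hoch k (𝟭 (Semidirect ρ)) ⟶ twistedHoch ρ where
  f q := ModuleCat.ofHom (nuLin ρ q)
  comm' q r h := ModuleCat.hom_ext (LinearMap.ext fun t => nuLin_d ρ hG q r h t)

theorem isNu_nu (hG : (Fintype.card G : k) ≠ 0) : IsNu ρ (nu ρ hG) :=
  fun _ _ c => nuLin_toChain ρ c

variable {ρ}

theorem piece_linearMap_ext_crossed {q : ℤ} {P : Type*} [AddCommGroup P] [Module k P]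
    {φ ψ : piece k (𝟭 (Semidirect ρ)) q →ₗ[k] P}
    (h : ∀ (n : ℕ) (c : CrossedChain ρ n q), φ c.toChain.cls = ψ c.toChain.cls) : φ = ψ := by
  refine LinearMap.ext fun x => ?_
  suffices e : ∃ hx, φ ⟨x.1, hx⟩ = ψ ⟨x.1, hx⟩ from e.2
  refine crossed_induction (P := fun x => ∃ hx, φ ⟨x, hx⟩ = ψ ⟨x, hx⟩) x.2
    ⟨zero_mem _, (map_zero φ).trans (map_zero ψ).symm⟩ ?_ ?_ fun n c => ⟨c.toChain.cls.2, h n c⟩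
  · rintro s t ⟨hs, es⟩ ⟨ht, et⟩
    have e : (⟨s + t, add_mem hs ht⟩ : piece k (𝟭 (Semidirect ρ)) q) = ⟨s, hs⟩ + ⟨t, ht⟩ := rfl
    exact ⟨add_mem hs ht, by rw [e, map_add, map_add, es, et]⟩
  · rintro a t ⟨ht, et⟩
    have e : (⟨a • t, Submodule.smul_mem _ a ht⟩ : piece k (𝟭 (Semidirect ρ)) q) =
      a • ⟨t, ht⟩ := rfl
    exact ⟨Submodule.smul_mem _ a ht, by rw [e, map_smul, map_smul, et]⟩

theorem IsNu.unique {ν ν' : Hoch k (𝟭 (Semidirect ρ)) ⟶ twistedHoch ρ} (h : IsNu ρ ν)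
    (h' : IsNu ρ ν') : ν' = ν :=
  HomologicalComplex.hom_ext _ _ fun q => ModuleCat.hom_ext (piece_linearMap_ext_crossed fun n c =>
    (h' n q c).trans (h n q c).symm)

theorem xi_nu (hG : (Fintype.card G : k) ≠ 0) : xi ρ ≫ nu ρ hG = 𝟙 (twistedHoch ρ) :=
  HomologicalComplex.hom_ext _ _ fun q => ModuleCat.hom_ext (LinearMap.ext fun z =>
    nuLin_xi hG q z)

variable (ρ) in
/-- The contracting homotopy in degree `q`. -/
noncomputable def prismHom (q r : ℤ) :
    (Hoch k (𝟭 (Semidirect ρ))).X q ⟶ (Hoch k (𝟭 (Semidirect ρ))).X r :=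
  if h : r + 1 = q then
    -- The sign comes from the convention that a homotopy from ξν to id expresses ξν as id plus the
    -- boundary terms, while ξν = id - (dH + Hd).
    ModuleCat.ofHom ((-prismHomotopy k ρ).restrict fun _ ht =>
      neg_mem (prismHomotopy_mem_piece h ht))
  else 0

theorem prismHom_apply {q r : ℤ} (h : r + 1 = q) (t : piece k (𝟭 (Semidirect ρ)) q) :
    (show piece k (𝟭 (Semidirect ρ)) r from (prismHom ρ q r).hom t).1 =
      -prismHomotopy k ρ t.1 :=
  congrArg (fun f : (Hoch k (𝟭 (Semidirect ρ))).X q ⟶ (Hoch k (𝟭 (Semidirect ρ))).X r =>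
    (show piece k (𝟭 (Semidirect ρ)) r from f.hom t).1) (dif_pos h)

/-- The homotopy between `ξ ν` and the identity. -/
noncomputable def nuXiHomotopy (hG : (Fintype.card G : k) ≠ 0) :
    Homotopy (nu ρ hG ≫ xi ρ) (𝟙 (Hoch k (𝟭 (Semidirect ρ)))) where
  hom := prismHom ρ
  zero i j h := dif_neg h
  comm q := by
    rw [dNext_eq (prismHom ρ) (show (ComplexShape.up ℤ).Rel q (q + 1) from rfl),
      prevD_eq (prismHom ρ) (show (ComplexShape.up ℤ).Rel (q - 1) q from sub_add_cancel q 1)]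
    refine ModuleCat.hom_ext (LinearMap.ext fun t => Subtype.ext ?_)
    refine (xi_nuLin ρ q t).trans ((sum_xiAvg_nuT_eq hG (Subtype.property _)).trans ?_)
    have e1 := prismHom_apply (ρ := ρ) rfl
      (((Hoch k (𝟭 (Semidirect ρ))).d q (q + 1)).hom t)
    have e2 := hoch_d_apply (𝟭 (Semidirect ρ)) (sub_add_cancel q 1)
      ((prismHom ρ q (q - 1)).hom t)
    rw [hoch_d_apply (𝟭 (Semidirect ρ)) rfl t] at e1
    rw [prismHom_apply (sub_add_cancel q 1) t, map_neg] at e2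
    refine Eq.trans ?_ (congrArg₂ (· + ·) (congrArg₂ (· + ·) e1 e2) rfl).symm
    change _ = _ + t.1
    abel

end Equivalence

/-! ### Homology commutes with coinvariants when |G| is invertible -/

section CoinvariantHomology

universe t

variable {k : Type w₀} [Field k]

/-- The linear maps induced on homology, depending linearly on the morphism of complexes. -/
noncomputable def homologyLin (K L : CochainComplex (ModuleCat.{t} k) ℤ) (q : ℤ) :
    (K ⟶ L) →ₗ[k] (K.homology q →ₗ[k] L.homology q) where
  toFun f := (HomologicalComplex.homologyMap f q).hom
  map_add' f g := congrArg ModuleCat.Hom.hom (HomologicalComplex.homologyMap_add f g q)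
  map_smul' c f := congrArg ModuleCat.Hom.hom (ShortComplex.homologyMap_smul
    ((HomologicalComplex.shortComplexFunctor (ModuleCat.{t} k) (ComplexShape.up ℤ) q).map f) c)

theorem homologyLin_comp {K L M : CochainComplex (ModuleCat.{t} k) ℤ} (q : ℤ) (f : K ⟶ L)
    (g : L ⟶ M) : homologyLin K M q (f ≫ g) = homologyLin L M q g ∘ₗ homologyLin K L q f :=
  congrArg ModuleCat.Hom.hom (HomologicalComplex.homologyMap_comp f g q)

theorem homologyLin_id (K : CochainComplex (ModuleCat.{t} k) ℤ) (q : ℤ) :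
    homologyLin K K q (𝟙 K) = LinearMap.id :=
  congrArg ModuleCat.Hom.hom (HomologicalComplex.homologyMap_id K q)

variable {G : Type v} [Group G] [Fintype G]
variable (K : G → CochainComplex (ModuleCat.{max v t} k) ℤ) (a : ∀ h g : G, K g ⟶ K (h * g * h⁻¹))

/-- The component `K g' ⟶ K g` of the action of `h`. -/
noncomputable def actComponent (h g' g : G) : K g' ⟶ K g :=
  if e : h * g' * h⁻¹ = g then a h g' ≫ eqToHom (congrArg K e) else 0

/-- The component `K g' ⟶ K g` of the symmetrisation. -/
noncomputable def symComponent (g' g : G) : K g' ⟶ K g :=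
  (Fintype.card G : k)⁻¹ • ∑ h : G, actComponent K a h g' g

/-- Each h contributes to exactly one component, g = h g' h⁻¹, so summing over all targets removes
the dependent transport. It serves once for morphisms of complexes and once for classes in homology.
-/
theorem sum_symComponent {M : Type*} [AddCommGroup M] [Module k M] (g' : G)
    (T : ∀ g, (K g' ⟶ K g) →ₗ[k] M) : ∑ g, T g (symComponent K a g' g) =
      (Fintype.card G : k)⁻¹ • ∑ h : G, T (h * g' * h⁻¹) (a h g') := by
  simp only [symComponent, map_smul, map_sum, ← Finset.smul_sum]
  rw [Finset.sum_comm]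
  congr 1
  refine Finset.sum_congr rfl fun h _ => ?_
  rw [Finset.sum_eq_single (h * g' * h⁻¹)]
  · simp [actComponent]
  · intro g _ hg
    rw [actComponent, dif_neg hg.symm, map_zero]
  · exact fun h => absurd (Finset.mem_univ _) h

variable {K a}

/-- Multiplicativity of the action turns precomposition with `m` into the translation h ↦ h m of the
summation index. Hence the symmetrisation factors through the coinvariants. -/
theorem comp_symComponent (ha : ∀ h m g, a m g ≫ a h (m * g * m⁻¹) =
      a (h * m) g ≫ eqToHom (congrArg K (by group))) (m g' g : G) :
    a m g' ≫ symComponent K a (m * g' * m⁻¹) g = symComponent K a g' g := by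
  rw [symComponent, symComponent, Linear.comp_smul, Preadditive.comp_sum]
  congr 1
  rw [← Equiv.sum_comp (Equiv.mulRight m) fun h => actComponent K a h g' g]
  refine Finset.sum_congr rfl fun h _ => ?_
  have e : h * (m * g' * m⁻¹) * h⁻¹ = h * m * g' * (h * m)⁻¹ := by group
  rw [Equiv.coe_mulRight, actComponent, actComponent]
  by_cases hg : h * m * g' * (h * m)⁻¹ = g
  · rw [dif_pos hg, dif_pos (e.trans hg), ← Category.assoc, ha, Category.assoc, eqToHom_trans]
  · rw [dif_neg hg, dif_neg fun h' => hg (e.symm.trans h'), Limits.comp_zero]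

/-- The maps `s g` are the components of the symmetrisation on the coinvariant complex. Taking
homology of each and then classes gives the inverse; both composites are averages of |G| equal
terms. -/
theorem coinvHomologyMap_bijective (hG : (Fintype.card G : k) ≠ 0)
    (ha : ∀ h m g, a m g ≫ a h (m * g * m⁻¹) = a (h * m) g ≫ eqToHom (congrArg K (by group)))
    (q : ℤ) : Function.Bijective (coinvHomologyMap.{w₀, v, t} K a q) := by
  let s : ∀ g, coinvComplex.{w₀, v, max v t} K a ⟶ K g := fun g =>
    coinvDesc (fun g' => symComponent K a g' g) fun m g' => comp_symComponent ha m g' g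
  have hs : ∀ g' g, coinvIncl K a g' ≫ s g = symComponent K a g' g := fun g' g =>
    coinvIncl_desc _ _ g'
  have avg : ∀ {M : Type (max v t)} [AddCommGroup M] [Module k M] (x : M),
      (Fintype.card G : k)⁻¹ • ∑ _h : G, x = x := fun x => by
    rw [Finset.sum_const, Finset.card_univ, ← Nat.cast_smul_eq_nsmul k, inv_smul_smul₀ hG]
  have avg' : ∀ {A B : CochainComplex (ModuleCat.{max v t} k) ℤ} (x : A ⟶ B),
      (Fintype.card G : k)⁻¹ • ∑ _h : G, x = x := fun x => by
    rw [Finset.sum_const, Finset.card_univ, ← Nat.cast_smul_eq_nsmul k, inv_smul_smul₀ hG]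
  -- Symmetrising and projecting back is the identity already on complexes, since all translates
  -- have the same class.
  have hs1 : ∑ g, s g ≫ coinvIncl K a g = 𝟙 _ := by
    refine coinvComplex_hom_ext fun g' => ?_
    rw [Preadditive.comp_sum, Category.comp_id]
    simp only [← Category.assoc, hs]
    refine (sum_symComponent K a g' fun g =>
      (Linear.rightComp k (K g') (coinvIncl K a g))).trans ?_
    simp only [Linear.rightComp_apply, coinvIncl_conj]
    exact avg' _
  let mk : ∀ g, (K g).homology q →ₗ[k] CoinvHomology K a q := fun g =>
    coinvMk (fun g => (K g).homology q)
      (fun h g => (HomologicalComplex.homologyMap (a h g) q).hom) g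
  have mk_conj : ∀ h g x, mk (h * g * h⁻¹) (homologyLin _ _ q (a h g) x) = mk g x :=
    coinvMk_conj (fun g => (K g).homology q)
      (fun h g => (HomologicalComplex.homologyMap (a h g) q).hom)
  have hm : ∀ g x, coinvHomologyMap.{w₀, v, t} K a q (mk g x) =
      homologyLin _ _ q (coinvIncl K a g) x := fun g x =>
    coinvLift_mk (k := k) (M := fun g => (K g).homology q)
      (a := fun h g => (HomologicalComplex.homologyMap (a h g) q).hom) _ _ g x
  let ψ : (coinvComplex.{w₀, v, max v t} K a).homology q →ₗ[k] CoinvHomology K a q :=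
    ∑ g, mk g ∘ₗ homologyLin _ _ q (s g)
  have hψ : ∀ z, ψ z = ∑ g, mk g (homologyLin _ _ q (s g) z) := fun z => by
    simp only [ψ, LinearMap.sum_apply, LinearMap.comp_apply]
  have left : ψ ∘ₗ coinvHomologyMap.{w₀, v, t} K a q = LinearMap.id := by
    refine coinv_ext (k := k) (M := fun g => (K g).homology q)
      (a := fun h g => (HomologicalComplex.homologyMap (a h g) q).hom) fun g' x => ?_
    change ψ (coinvHomologyMap.{w₀, v, t} K a q (mk g' x)) = mk g' x
    rw [hm, hψ]
    simp only [← LinearMap.comp_apply, ← homologyLin_comp, hs]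
    refine (sum_symComponent K a g' fun g =>
      mk g ∘ₗ LinearMap.applyₗ x ∘ₗ homologyLin (K g') (K g) q).trans ?_
    exact (congrArg _ (Finset.sum_congr rfl fun h _ => mk_conj h g' x)).trans (avg _)
  have right : ∀ z, coinvHomologyMap.{w₀, v, t} K a q (ψ z) = z := fun z => by
    rw [hψ, map_sum]
    have e : ∀ g, coinvHomologyMap.{w₀, v, t} K a q (mk g (homologyLin _ _ q (s g) z)) =
        homologyLin _ _ q (s g ≫ coinvIncl K a g) z := fun g => by
      rw [hm, homologyLin_comp, LinearMap.comp_apply]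
    rw [Finset.sum_congr rfl fun g _ => e g, ← LinearMap.sum_apply, ← map_sum, hs1,
      homologyLin_id, LinearMap.id_apply]
  exact Function.bijective_iff_has_inverse.2 ⟨ψ, LinearMap.congr_fun left, right⟩

end CoinvariantHomology

/-! ### Application to the twisted Hochschild complexes -/

section TwistedHomology

variable {k : Type w₀} [Field k] {C : Type u} [Category.{v} C] [Preadditive C] [Linear k C]
  [DGCategory k C] {G : Type v} [Group G] (ρ : StrongAction k G C)

/-- All the complexes lie in the same space `TSum`, so transport along an equality of group elements
does not change the underlying tensor. -/
theorem hoch_eqToHom_apply {g g' : G} (e : g = g') (q : ℤ) (t : piece k (ρ.F g) q) :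
    (show piece k (ρ.F g') q from ((eqToHom (congrArg (fun g => Hoch k (ρ.F g)) e)).f q).hom t).1 =
      t.1 := by
  subst e
  rfl

theorem hochAct_comp (h m g : G) : hochAct ρ m g ≫ hochAct ρ h (m * g * m⁻¹) =
    hochAct ρ (h * m) g ≫ eqToHom (congrArg (fun g => Hoch k (ρ.F g)) (by group)) := by
  refine HomologicalComplex.hom_ext _ _ fun q => ModuleCat.hom_ext (LinearMap.ext fun t =>
    Subtype.ext ?_)
  refine (mapT_mapT ρ h m _).trans ?_
  exact (hoch_eqToHom_apply ρ (show h * m * g * (h * m)⁻¹ = h * (m * g * m⁻¹) * h⁻¹ by group) q 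
    (((hochAct ρ (h * m) g).f q).hom t)).symm

variable [Fintype G]

theorem twistedHHMap_bijective (hG : (Fintype.card G : k) ≠ 0) (q : ℤ) :
    Function.Bijective (twistedHHMap ρ q) :=
  coinvHomologyMap_bijective.{w₀, v, max w₀ u} hG (hochAct_comp ρ) q

/-- The isomorphism induced by `ν` on homology. -/
noncomputable def nuHomologyEquiv (hG : (Fintype.card G : k) ≠ 0) (q : ℤ) :
    HH k (𝟭 (Semidirect ρ)) q ≃ₗ[k] (twistedHoch ρ).homology q :=
  LinearEquiv.ofLinearMap (homologyLin _ _ q (nu ρ hG)) (homologyLin _ _ q (xi ρ))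
    (by rw [← homologyLin_comp, xi_nu, homologyLin_id])
    (by
      rw [← homologyLin_comp, ← homologyLin_id]
      exact congrArg ModuleCat.Hom.hom ((nuXiHomotopy hG).homologyMap_eq q))

end TwistedHomology

end DGHochschild

/-- For a small DG category `C` over a field `k` with a strong action of a finite group `G` whose
order is invertible in `k`, the maps `ν` and `ξ` are well-defined morphisms of complexes, uniquely
determined by their formulas, `ν ξ = id`, `ξ ν` is homotopic to `id`, and they induce mutually
inverse isomorphisms between `HH_•(C ⋊ G)` and `(⨁ g, HH_•(C; g))_G`, the latter being identified
with the homology of `(⨁ g, C_•(C; g))_G` through the canonical map. -/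
theorem proposition4p3 {k : Type w₀} [Field k] {C : Type u} [CategoryTheory.Category.{v} C]
    [CategoryTheory.Preadditive C] [CategoryTheory.Linear k C] [DGHochschild.DGCategory k C]
    {G : Type v} [Group G] [Fintype G] (hG : (Fintype.card G : k) ≠ 0)
    (ρ : DGHochschild.StrongAction k G C) :
    ∃ (ν : DGHochschild.Hoch k (𝟭 (DGHochschild.Semidirect ρ)) ⟶ DGHochschild.twistedHoch ρ)
      (ξ : DGHochschild.twistedHoch ρ ⟶ DGHochschild.Hoch k (𝟭 (DGHochschild.Semidirect ρ))),
      (DGHochschild.IsNu ρ ν ∧ ∀ ν', DGHochschild.IsNu ρ ν' → ν' = ν) ∧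
      (DGHochschild.IsXi ρ ξ ∧ ∀ ξ', DGHochschild.IsXi ρ ξ' → ξ' = ξ) ∧
      ξ ≫ ν = 𝟙 (DGHochschild.twistedHoch ρ) ∧
      Nonempty (Homotopy (ν ≫ ξ) (𝟙 (DGHochschild.Hoch k (𝟭 (DGHochschild.Semidirect ρ))))) ∧
      ∀ q : ℤ, Function.Bijective (DGHochschild.twistedHHMap ρ q) ∧
        ∃ e : DGHochschild.HH k (𝟭 (DGHochschild.Semidirect ρ)) q ≃ₗ[k]
            DGHochschild.TwistedHH ρ q,
          (∀ z, DGHochschild.twistedHHMap ρ q (e z) =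
            (HomologicalComplex.homologyMap ν q).hom z) ∧
          (∀ y, e.symm y =
            (HomologicalComplex.homologyMap ξ q).hom (DGHochschild.twistedHHMap ρ q y)) := by
  refine ⟨DGHochschild.nu ρ hG, DGHochschild.xi ρ,
    ⟨DGHochschild.isNu_nu ρ hG, fun _ h => (DGHochschild.isNu_nu ρ hG).unique h⟩,
    ⟨DGHochschild.isXi_xi ρ, fun _ h => (DGHochschild.isXi_xi ρ).unique h⟩,
    DGHochschild.xi_nu hG, ⟨DGHochschild.nuXiHomotopy hG⟩, fun q =>
    ⟨DGHochschild.twistedHHMap_bijective ρ hG q, ?_⟩⟩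
  -- The inverse of `nuHomologyEquiv` is by construction the map induced by ξ, so with this choice
  -- the formula for `e.symm` holds by definition.
  let E := LinearEquiv.ofBijective _ (DGHochschild.twistedHHMap_bijective ρ hG q)
  exact ⟨(DGHochschild.nuHomologyEquiv ρ hG q).trans E.symm,
    fun z => E.apply_symm_apply (DGHochschild.nuHomologyEquiv ρ hG q z), fun _ => rfl⟩
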